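/- Let $-\infty\le a<b\le\infty$, let $J\in\mathbb C^{n\times n}$ be invertible and skew-Hermitian, and let $q,w$ be $n\times n$ matrices of distributions of order $0$ on $(a,b)$, $q$ Hermitian and $w$ non-negative. Let $Q,W_0$ be left-continuous antiderivatives (of locally bounded variation) of $q,w$, put $\Delta_q(x)=Q^+(x)-Q^-(x)$, and assume that $2J\pm\Delta_q(x)$ is invertible for every $x\in(a,b)$. Assume that both endpoints are regular, i.e. $Q$ and $W_0$ are of bounded variation on $(a,c)$ and on $(c,b)$ for some $c\in(a,b)$. Let $\tilde W$ be the Radon–Nikodym derivative of $w$ with respect to $\operatorname{tr}w$, let $\mathcal L^2(w)$ be the space of functions $f:(a,b)\to\mathbb C^n$ with $\int f^*\tilde Wf\,\operatorname{tr}w<\infty$, and let $L^2(w)$ be the corresponding Hilbert space of classes, with $\langle f,g\rangle=\int f^*\tilde Wg\,\operatorname{tr}w$. A function $u:(a,b)\to\mathbb C^n$ of locally bounded variation is balanced if $u=(u^++u^-)/2$. Let $\mathcal T_{\max}$ be the set of all $(u,f)\in\mathcal L^2(w)\times\mathcal L^2(w)$ such that $u$ is balanced and of locally bounded variation and $Ju'+qu=wf$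 as distributions on $(a,b)$, and let $T_{\max}=\{([u],[f]):(u,f)\in\mathcal T_{\max}\}$. Every such $u$ has limits $u(a)$ and $u(b)$ at the endpoints. Put $D_{\pm i}=\{([u],\pm i[u])\in T_{\max}\}$ and $n_+=\dim D_i$. A self-adjoint restriction of $T_{\max}$ is a set $T\subset T_{\max}$ with $T=T^*$, where $T^*=\{(v,g):\langle g,u\rangle=\langle v,f\rangle\text{ for all }(u,f)\in T\}$. Fix $x_0\in(a,b)$ and let $\mathcal L_0$ be the space of balanced $u$ of locally bounded variation with $Ju'+qu=0$ and $wu=0$. For $([v],[g])\in T_{\max}$ let $E([v],[g])$ be the unique balanced representative $v$ of $[v]$ of locally bounded variation with $Jv'+qv=wg$ and $v(x_0)\perp\{y(x_0):y\in\mathcal L_0\}$. Let $W\subset\mathbb C^{2n}$ be the set of the vectors $\begin{pmatrix}v(a)\\ v(b)\end{pmatrix}$ with $v=E(p)$, $p\in D_i\oplus D_{-i}$, and let $\mathbb J=\begin{pmatrix}J&0\\0&-J\end{pmatrix}$. Suppose that $\tilde A\in\mathbb C^{n_+\times 2n}$ satisfies: (1) $\tilde A$ has full rank $n_+$; (2)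 $\mathbb J^{-1}\tilde A^*(\mathbb C^{n_+})\subset W$; (3) $\tilde A\mathbb J^{-1}\tilde A^*=0$. Then $$T=\Big\{([u],[f]):(u,f)\in\mathcal T_{\max},\ \tilde A\begin{pmatrix}u(a)\\u(b)\end{pmatrix}=0\Big\}$$ is a self-adjoint restriction of $T_{\max}$. Conversely, every self-adjoint restriction $T$ of $T_{\max}$ is of this form for some matrix $\tilde A\in\mathbb C^{n_+\times2n}$ with the properties (1), (2) and (3). -/

import Mathlib

open MeasureTheory Set Filter Topology
open scoped Distributions Matrix ComplexOrder

namespace DistSystem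

noncomputable section

/-! ### Distributions of order zero and their Lebesgue-Stieltjes measures -/

/-- The open interval `(a, b)` of real numbers; the endpoints may be infinite. -/
def interval (a b : EReal) : TopologicalSpace.Opens ℝ :=
  ⟨{x : ℝ | a < (x : EReal) ∧ (x : EReal) < b},
    (isOpen_lt continuous_const continuous_coe_real_ereal).inter
      (isOpen_lt continuous_coe_real_ereal continuous_const)⟩

/-- `n × n` matrices whose entries are complex distributions of order zero on `(a, b)`, in
Mathlib's sense (continuous linear functionals on the compactly supported continuous functions;
they are tested against real-valued functions, which determine them). -/
abbrev DistMatrix (a b : EReal) (n : ℕ) : Type :=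
  Matrix (Fin n) (Fin n) (𝓓'^{0}(interval a b, ℂ))

variable {a b : EReal} {n : ℕ}

/-- `Q` is a left-continuous antiderivative, of locally bounded variation on `(a, b)`, of the
distribution `q`, i.e. `q φ = - ∫ φ' Q` for all smooth test functions `φ`. It is unique on
`(a, b)` up to an additive constant. -/
def IsAntiderivative (q : 𝓓'^{0}(interval a b, ℂ)) (Q : ℝ → ℂ) : Prop :=
  LocallyBoundedVariationOn Q (interval a b) ∧
  (∀ x ∈ interval a b, ContinuousWithinAt Q (Iic x) x) ∧
  ∀ φ : 𝓓(interval a b, ℝ),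
    q (TestFunction.monoCLM ℝ φ) = - ∫ x, ((deriv φ x : ℝ) : ℂ) * Q x

open Classical in
/-- A left-continuous antiderivative of the distribution `q`. -/
def antideriv (q : 𝓓'^{0}(interval a b, ℂ)) : ℝ → ℂ :=
  if h : ∃ Q, IsAntiderivative q Q then h.choose else 0

/-- `Δ_q(x) = Q⁺(x) - Q⁻(x)`, for a matrix `q` of distributions with antiderivative `Q`. -/
def jump (q : DistMatrix a b n) (x : ℝ) : Matrix (Fin n) (Fin n) ℂ :=
  Matrix.of fun i j =>
    Function.rightLim (antideriv (q i j)) x - Function.leftLim (antideriv (q i j)) x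

/-- The endpoint `a` is regular for `q`: the antiderivatives of the entries of `q` are of bounded
variation on `(a, c)` for some `c ∈ (a, b)`. -/
def RegularLeft (q : DistMatrix a b n) : Prop :=
  ∃ c ∈ interval a b, ∀ i j, ∃ Q, IsAntiderivative (q i j) Q ∧
    BoundedVariationOn Q ((interval a b : Set ℝ) ∩ Iio c)

/-- The endpoint `b` is regular for `q`: the antiderivatives of the entries of `q` are of bounded
variation on `(c, b)` for some `c ∈ (a, b)`. -/
def RegularRight (q : DistMatrix a b n) : Prop :=
  ∃ c ∈ interval a b, ∀ i j, ∃ Q, IsAntiderivative (q i j) Q ∧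
    BoundedVariationOn Q ((interval a b : Set ℝ) ∩ Ioi c)

open Classical in
/-- The finite complex Lebesgue-Stieltjes measure `dF` on the open interval `I`, as a measure on
`ℝ` carried by `I`, for a function `F` of bounded variation on `I`: it gives the mass
`F⁺(d) - F⁻(c)` to `[c, d] ⊆ I`. (If `F` is of bounded variation on `I`, so is its extension by
zero; the masses of this extension at the endpoints of `I` are discarded.) -/
def stieltjes (I : Set ℝ) (F : ℝ → ℂ) : ComplexMeasure ℝ :=
  if h : BoundedVariationOn (I.indicator F) univ then h.vectorMeasure.restrict I else 0

/-- The complex measure on `(a, b)` corresponding to the distribution `q`, in the case where the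
antiderivative of `q` is of bounded variation on `(a, b)`, i.e. where both endpoints are
regular. -/
def distMeasure (q : 𝓓'^{0}(interval a b, ℂ)) : ComplexMeasure ℝ :=
  stieltjes (interval a b) (antideriv q)

/-- The value `(q f)(φ) = ∫ φ f dQ` of the distribution `q f` at the test function `φ`. -/
def mulPair (q : 𝓓'^{0}(interval a b, ℂ)) (f : ℝ → ℂ) (φ : 𝓓(interval a b, ℝ)) : ℂ :=
  (distMeasure q).integral (fun x => ((φ x : ℝ) : ℂ) * f x) (ContinuousLinearMap.mul ℝ ℂ)

/-- `q* = q` for a matrix of distributions. -/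
def IsHermitianDist (q : DistMatrix a b n) : Prop :=
  ∀ (i j : Fin n) (φ : 𝓓^{0}(interval a b, ℝ)), q i j φ = star (q j i φ)

/-- `w ≥ 0` for a matrix of distributions: `v* w v` is a non-negative distribution for every
`v ∈ ℂⁿ`. -/
def IsNonnegDist (w : DistMatrix a b n) : Prop :=
  ∀ (v : Fin n → ℂ) (φ : 𝓓^{0}(interval a b, ℝ)), (∀ x, 0 ≤ φ x) →
    0 ≤ ∑ i, ∑ j, star (v i) * w i j φ * v j

/-! ### The Hilbert space `L²(w)` -/

/-- The positive measure `tr w` (a non-negative complex measure is its own total variation). -/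
def traceMeasure (w : DistMatrix a b n) : Measure ℝ :=
  (∑ i, distMeasure (w i i)).variation

/-- The matrix of the Radon-Nikodym derivatives of the entries of `w` with respect to `tr w`. -/
def rnMatrix (w : DistMatrix a b n) (x : ℝ) : Matrix (Fin n) (Fin n) ℂ :=
  Matrix.of fun i j => ComplexMeasure.rnDeriv (distMeasure (w i j)) (traceMeasure w) x

open Classical in
/-- The version `W̃` of the Radon-Nikodym derivative of `w` with respect to `tr w` that is
non-negative everywhere (when `w ≥ 0`, the Radon-Nikodym derivative is non-negative almost
everywhere with respect to `tr w`, and `W̃` only changes it on a null set). -/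
def density (w : DistMatrix a b n) (x : ℝ) : Matrix (Fin n) (Fin n) ℂ :=
  if (rnMatrix w x).PosSemidef then rnMatrix w x else 0

lemma density_posSemidef (w : DistMatrix a b n) (x : ℝ) : (density w x).PosSemidef := by
  unfold density
  split_ifs with h
  · exact h
  · exact Matrix.PosSemidef.zero

/-- The integrand `f* W̃ g`. -/
def form (w : DistMatrix a b n) (f g : ℝ → Fin n → ℂ) (x : ℝ) : ℂ :=
  star (f x) ⬝ᵥ (density w x *ᵥ g x)

lemma form_add_left (w : DistMatrix a b n) (f f' g : ℝ → Fin n → ℂ) (x : ℝ) :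
    form w (f + f') g x = form w f g x + form w f' g x := by
  simp [form, add_dotProduct]

lemma form_add_right (w : DistMatrix a b n) (f g g' : ℝ → Fin n → ℂ) (x : ℝ) :
    form w f (g + g') x = form w f g x + form w f g' x := by
  simp [form, Matrix.mulVec_add]

lemma form_smul_left (w : DistMatrix a b n) (c : ℂ) (f g : ℝ → Fin n → ℂ) (x : ℝ) :
    form w (c • f) g x = star c * form w f g x := by
  simp [form]

lemma form_smul_right (w : DistMatrix a b n) (c : ℂ) (f g : ℝ → Fin n → ℂ) (x : ℝ) :
    form w f (c • g) x = c * form w f g x := by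
  simp [form, Matrix.mulVec_smul]

lemma form_self_nonneg (w : DistMatrix a b n) (f : ℝ → Fin n → ℂ) (x : ℝ) :
    0 ≤ form w f f x :=
  (density_posSemidef w x).dotProduct_mulVec_nonneg (f x)

lemma form_symm (w : DistMatrix a b n) (f g : ℝ → Fin n → ℂ) (x : ℝ) :
    star (form w g f x) = form w f g x := by
  unfold form
  rw [← Matrix.star_dotProduct, Matrix.star_mulVec, (density_posSemidef w x).1.eq,
    Matrix.dotProduct_mulVec]

lemma measurable_rnMatrix (w : DistMatrix a b n) (i j : Fin n) :
    Measurable fun x => rnMatrix w x i j := by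
  have h1 := SignedMeasure.measurable_rnDeriv
    (ComplexMeasure.re (distMeasure (w i j))) (traceMeasure w)
  have h2 := SignedMeasure.measurable_rnDeriv
    (ComplexMeasure.im (distMeasure (w i j))) (traceMeasure w)
  have h := (Complex.measurable_ofReal.comp h1).add
    ((Complex.measurable_ofReal.comp h2).mul_const Complex.I)
  convert h using 1
  funext x
  apply Complex.ext <;> simp [rnMatrix, ComplexMeasure.rnDeriv]

lemma measurable_density (w : DistMatrix a b n) (i j : Fin n) :
    Measurable fun x => density w x i j := by
  have hcl : IsClosed {A : Fin n → Fin n → ℂ | Matrix.PosSemidef (Matrix.of A)} := by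
    have : {A : Fin n → Fin n → ℂ | Matrix.PosSemidef (Matrix.of A)} =
        {A | (Matrix.of A)ᴴ = Matrix.of A} ∩
          ⋂ v : Fin n → ℂ, {A | 0 ≤ star v ⬝ᵥ (Matrix.of A *ᵥ v)} := by
      ext A
      simp only [mem_ofPred_eq, mem_inter_iff, mem_iInter]
      exact ⟨fun h => ⟨h.1, h.dotProduct_mulVec_nonneg⟩,
        fun h => Matrix.PosSemidef.of_dotProduct_mulVec_nonneg h.1 h.2⟩
    rw [this]
    have hof : Continuous fun A : Fin n → Fin n → ℂ => Matrix.of A := continuous_id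
    refine (isClosed_eq (Continuous.matrix_conjTranspose hof) hof).inter
      (isClosed_iInter fun v => ?_)
    exact isClosed_le continuous_const
      (continuous_const.dotProduct (hof.matrix_mulVec continuous_const))
  have hm : Measurable (β := Fin n → Fin n → ℂ) (rnMatrix w) :=
    measurable_pi_iff.2 fun i => measurable_pi_iff.2 fun j => measurable_rnMatrix w i j
  have hs : MeasurableSet {x | (rnMatrix w x).PosSemidef} := hm hcl.measurableSet
  have heq : (fun x => density w x i j) =
      {x | (rnMatrix w x).PosSemidef}.indicator fun x => rnMatrix w x i j := by
    funext x
    by_cases h : (rnMatrix w x).PosSemidef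
    · rw [indicator_of_mem (show x ∈ {x | (rnMatrix w x).PosSemidef} from h), density, if_pos h]
    · rw [indicator_of_notMem (show x ∉ {x | (rnMatrix w x).PosSemidef} from h), density,
        if_neg h]
      rfl
  rw [heq]
  exact (measurable_rnMatrix w i j).indicator hs

lemma aestronglyMeasurable_form (w : DistMatrix a b n) {f g : ℝ → Fin n → ℂ} {μ : Measure ℝ}
    (hf : AEStronglyMeasurable f μ) (hg : AEStronglyMeasurable g μ) :
    AEStronglyMeasurable (form w f g) μ := by
  have hf' : ∀ i, AEStronglyMeasurable (fun x => f x i) μ := fun i => (continuous_apply i).comp_aestronglyMeasurable hf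
  have hg' : ∀ i, AEStronglyMeasurable (fun x => g x i) μ := fun i => (continuous_apply i).comp_aestronglyMeasurable hg
  unfold form
  simp only [dotProduct, Matrix.mulVec, Pi.star_apply]
  refine Finset.aestronglyMeasurable_fun_sum _ fun i _ => ?_
  refine (hf' i).star.mul (Finset.aestronglyMeasurable_fun_sum _ fun j _ => ?_)
  exact (measurable_density w i j).aestronglyMeasurable.mul (hg' j)

lemma norm_form_add_le (w : DistMatrix a b n) (f g : ℝ → Fin n → ℂ) (x : ℝ) :
    ‖form w (f + g) (f + g) x‖ ≤ 2 * ‖form w f f x‖ + 2 * ‖form w g g x‖ := by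
  have h1 := form_self_nonneg w (f + g) x
  have h2 := form_self_nonneg w (f + (-1 : ℂ) • g) x
  have h3 := form_self_nonneg w f x
  have h4 := form_self_nonneg w g x
  have key : form w (f + g) (f + g) x + form w (f + (-1 : ℂ) • g) (f + (-1 : ℂ) • g) x =
      2 * form w f f x + 2 * form w g g x := by
    simp only [form_add_left, form_add_right, form_smul_left, form_smul_right, star_neg, star_one]
    ring
  rw [← Complex.re_eq_norm.2 h1, ← Complex.re_eq_norm.2 h3, ← Complex.re_eq_norm.2 h4]
  have hr := congrArg Complex.re key
  have := (Complex.le_def.1 h2).1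
  simp only [Complex.add_re, Complex.mul_re, Complex.re_ofNat, Complex.im_ofNat, zero_mul,
    sub_zero, Complex.zero_re] at hr this
  linarith

variable (w : DistMatrix a b n)

/-- The space `𝓛²(w)` of (measurable) functions `f` with `∫ f* W̃ f tr w < ∞`. The values of `f`
outside `(a, b)` are irrelevant, since `tr w` is carried by `(a, b)`. -/
def preL2 : Submodule ℂ (ℝ → Fin n → ℂ) where
  carrier := {f | AEStronglyMeasurable f (traceMeasure w) ∧
    Integrable (form w f f) (traceMeasure w)}
  zero_mem' := by
    refine ⟨aestronglyMeasurable_zero, ?_⟩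
    have : form w 0 0 = 0 := by funext x; simp [form]
    rw [this]
    exact integrable_zero _ _ _
  add_mem' := by
    rintro f g ⟨hf, hf'⟩ ⟨hg, hg'⟩
    refine ⟨hf.add hg, ((hf'.norm.const_mul 2).add (hg'.norm.const_mul 2)).mono'
      (aestronglyMeasurable_form w (hf.add hg) (hf.add hg)) (Eventually.of_forall fun x => ?_)⟩
    exact norm_form_add_le w f g x
  smul_mem' := by
    rintro c f ⟨hf, hf'⟩
    refine ⟨hf.const_smul c, ?_⟩
    have : form w (c • f) (c • f) = fun x => (star c * c) * form w f f x := by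
      funext x
      rw [form_smul_left, form_smul_right, mul_assoc]
    rw [this]
    exact hf'.const_mul _

lemma integrable_form {f g : ℝ → Fin n → ℂ} (hf : f ∈ preL2 w) (hg : g ∈ preL2 w) :
    Integrable (form w f g) (traceMeasure w) := by
  have h : ∀ c : ℂ, Integrable (form w (f + c • g) (f + c • g)) (traceMeasure w) := fun c =>
    ((preL2 w).add_mem hf ((preL2 w).smul_mem c hg)).2
  have key : form w f g = fun x => (1 / 4 : ℂ) *
      (form w (f + (1 : ℂ) • g) (f + (1 : ℂ) • g) x
        - form w (f + (-1 : ℂ) • g) (f + (-1 : ℂ) • g) x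
        - Complex.I * form w (f + Complex.I • g) (f + Complex.I • g) x
        + Complex.I * form w (f + (-Complex.I) • g) (f + (-Complex.I) • g) x) := by
    funext x
    simp only [form_add_left, form_add_right, form_smul_left, form_smul_right, star_neg, star_one,
      Complex.star_def, Complex.conj_I]
    ring_nf
    simp only [Complex.I_sq]
    ring
  rw [key]
  exact ((((h _).sub (h _)).sub ((h _).const_mul _)).add ((h _).const_mul _)).const_mul _

/-- The type of elements of `𝓛²(w)`, with its semi-norm. -/
def PreL2 : Type := preL2 w

instance : AddCommGroup (PreL2 w) := inferInstanceAs (AddCommGroup (preL2 w))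

instance : Module ℂ (PreL2 w) := inferInstanceAs (Module ℂ (preL2 w))

variable {w}

/-- An element of `𝓛²(w)` as a function. -/
def PreL2.toFun (f : PreL2 w) : ℝ → Fin n → ℂ := Subtype.val (p := fun f => f ∈ preL2 w) f

lemma PreL2.mem (f : PreL2 w) : f.toFun ∈ preL2 w := Subtype.property (p := fun f => f ∈ preL2 w) f

lemma PreL2.toFun_add (f g : PreL2 w) : (f + g).toFun = f.toFun + g.toFun := rfl

lemma PreL2.toFun_smul (c : ℂ) (f : PreL2 w) : (c • f).toFun = c • f.toFun := rfl

variable (w)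

/-- The semi-scalar product `⟨f, g⟩ = ∫ f* W̃ g tr w`, linear in the second entry. -/
instance preL2Core : PreInnerProductSpace.Core ℂ (PreL2 w) where
  inner f g := ∫ x, form w f.toFun g.toFun x ∂(traceMeasure w)
  conj_inner_symm f g := by
    rw [← integral_conj]
    exact integral_congr_ae (Eventually.of_forall fun x => form_symm w f.toFun g.toFun x)
  re_inner_nonneg f := by
    have h := integral_re (integrable_form w f.mem f.mem)
    refine le_of_le_of_eq ?_ h
    exact integral_nonneg fun x => (Complex.le_def.1 (form_self_nonneg w f.toFun x)).1
  add_left f g h := by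
    rw [← integral_add (integrable_form w f.mem h.mem) (integrable_form w g.mem h.mem)]
    exact integral_congr_ae
      (Eventually.of_forall fun x => form_add_left w f.toFun g.toFun h.toFun x)
  smul_left f g c := by
    rw [← integral_const_mul]
    exact integral_congr_ae
      (Eventually.of_forall fun x => form_smul_left w c f.toFun g.toFun x)

instance : SeminormedAddCommGroup (PreL2 w) :=
  InnerProductSpace.Core.toSeminormedAddCommGroup (𝕜 := ℂ)

instance : InnerProductSpace ℂ (PreL2 w) := InnerProductSpace.ofCore (preL2Core w)

/-- The space `L²(w)`: elements of `𝓛²(w)` are identified when their difference has norm zero. -/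
abbrev L2 : Type := SeparationQuotient (PreL2 w)

variable {w}

/-- The class `[f] ∈ L²(w)` of `f ∈ 𝓛²(w)`. -/
def toL2 (f : ℝ → Fin n → ℂ) (hf : f ∈ preL2 w) : L2 w :=
  SeparationQuotient.mk (⟨f, hf⟩ : PreL2 w)

/-! ### The differential equation and the maximal relation -/

/-- `u ∈ BV^#_loc((a, b))ⁿ`: `u` is of locally bounded variation on `(a, b)` and balanced,
`u = (u⁺ + u⁻) / 2`. -/
def IsBalancedBV (a b : EReal) (u : ℝ → Fin n → ℂ) : Prop :=
  LocallyBoundedVariationOn u (interval a b) ∧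
  ∀ x ∈ interval a b, u x = (1 / 2 : ℂ) • (Function.rightLim u x + Function.leftLim u x)

/-- The value `∫ φ W̃ f tr w ∈ ℂⁿ` of the vector-valued distribution `w f` at the test
function `φ`. -/
def weightPair (w : DistMatrix a b n) (f : ℝ → Fin n → ℂ) (φ : 𝓓(interval a b, ℝ)) :
    Fin n → ℂ :=
  fun i => ∫ x, ((φ x : ℝ) : ℂ) * (density w x *ᵥ f x) i ∂(traceMeasure w)

/-- `J u' + q u = w f` in the sense of distributions on `(a, b)`. -/
def SolvesEquation (J : Matrix (Fin n) (Fin n) ℂ) (q w : DistMatrix a b n)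
    (u f : ℝ → Fin n → ℂ) : Prop :=
  ∀ (φ : 𝓓(interval a b, ℝ)) (i : Fin n),
    -(∫ x, ((deriv φ x : ℝ) : ℂ) * (J *ᵥ u x) i) +
      ∑ j, mulPair (q i j) (fun x => u x j) φ = weightPair w f φ i

/-- `T_max = {([u], [f]) : u, f ∈ 𝓛²(w), u ∈ BV^#_loc((a, b))ⁿ, J u' + q u = w f}`. -/
def Tmax (J : Matrix (Fin n) (Fin n) ℂ) (q w : DistMatrix a b n) : Set (L2 w × L2 w) :=
  {p | ∃ (u f : ℝ → Fin n → ℂ) (hu : u ∈ preL2 w) (hf : f ∈ preL2 w),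
    IsBalancedBV a b u ∧ SolvesEquation J q w u f ∧ p = (toL2 u hu, toL2 f hf)}

/-- The adjoint `S* = {(v, g) : ⟨g, u⟩ = ⟨v, f⟩ for all (u, f) ∈ S}` of a relation `S` in
`H × H`. -/
def relAdjoint {H : Type*} [SeminormedAddCommGroup H] [InnerProductSpace ℂ H] (S : Set (H × H)) :
    Set (H × H) :=
  {p | ∀ r ∈ S, inner ℂ p.2 r.1 = inner ℂ p.1 r.2}

/-- `T` is a self-adjoint restriction of `T_max`: `T ⊆ T_max` and `T = T*` (the latter makes `T`
a closed linear subspace). -/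
def IsSelfAdjointRestriction (J : Matrix (Fin n) (Fin n) ℂ) (q w : DistMatrix a b n)
    (T : Set (L2 w × L2 w)) : Prop :=
  T ⊆ Tmax J q w ∧ T = relAdjoint T

/-- The deficiency space `D_μ = {([u], μ [u]) ∈ T_max}`. -/
def deficiencySpace (J : Matrix (Fin n) (Fin n) ℂ) (q w : DistMatrix a b n) (μ : ℂ) :
    Set (L2 w × L2 w) :=
  {p | p ∈ Tmax J q w ∧ p.2 = μ • p.1}

/-- The deficiency index `n₊ = dim D_i` (`D_i` is a linear subspace, equal to its span). -/
def nPlus (J : Matrix (Fin n) (Fin n) ℂ) (q w : DistMatrix a b n) : ℕ :=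
  Set.finrank ℂ (deficiencySpace J q w Complex.I)

/-! ### Evaluation and boundary values -/

/-- `𝓛₀ = {u ∈ BV^#_loc((a, b))ⁿ : J u' + q u = 0, w u = 0}`. -/
def nullSolutions (J : Matrix (Fin n) (Fin n) ℂ) (q w : DistMatrix a b n) :
    Set (ℝ → Fin n → ℂ) :=
  {u | IsBalancedBV a b u ∧ SolvesEquation J q w u 0 ∧ ∀ φ, weightPair w u φ = 0}

/-- `v = E([u], [f])` for `p = ([u], [f]) ∈ T_max` and the evaluation operator `E` with base point
`x₀`: `v` is the balanced representative of `[u]` with `J v' + q v = w f` and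
`v(x₀) ⟂ {y(x₀) : y ∈ 𝓛₀}`. -/
def IsEvaluation (J : Matrix (Fin n) (Fin n) ℂ) (q w : DistMatrix a b n) (x₀ : ℝ)
    (p : L2 w × L2 w) (v : ℝ → Fin n → ℂ) : Prop :=
  (∃ (f : ℝ → Fin n → ℂ) (hv : v ∈ preL2 w) (hf : f ∈ preL2 w),
    IsBalancedBV a b v ∧ SolvesEquation J q w v f ∧ p = (toL2 v hv, toL2 f hf)) ∧
  ∀ y ∈ nullSolutions J q w, star (y x₀) ⬝ᵥ v x₀ = 0

/-- `z = (u(a), u(b))`: the components of `z ∈ ℂⁿ × ℂⁿ = ℂ²ⁿ` are the limits of `u` at the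
endpoints `a` and `b` (taken from inside `(a, b)`). -/
def HasBoundaryValues (a b : EReal) (u : ℝ → Fin n → ℂ) (z : Fin n ⊕ Fin n → ℂ) : Prop :=
  Tendsto u (comap (fun x : ℝ => (x : EReal)) (𝓝[>] a)) (𝓝 fun i => z (Sum.inl i)) ∧
  Tendsto u (comap (fun x : ℝ => (x : EReal)) (𝓝[<] b)) (𝓝 fun i => z (Sum.inr i))

/-- The space `W` of the boundary values of `E([v], [g])` for `([v], [g]) ∈ D_i ⊕ D_{-i}`. -/
def boundarySpace (J : Matrix (Fin n) (Fin n) ℂ) (q w : DistMatrix a b n) (x₀ : ℝ) :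
    Set (Fin n ⊕ Fin n → ℂ) :=
  {z | ∃ p ∈ deficiencySpace J q w Complex.I, ∃ p' ∈ deficiencySpace J q w (-Complex.I),
    ∃ v, IsEvaluation J q w x₀ (p + p') v ∧ HasBoundaryValues a b v z}

/-- The block matrix `𝕁 = diag(J, -J)`. -/
def blockJ (J : Matrix (Fin n) (Fin n) ℂ) : Matrix (Fin n ⊕ Fin n) (Fin n ⊕ Fin n) ℂ :=
  Matrix.fromBlocks J 0 0 (-J)

/-- The relation `{([u], [f]) : (u, f) ∈ 𝓣_max, A (u(a), u(b))ᵀ = 0}` given by a matrix `A` with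
`2n` columns. -/
def boundaryRelation (J : Matrix (Fin n) (Fin n) ℂ) (q w : DistMatrix a b n) {m : ℕ}
    (A : Matrix (Fin m) (Fin n ⊕ Fin n) ℂ) : Set (L2 w × L2 w) :=
  {p | ∃ (u f : ℝ → Fin n → ℂ) (hu : u ∈ preL2 w) (hf : f ∈ preL2 w),
    (IsBalancedBV a b u ∧ SolvesEquation J q w u f ∧ p = (toL2 u hu, toL2 f hf)) ∧
    ∃ z, HasBoundaryValues a b u z ∧ A *ᵥ z = 0}

/-- The properties of a matrix `A` of boundary conditions: (1) `A` has full rank `n₊`,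
(2) `𝕁⁻¹ A* y ∈ W` for all `y`, (3) `A 𝕁⁻¹ A* = 0`. -/
def IsBoundaryMatrix (J : Matrix (Fin n) (Fin n) ℂ) (q w : DistMatrix a b n) (x₀ : ℝ)
    (A : Matrix (Fin (nPlus J q w)) (Fin n ⊕ Fin n) ℂ) : Prop :=
  A.rank = nPlus J q w ∧
  (∀ y, ((blockJ J)⁻¹ * Aᴴ) *ᵥ y ∈ boundarySpace J q w x₀) ∧
  A * (blockJ J)⁻¹ * Aᴴ = 0

end

end DistSystem

/-! The theorem is symplectic linear algebra on the space ℂ²ⁿ of boundary values. For two pairs (u,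
f), (v, g) of 𝓣_max with boundary values z, z', Green's formula reads ⟨v, f⟩ - ⟨g, u⟩ = -z'* 𝕁 z, so
symmetry of a restriction is isotropy of its boundary values for the form of 𝕁. Let R be the space
of all boundary values, N the boundary values of the pairs that represent zero in L²(w) × L²(w), and
W those of the normalized representatives of D_i ⊕ D_{-i}; write ⊥ for orthogonality with respect to
𝕁.

Three facts carry the argument, in the abstract setting of `BoundarySystem`. First, R = N⊥
(`range_eq`), and the self-adjoint restrictions are those given by the spaces L with N ≤ L = L⊥
(`restriction_eq_relAdjoint` and the proof of `exists_eq_restriction`). Second, von Neumann's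
decomposition gives R = W ⊕ N (`range_eq_sup`, `disjoint_defectBdry`). Third, n₊ + dim N = n
(`two_mul_finrank_defect_add`): the form i z* 𝕁 z has signature (n, n), is non-negative on the
boundary values of D_i plus N and non-positive on those of D_{-i} plus N, which bounds both
dimensions by n, while dim R + dim N = 2n forces equality. Consequently V ↦ V ⊕ N and L ↦ L ∩ W
relate the isotropic V ≤ W of dimension n₊ to the Lagrangian spaces L containing N. The matrix A
encodes V = 𝕁⁻¹ A* ℂ^{n₊}: the equation A z = 0 says z ∈ V⊥, and inside R = N⊥ this means z ∈ (V ⊕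
N)⊥ = V ⊕ N.

The analysis provides the hypotheses of this scheme. All coefficients have densities with respect to
one finite measure, so the equation becomes u = c + ∫ J⁻¹ (F - k u) with balanced integration.
Invertibility of 2J + Δ_q removes the implicit dependence at atoms and leaves a Volterra equation
(`exists_volterra`, `exists_globalSol`). Every distributional solution arises in this way
(`solvesEquation_iff`, `IsSol.exists_globalSol`), hence has boundary values, and integration by
parts for balanced primitives gives Green's formula. Solvability for every right-hand side and every
value at the left end yields R = N⊥ and the inclusion of the adjoint of the minimal relation in
T_max (`BoundarySystem.ofInitialValues`). Completeness of L²(w) (`completeSpace_preL2`) enters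
through the orthogonal projection in von Neumann's decomposition. -/

namespace DistSystem

noncomputable section

/-! ### Orthogonality for skew-Hermitian forms on ℂ^ι -/

section Symplectic

variable {ι : Type*} [Fintype ι]

/-- The orthogonal complement of `S` with respect to the sesquilinear form `s* M z`. -/
def formPerp (M : Matrix ι ι ℂ) (S : Submodule ℂ (ι → ℂ)) : Submodule ℂ (ι → ℂ) where
  carrier := {z | ∀ s ∈ S, star s ⬝ᵥ (M *ᵥ z) = 0}
  zero_mem' := by simp
  add_mem' := by
    intro x y hx hy _ hs
    rw [Matrix.mulVec_add, dotProduct_add, hx _ hs, hy _ hs, add_zero]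
  smul_mem' := by
    intro c x hx s hs
    rw [Matrix.mulVec_smul, dotProduct_smul, hx s hs, smul_zero]

lemma mem_formPerp {M : Matrix ι ι ℂ} {S : Submodule ℂ (ι → ℂ)} {z : ι → ℂ} :
    z ∈ formPerp M S ↔ ∀ s ∈ S, star s ⬝ᵥ (M *ᵥ z) = 0 := Iff.rfl

lemma formPerp_anti {M : Matrix ι ι ℂ} {S S' : Submodule ℂ (ι → ℂ)} (h : S ≤ S') :
    formPerp M S' ≤ formPerp M S := fun _ hz s hs => hz s (h hs)

lemma formPerp_sup {M : Matrix ι ι ℂ} (S S' : Submodule ℂ (ι → ℂ)) :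
    formPerp M (S ⊔ S') = formPerp M S ⊓ formPerp M S' := by
  refine le_antisymm (le_inf (formPerp_anti le_sup_left) (formPerp_anti le_sup_right)) ?_
  rintro z ⟨h1, h2⟩ _ hs
  obtain ⟨x, hx, y, hy, rfl⟩ := Submodule.mem_sup.1 hs
  rw [star_add, add_dotProduct, h1 x hx, h2 y hy, add_zero]

lemma form_skew {M : Matrix ι ι ℂ} (hM : Mᴴ = -M) (x y : ι → ℂ) :
    star x ⬝ᵥ (M *ᵥ y) = -star (star y ⬝ᵥ (M *ᵥ x)) := by
  rw [← Matrix.star_dotProduct, Matrix.star_mulVec, hM, Matrix.vecMul_neg, neg_dotProduct, neg_neg,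
    ← Matrix.dotProduct_mulVec]

lemma form_eq_zero_symm {M : Matrix ι ι ℂ} (hM : Mᴴ = -M) {x y : ι → ℂ}
    (h : star x ⬝ᵥ (M *ᵥ y) = 0) : star y ⬝ᵥ (M *ᵥ x) = 0 := by
  rw [form_skew hM, h, star_zero, neg_zero]

lemma le_formPerp_comm {M : Matrix ι ι ℂ} (hM : Mᴴ = -M) {S S' : Submodule ℂ (ι → ℂ)}
    (h : S ≤ formPerp M S') : S' ≤ formPerp M S :=
  fun _ hx _ hs => form_eq_zero_symm hM (h hs _ hx)

lemma le_formPerp_formPerp {M : Matrix ι ι ℂ} (hM : Mᴴ = -M) (S : Submodule ℂ (ι → ℂ)) :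
    S ≤ formPerp M (formPerp M S) := le_formPerp_comm hM le_rfl

/-- The space `formPerp M S` is the preimage under the invertible `M` of the Euclidean orthogonal
complement of `S`. The transport to `EuclideanSpace` is needed because `ι → ℂ` carries the sup norm.
-/
lemma finrank_formPerp [DecidableEq ι] {M : Matrix ι ι ℂ} (hM : IsUnit M)
    (S : Submodule ℂ (ι → ℂ)) :
    Module.finrank ℂ S + Module.finrank ℂ (formPerp M S) = Fintype.card ι := by
  let e : (ι → ℂ) ≃ₗ[ℂ] EuclideanSpace ℂ ι := (WithLp.linearEquiv 2 ℂ (ι → ℂ)).symm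
  let g : (ι → ℂ) ≃ₗ[ℂ] (ι → ℂ) := LinearEquiv.ofInjectiveEndo M.mulVecLin
    (Matrix.mulVec_injective_of_isUnit hM)
  have hg : ∀ z, g z = M *ᵥ z := fun z => rfl
  let S' := S.map (e : (ι → ℂ) →ₗ[ℂ] EuclideanSpace ℂ ι)
  have h1 : formPerp M S =
      S'ᗮ.comap ((g.trans e : (ι → ℂ) ≃ₗ[ℂ] EuclideanSpace ℂ ι) :
        (ι → ℂ) →ₗ[ℂ] EuclideanSpace ℂ ι) := by
    ext z
    simp only [mem_formPerp, Submodule.mem_comap, Submodule.mem_orthogonal, S', Submodule.mem_map,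
      forall_exists_index, and_imp, forall_apply_eq_imp_iff₂, LinearEquiv.coe_coe]
    refine forall₂_congr fun _ _ => ?_
    rw [EuclideanSpace.inner_eq_star_dotProduct, dotProduct_comm]
    rfl
  have h2 := Submodule.finrank_add_finrank_orthogonal S'
  rw [h1, Submodule.comap_equiv_eq_map_symm, LinearEquiv.finrank_map_eq,
    ← LinearEquiv.finrank_map_eq e S, h2, finrank_euclideanSpace]

lemma formPerp_formPerp [DecidableEq ι] {M : Matrix ι ι ℂ} (hM : IsUnit M) (hM' : Mᴴ = -M)
    (S : Submodule ℂ (ι → ℂ)) : formPerp M (formPerp M S) = S := by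
  refine (Submodule.eq_of_le_of_finrank_le (le_formPerp_formPerp hM' S) ?_).symm
  have h1 := finrank_formPerp hM S
  have h2 := finrank_formPerp hM (formPerp M S)
  omega

/-- Orthogonal projection in coordinates: `formPerp 1` is the Hermitian orthogonal complement,
disjoint from `S` by definiteness and complementary to it by dimension. -/
lemma exists_sub_mem_orthogonal [DecidableEq ι] (S : Submodule ℂ (ι → ℂ)) (z : ι → ℂ) :
    ∃ y ∈ S, ∀ s ∈ S, star s ⬝ᵥ (z - y) = 0 := by
  have hd : Disjoint S (formPerp 1 S) := by
    rw [Submodule.disjoint_def]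
    intro x hx hx'
    have := hx' x hx
    rwa [Matrix.one_mulVec, dotProduct_star_self_eq_zero] at this
  have ht : S ⊔ formPerp 1 S = ⊤ := by
    apply Submodule.eq_top_of_finrank_eq
    have h1 := Submodule.finrank_sup_add_finrank_inf_eq S (formPerp 1 S)
    rw [hd.eq_bot, finrank_bot, add_zero, finrank_formPerp isUnit_one] at h1
    rw [h1, Module.finrank_fintype_fun_eq_card]
  obtain ⟨y, hy, x, hx, rfl⟩ := Submodule.mem_sup.1 (ht ▸ Submodule.mem_top : z ∈ S ⊔ formPerp 1 S)
  refine ⟨y, hy, fun s hs => ?_⟩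
  have := hx s hs
  rwa [add_sub_cancel_left, ← Matrix.one_mulVec x]

end Symplectic

/-! ### Abstract boundary systems and their self-adjoint restrictions -/

/-- A Hilbert space relation given by two linear maps `c₁, c₂ : P → H`, with boundary values `β`
satisfying Green's identity for the form of the matrix `M`, and with an evaluation `ev` that
detects the boundary values of the elements representing zero. -/
structure BoundarySystem (P H ι κ : Type*) [AddCommGroup P] [Module ℂ P] [NormedAddCommGroup H]
    [InnerProductSpace ℂ H] [Fintype ι] [DecidableEq ι] [Fintype κ] (M : Matrix ι ι ℂ) where
  c₁ : P →ₗ[ℂ] H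
  c₂ : P →ₗ[ℂ] H
  β : P →ₗ[ℂ] (ι → ℂ)
  ev : P →ₗ[ℂ] (κ → ℂ)
  isUnit : IsUnit M
  skew : Mᴴ = -M
  green : ∀ r p, inner ℂ (c₁ r) (c₂ p) - inner ℂ (c₂ r) (c₁ p) = -(star (β r) ⬝ᵥ (M *ᵥ β p))
  perp_le : formPerp M ((LinearMap.ker c₁ ⊓ LinearMap.ker c₂).map β) ≤ LinearMap.range β
  closed : ∀ v g, (∀ p, β p = 0 → inner ℂ g (c₁ p) = inner ℂ v (c₂ p)) → ∃ r, c₁ r = v ∧ c₂ r = g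
  unique : ∀ p, c₁ p = 0 → c₂ p = 0 → ev p = 0 → β p = 0
  exists_pos : ∃ U : Submodule ℂ (ι → ℂ), 2 * Module.finrank ℂ U = Fintype.card ι ∧
    ∀ z ∈ U, (Complex.I * (star z ⬝ᵥ (M *ᵥ z))).re ≤ 0 → z = 0
  exists_neg : ∃ U : Submodule ℂ (ι → ℂ), 2 * Module.finrank ℂ U = Fintype.card ι ∧
    ∀ z ∈ U, 0 ≤ (Complex.I * (star z ⬝ᵥ (M *ᵥ z))).re → z = 0

namespace BoundarySystem

variable {P H ι κ : Type*} [AddCommGroup P] [Module ℂ P] [NormedAddCommGroup H]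
    [InnerProductSpace ℂ H] [Fintype ι] [DecidableEq ι] [Fintype κ] {M : Matrix ι ι ℂ}
    (S : BoundarySystem P H ι κ M)

/-- The elements representing zero. -/
def null : Submodule ℂ P := LinearMap.ker S.c₁ ⊓ LinearMap.ker S.c₂

/-- The boundary values of the elements representing zero. -/
def nullBdry : Submodule ℂ (ι → ℂ) := S.null.map S.β

/-- The normalized elements: their evaluation is orthogonal to that of `null`. -/
def normalized : Submodule ℂ P where
  carrier := {p | ∀ y ∈ S.null, star (S.ev y) ⬝ᵥ S.ev p = 0}
  zero_mem' := by simp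
  add_mem' := by
    intro p r hp hr y hy
    rw [map_add, dotProduct_add, hp y hy, hr y hy, add_zero]
  smul_mem' := by
    intro c p hp y hy
    rw [map_smul, dotProduct_smul, hp y hy, smul_zero]

/-- The normalized elements with `c₂ = z c₁`. -/
def eigen (z : ℂ) : Submodule ℂ P := S.normalized ⊓ LinearMap.ker (S.c₂ - z • S.c₁)

/-- The relation. -/
def rel : P →ₗ[ℂ] H × H := S.c₁.prod S.c₂

/-- The deficiency space. -/
def defect (z : ℂ) : Submodule ℂ (H × H) := (S.eigen z).map S.rel

/-- The space of boundary values of normalized elements of the deficiency spaces. -/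
def defectBdry : Submodule ℂ (ι → ℂ) :=
  (S.eigen Complex.I).map S.β ⊔ (S.eigen (-Complex.I)).map S.β

lemma mem_null {p : P} : p ∈ S.null ↔ S.c₁ p = 0 ∧ S.c₂ p = 0 := by
  simp [null]

lemma mem_eigen {z : ℂ} {p : P} : p ∈ S.eigen z ↔ p ∈ S.normalized ∧ S.c₂ p = z • S.c₁ p := by
  simp [eigen, sub_eq_zero]

/-- Green's identity against an element representing zero has vanishing left-hand side, which gives
one inclusion; the other one is the field `perp_le`. -/
lemma range_eq : LinearMap.range S.β = formPerp M S.nullBdry := by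
  refine le_antisymm ?_ S.perp_le
  rintro _ ⟨p, rfl⟩ _ ⟨y, hy, rfl⟩
  have h := S.green y p
  obtain ⟨h1, h2⟩ := S.mem_null.1 hy
  rw [h1, h2, inner_zero_left, inner_zero_left, sub_zero] at h
  exact neg_eq_zero.1 h.symm

lemma perp_range : formPerp M (LinearMap.range S.β) = S.nullBdry := by
  rw [range_eq, formPerp_formPerp S.isUnit S.skew]

lemma nullBdry_le_range : S.nullBdry ≤ LinearMap.range S.β := LinearMap.map_le_range

lemma exists_normalized (p : P) : ∃ y ∈ S.null, p - y ∈ S.normalized := by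
  classical
  obtain ⟨_, ⟨y, hy, rfl⟩, h⟩ := exists_sub_mem_orthogonal (S.null.map S.ev) (S.ev p)
  refine ⟨y, hy, fun r hr => ?_⟩
  rw [map_sub]
  exact h _ ⟨r, hr, rfl⟩

/-- The evaluation of such an element is orthogonal to itself, hence zero, and `unique` applies.
Thus a normalized element has boundary values that depend only on its class. -/
lemma β_eq_zero_of_normalized {p : P} (hp : p ∈ S.normalized) (hp' : p ∈ S.null) : S.β p = 0 := by
  obtain ⟨h1, h2⟩ := S.mem_null.1 hp'
  refine S.unique p h1 h2 ?_
  have := hp p hp'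
  rwa [dotProduct_star_self_eq_zero] at this

/-- The source of the dimension bounds: the Hermitian form `i z* M z` is non-negative on the
boundary values of `eigen i` plus those of `null`, and non-positive for `eigen (-i)`. -/
lemma green_self_eigen {p r : P} (hp : p ∈ S.eigen Complex.I) (hr : r ∈ S.eigen (-Complex.I))
    {y : P} (hy : y ∈ S.null) :
    Complex.I * (star (S.β (p + r + y)) ⬝ᵥ (M *ᵥ S.β (p + r + y))) =
      2 * (‖S.c₁ p‖ ^ 2 - ‖S.c₁ r‖ ^ 2 : ℝ) := by
  have h := S.green (p + r + y) (p + r + y)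
  obtain ⟨h1, h2⟩ := S.mem_null.1 hy
  have h3 := (S.mem_eigen.1 hp).2
  have h4 := (S.mem_eigen.1 hr).2
  rw [← neg_eq_iff_eq_neg] at h
  rw [← h]
  simp only [map_add, h1, h2, h3, h4, add_zero, inner_add_left, inner_add_right, inner_smul_left,
    inner_smul_right, inner_self_eq_norm_sq_to_K, map_neg, Complex.conj_I]
  push_cast
  ring_nf
  simp only [Complex.I_sq]
  simp
  ring

lemma mem_null_of_eigen {z : ℂ} {p : P} (hp : p ∈ S.eigen z) (h : S.c₁ p = 0) : p ∈ S.null := by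
  rw [mem_null, (S.mem_eigen.1 hp).2, h, smul_zero]
  exact ⟨rfl, rfl⟩

lemma form_range_null {p : P} {z : ι → ℂ} (hz : z ∈ S.nullBdry) :
    star (S.β p) ⬝ᵥ (M *ᵥ z) = 0 := by
  rw [← perp_range] at hz
  exact hz _ ⟨p, rfl⟩

/-- Green's identity of `p + r` is taken against `p` and against `r` separately. Both vanish since
`nullBdry` is orthogonal to the range, and in each the mixed inner product cancels, leaving `±2i`
times a squared norm. -/
lemma c₁_eq_zero_of_add_mem {p r : P} (hp : p ∈ S.eigen Complex.I)
    (hr : r ∈ S.eigen (-Complex.I)) (h : S.β (p + r) ∈ S.nullBdry) :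
    S.c₁ p = 0 ∧ S.c₁ r = 0 := by
  have h3 := (S.mem_eigen.1 hp).2
  have h4 := (S.mem_eigen.1 hr).2
  have g1 := S.green p (p + r)
  have g2 := S.green r (p + r)
  rw [S.form_range_null h, neg_zero] at g1 g2
  simp only [map_add, h3, h4, inner_add_right, inner_smul_left, inner_smul_right, map_neg,
    Complex.conj_I] at g1 g2
  constructor
  · have : 2 * Complex.I * inner ℂ (S.c₁ p) (S.c₁ p) = 0 := by linear_combination g1
    simpa [Complex.I_ne_zero] using this
  · have : 2 * Complex.I * inner ℂ (S.c₁ r) (S.c₁ r) = 0 := by linear_combination -g2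
    simpa [Complex.I_ne_zero] using this

lemma mem_defectBdry {z : ι → ℂ} :
    z ∈ S.defectBdry ↔ ∃ p ∈ S.eigen Complex.I, ∃ r ∈ S.eigen (-Complex.I), S.β (p + r) = z := by
  simp only [defectBdry, Submodule.mem_sup, Submodule.mem_map]
  constructor
  · rintro ⟨_, ⟨p, hp, rfl⟩, _, ⟨r, hr, rfl⟩, rfl⟩
    exact ⟨p, hp, r, hr, map_add _ _ _⟩
  · rintro ⟨p, hp, r, hr, rfl⟩
    exact ⟨_, ⟨p, hp, rfl⟩, _, ⟨r, hr, rfl⟩, (map_add _ _ _).symm⟩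

lemma disjoint_defectBdry : Disjoint S.defectBdry S.nullBdry := by
  rw [Submodule.disjoint_def]
  intro z hz hz'
  obtain ⟨p, hp, r, hr, rfl⟩ := S.mem_defectBdry.1 hz
  obtain ⟨h1, h2⟩ := S.c₁_eq_zero_of_add_mem hp hr hz'
  rw [map_add, S.β_eq_zero_of_normalized hp.1 (S.mem_null_of_eigen hp h1),
    S.β_eq_zero_of_normalized hr.1 (S.mem_null_of_eigen hr h2), add_zero]

lemma defectBdry_le_range : S.defectBdry ≤ LinearMap.range S.β :=
  sup_le LinearMap.map_le_range LinearMap.map_le_range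

lemma finrank_map_congr {V V₁ V₂ : Type*} [AddCommGroup V] [Module ℂ V] [AddCommGroup V₁]
    [Module ℂ V₁] [AddCommGroup V₂] [Module ℂ V₂] (f : V →ₗ[ℂ] V₁) (g : V →ₗ[ℂ] V₂)
    (X : Submodule ℂ V) (h : ∀ x ∈ X, f x = 0 ↔ g x = 0) :
    Module.finrank ℂ (X.map f) = Module.finrank ℂ (X.map g) := by
  have hk : LinearMap.ker (f.domRestrict X) = LinearMap.ker (g.domRestrict X) := by
    ext x
    exact h x x.2
  rw [← LinearMap.range_domRestrict, ← LinearMap.range_domRestrict]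
  exact LinearEquiv.finrank_eq ((f.domRestrict X).quotKerEquivRange.symm.trans
    ((Submodule.quotEquivOfEq _ _ hk).trans (g.domRestrict X).quotKerEquivRange))

lemma rel_eq_zero {p : P} : S.rel p = 0 ↔ p ∈ S.null := by
  rw [mem_null]
  exact Prod.ext_iff

/-- On normalized eigen-elements the class and the boundary values vanish simultaneously, so the
deficiency index can be computed in ℂ^ι. -/
lemma finrank_defect_I :
    Module.finrank ℂ (S.defect Complex.I) = Module.finrank ℂ ((S.eigen Complex.I).map S.β) := by
  refine finrank_map_congr _ _ _ fun p hp => ?_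
  rw [rel_eq_zero]
  refine ⟨fun h => S.β_eq_zero_of_normalized hp.1 h, fun h => S.mem_null_of_eigen hp ?_⟩
  refine (S.c₁_eq_zero_of_add_mem hp (zero_mem _) ?_).1
  rw [add_zero, h]
  exact zero_mem _

lemma finrank_add_of_disjoint {V : Type*} [AddCommGroup V] [Module ℂ V] [FiniteDimensional ℂ V]
    {A B : Submodule ℂ V} (h : Disjoint A B) :
    Module.finrank ℂ (A ⊔ B : Submodule ℂ V) = Module.finrank ℂ A + Module.finrank ℂ B := by
  rw [← Submodule.finrank_sup_add_finrank_inf_eq, h.eq_bot, finrank_bot, add_zero]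

lemma two_mul_finrank_le_of_disjoint {A U : Submodule ℂ (ι → ℂ)} (h : Disjoint A U)
    (hU : 2 * Module.finrank ℂ U = Fintype.card ι) : 2 * Module.finrank ℂ A ≤ Fintype.card ι := by
  have h1 := finrank_add_of_disjoint h
  have h2 := Submodule.finrank_le (A ⊔ U)
  rw [Module.finrank_fintype_fun_eq_card] at h2
  omega

/-- The form `i z* M z` is non-negative on the sum of the two spaces and negative definite on a
space of half the dimension, so they are disjoint. -/
lemma two_mul_finrank_eigen_I_le :
    2 * (Module.finrank ℂ ((S.eigen Complex.I).map S.β) + Module.finrank ℂ S.nullBdry) ≤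
      Fintype.card ι := by
  rw [← finrank_add_of_disjoint (S.disjoint_defectBdry.mono_left le_sup_left)]
  obtain ⟨U, hU, hneg⟩ := S.exists_neg
  refine two_mul_finrank_le_of_disjoint ?_ hU
  rw [Submodule.disjoint_def]
  intro z hz hzU
  obtain ⟨_, ⟨p, hp, rfl⟩, _, ⟨y, hy, rfl⟩, rfl⟩ := Submodule.mem_sup.1 hz
  refine hneg _ hzU ?_
  have h := S.green_self_eigen hp (zero_mem _) hy
  rw [add_zero, map_add] at h
  rw [h, map_zero, norm_zero, zero_pow two_ne_zero, sub_zero]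
  norm_cast
  positivity

lemma two_mul_finrank_eigen_neg_I_le :
    2 * (Module.finrank ℂ ((S.eigen (-Complex.I)).map S.β) + Module.finrank ℂ S.nullBdry) ≤
      Fintype.card ι := by
  rw [← finrank_add_of_disjoint (S.disjoint_defectBdry.mono_left le_sup_right)]
  obtain ⟨U, hU, hpos⟩ := S.exists_pos
  refine two_mul_finrank_le_of_disjoint ?_ hU
  rw [Submodule.disjoint_def]
  intro z hz hzU
  obtain ⟨_, ⟨p, hp, rfl⟩, _, ⟨y, hy, rfl⟩, rfl⟩ := Submodule.mem_sup.1 hz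
  refine hpos _ hzU ?_
  have h := S.green_self_eigen (zero_mem _) hp hy
  rw [zero_add, map_add] at h
  rw [h, map_zero, norm_zero, zero_pow two_ne_zero, zero_sub]
  norm_cast
  have := sq_nonneg ‖S.c₁ p‖
  linarith

/-- Subtracting an element of `null` normalizes a representative without changing its class, so the
normalization in `eigen` loses nothing. -/
lemma mem_defect {z : ℂ} {x : H × H} :
    x ∈ S.defect z ↔ x ∈ LinearMap.range S.rel ∧ x.2 = z • x.1 := by
  constructor
  · rintro ⟨p, hp, rfl⟩
    exact ⟨⟨p, rfl⟩, (S.mem_eigen.1 hp).2⟩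
  · rintro ⟨⟨p, rfl⟩, h⟩
    obtain ⟨y, hy, hn⟩ := S.exists_normalized p
    have e : S.rel (p - y) = S.rel p := by rw [map_sub, S.rel_eq_zero.2 hy, sub_zero]
    refine ⟨p - y, S.mem_eigen.2 ⟨hn, ?_⟩, e⟩
    have e1 : S.c₁ (p - y) = S.c₁ p := congrArg Prod.fst e
    have e2 : S.c₂ (p - y) = S.c₂ p := congrArg Prod.snd e
    rw [e1, e2]
    exact h

lemma β_mem_nullBdry {p : P} (h : ∀ r, inner ℂ (S.c₂ p) (S.c₁ r) = inner ℂ (S.c₁ p) (S.c₂ r)) :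
    S.β p ∈ S.nullBdry := by
  rw [← perp_range]
  rintro _ ⟨r, rfl⟩
  have := S.green p r
  rw [h r, sub_self] at this
  exact form_eq_zero_symm S.skew (neg_eq_zero.1 this.symm)

/-- Von Neumann's decomposition, on the level of boundary values. -/
lemma exists_eigen_decomposition [CompleteSpace H] (r : P) :
    ∃ p ∈ S.eigen Complex.I, ∃ q ∈ S.eigen (-Complex.I), S.β (r - (p + q)) ∈ S.nullBdry := by
  -- The orthogonal complement of the range `R` of `p ↦ (c₂ p, -c₁ p)` is the adjoint relation. It
  -- is closed whether or not `R` is, so a projection onto it exists in the Hilbert product.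
  let f : P →ₗ[ℂ] WithLp 2 (H × H) :=
    (WithLp.linearEquiv 2 ℂ (H × H)).symm.toLinearMap ∘ₗ (S.c₂.prod (-S.c₁))
  have hf : ∀ (x : WithLp 2 (H × H)) p, inner ℂ x (f p) =
      inner ℂ x.fst (S.c₂ p) - inner ℂ x.snd (S.c₁ p) := by
    intro x p
    rw [WithLp.prod_inner_apply, sub_eq_add_neg, ← inner_neg_right]
    rfl
  let R := LinearMap.range f
  have : CompleteSpace Rᗮ := R.isClosed_orthogonal.completeSpace_coe
  have : Rᗮ.HasOrthogonalProjection := .ofCompleteSpace _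
  obtain ⟨t, ht, s, hs, hts⟩ := (Rᗮ).exists_add_mem_mem_orthogonal (WithLp.toLp 2 (S.rel r))
  have ht' : ∀ p, inner ℂ t.snd (S.c₁ p) = inner ℂ t.fst (S.c₂ p) := by
    intro p
    have := (Submodule.mem_orthogonal' _ _).1 ht (f p) ⟨p, rfl⟩
    rw [hf, sub_eq_zero] at this
    exact this.symm
  obtain ⟨pt, hpt1, hpt2⟩ := S.closed _ _ fun p _ => ht' p
  have hs1 : S.c₁ (r - pt) = s.fst := by
    rw [map_sub, hpt1, sub_eq_iff_eq_add']
    exact congrArg WithLp.fst hts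
  have hs2 : S.c₂ (r - pt) = s.snd := by
    rw [map_sub, hpt2, sub_eq_iff_eq_add']
    exact congrArg WithLp.snd hts
  -- Elements with vanishing boundary values lie in the adjoint relation. Since `s` is orthogonal to
  -- these, the rotated pair `(s₂, -s₁)` belongs to the relation as well.
  obtain ⟨pv, hv1, hv2⟩ := S.closed s.snd (-s.fst) (by
    intro p hp
    have hm : WithLp.toLp 2 (S.rel p) ∈ Rᗮ := by
      rw [Submodule.mem_orthogonal']
      rintro _ ⟨q, rfl⟩
      rw [hf]
      have := S.green p q
      rw [hp, star_zero, zero_dotProduct, neg_zero] at this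
      exact this
    have h2 := (Submodule.mem_orthogonal' _ _).1 hs _ hm
    rw [WithLp.prod_inner_apply] at h2
    rw [inner_neg_left, neg_eq_iff_add_eq_zero]
    exact h2)
  -- With `z = ±i` the two halves `(s - z (s₂, -s₁)) / 2` satisfy `c₂ = z c₁` and add up to `s`.
  have key : ∀ z : ℂ, z * z = -1 → ∃ p ∈ S.eigen z,
      S.c₁ p = (1 / 2 : ℂ) • (s.fst - z • s.snd) ∧ S.c₂ p = (1 / 2 : ℂ) • (s.snd + z • s.fst) := by
    intro z hz
    have e1 : S.c₁ ((1 / 2 : ℂ) • ((r - pt) - z • pv)) = (1 / 2 : ℂ) • (s.fst - z • s.snd) := by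
      rw [map_smul, map_sub, map_smul, hs1, hv1]
    have e2 : S.c₂ ((1 / 2 : ℂ) • ((r - pt) - z • pv)) = (1 / 2 : ℂ) • (s.snd + z • s.fst) := by
      rw [map_smul, map_sub, map_smul, hs2, hv2, smul_neg, sub_neg_eq_add]
    obtain ⟨p, hp, hpe⟩ := (S.mem_defect (z := z)).2 ⟨⟨_, rfl⟩, show
      S.c₂ ((1 / 2 : ℂ) • ((r - pt) - z • pv)) = z • S.c₁ ((1 / 2 : ℂ) • ((r - pt) - z • pv)) by
        rw [e1, e2, smul_comm, smul_sub, smul_smul, hz]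
        simp [add_comm]⟩
    exact ⟨p, hp, (congrArg Prod.fst hpe).trans e1, (congrArg Prod.snd hpe).trans e2⟩
  obtain ⟨p, hp, hp1, hp2⟩ := key Complex.I Complex.I_mul_I
  obtain ⟨q, hq, hq1, hq2⟩ := key (-Complex.I) (by simp)
  refine ⟨p, hp, q, hq, S.β_mem_nullBdry fun p' => ?_⟩
  have e1 : S.c₁ (r - (p + q)) = t.fst := by
    rw [map_sub, map_add, hp1, hq1, ← hs1, ← hpt1, map_sub]
    module
  have e2 : S.c₂ (r - (p + q)) = t.snd := by
    rw [map_sub, map_add, hp2, hq2, ← hs2, ← hpt2, map_sub]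
    module
  rw [e1, e2]
  exact ht' p'

/-- The remainder in von Neumann's decomposition lies in the adjoint relation, so its boundary
values are orthogonal to the range of `β`, i.e. lie in `nullBdry`. -/
lemma range_eq_sup [CompleteSpace H] : LinearMap.range S.β = S.defectBdry ⊔ S.nullBdry := by
  refine le_antisymm ?_ (sup_le S.defectBdry_le_range S.nullBdry_le_range)
  rintro _ ⟨r, rfl⟩
  obtain ⟨p, hp, q, hq, h⟩ := S.exists_eigen_decomposition r
  rw [← sub_add_cancel r (p + q), map_add, add_comm]
  exact Submodule.add_mem_sup (S.mem_defectBdry.2 ⟨p, hp, q, hq, rfl⟩) h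

/-- The range has codimension `dim nullBdry` and is the sum of both eigen-boundary spaces and
`nullBdry`. The two upper bounds by half the dimension can then only hold with equality. -/
lemma two_mul_finrank_defect_add [CompleteSpace H] :
    2 * (Module.finrank ℂ (S.defect Complex.I) + Module.finrank ℂ S.nullBdry) =
      Fintype.card ι := by
  have h1 := finrank_formPerp S.isUnit S.nullBdry
  rw [← range_eq, range_eq_sup, finrank_add_of_disjoint S.disjoint_defectBdry] at h1
  have h2 := S.two_mul_finrank_eigen_I_le
  have h3 := S.two_mul_finrank_eigen_neg_I_le
  have h4 := Submodule.finrank_add_le_finrank_add_finrank ((S.eigen Complex.I).map S.β)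
    ((S.eigen (-Complex.I)).map S.β)
  rw [finrank_defect_I]
  unfold defectBdry at h1
  omega

/-- The restriction of the relation given by a space of boundary values. -/
def restriction (L : Submodule ℂ (ι → ℂ)) : Set (H × H) := {x | ∃ p, S.rel p = x ∧ S.β p ∈ L}

/-- An element of the adjoint annihilates in particular the pairs with zero boundary values, so
`closed` represents it by some `p`. Green's identity then places `β p` in `formPerp M L = L`; every
vector of `L` is attained as a boundary value because `nullBdry ≤ L`. -/
lemma restriction_eq_relAdjoint {L : Submodule ℂ (ι → ℂ)} (hL : formPerp M L = L)
    (hN : S.nullBdry ≤ L) : S.restriction L = relAdjoint (S.restriction L) := by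
  have hr : L ≤ LinearMap.range S.β := by
    rw [range_eq, ← hL]
    exact formPerp_anti hN
  ext ⟨v, g⟩
  constructor
  · rintro ⟨p, hp, hpL⟩ _ ⟨r, rfl, hrL⟩
    rw [← hp]
    rw [← hL] at hrL
    have := S.green p r
    rw [hrL _ hpL, neg_zero, sub_eq_zero] at this
    exact this.symm
  · intro h
    obtain ⟨p, rfl, rfl⟩ := S.closed v g fun r hr => h (S.rel r) ⟨r, rfl, hr ▸ zero_mem _⟩
    refine ⟨p, rfl, ?_⟩
    rw [← hL]
    intro z hz
    obtain ⟨r, rfl⟩ := hr hz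
    have h1 := S.green p r
    rw [show inner ℂ (S.c₂ p) (S.c₁ r) = inner ℂ (S.c₁ p) (S.c₂ r) from h (S.rel r) ⟨r, rfl, hz⟩,
      sub_self] at h1
    exact form_eq_zero_symm S.skew (neg_eq_zero.1 h1.symm)

lemma nullBdry_le_perp : S.nullBdry ≤ formPerp M S.nullBdry := by
  rw [← range_eq]
  exact S.nullBdry_le_range

/-- All boundary values are already orthogonal to `nullBdry`, so enlarging `V` by it imposes no
further condition. -/
lemma restriction_perp (V : Submodule ℂ (ι → ℂ)) :
    S.restriction (formPerp M V) = S.restriction (formPerp M (V ⊔ S.nullBdry)) := by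
  ext x
  refine exists_congr fun p => and_congr_right fun _ => ?_
  rw [formPerp_sup, ← range_eq]
  exact ⟨fun h => ⟨h, p, rfl⟩, fun h => h.1⟩

/-- Isotropic subspaces of the space of boundary values of the deficiency spaces that have
maximal dimension give self-adjoint restrictions. -/
theorem restriction_selfAdjoint [CompleteSpace H] {V : Submodule ℂ (ι → ℂ)}
    (hV : V ≤ S.defectBdry) (hd : Module.finrank ℂ V = Module.finrank ℂ (S.defect Complex.I))
    (hiso : V ≤ formPerp M V) :
    S.restriction (formPerp M V) = relAdjoint (S.restriction (formPerp M V)) := by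
  have hVN : V ≤ formPerp M S.nullBdry := by
    rw [← range_eq]
    exact hV.trans S.defectBdry_le_range
  have hle : V ⊔ S.nullBdry ≤ formPerp M (V ⊔ S.nullBdry) := by
    rw [formPerp_sup]
    exact sup_le (le_inf hiso hVN) (le_inf (le_formPerp_comm S.skew hVN) S.nullBdry_le_perp)
  have hL : formPerp M (V ⊔ S.nullBdry) = V ⊔ S.nullBdry := by
    refine (Submodule.eq_of_le_of_finrank_le hle ?_).symm
    have h1 := finrank_formPerp S.isUnit (V ⊔ S.nullBdry)
    have h2 := S.two_mul_finrank_defect_add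
    rw [finrank_add_of_disjoint (S.disjoint_defectBdry.mono_left hV)] at h1 ⊢
    omega
  rw [restriction_perp, hL]
  exact S.restriction_eq_relAdjoint hL le_sup_right

lemma relAdjoint_add_mem {T : Set (H × H)} {x y : H × H} (hx : x ∈ relAdjoint T)
    (hy : y ∈ relAdjoint T) : x + y ∈ relAdjoint T := by
  intro r hr
  rw [Prod.fst_add, Prod.snd_add, inner_add_left, inner_add_left, hx r hr, hy r hr]

lemma relAdjoint_smul_mem {T : Set (H × H)} {x : H × H} (c : ℂ) (hx : x ∈ relAdjoint T) :
    c • x ∈ relAdjoint T := by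
  intro r hr
  rw [Prod.smul_fst, Prod.smul_snd, inner_smul_left, inner_smul_left, hx r hr]

/-- Every self-adjoint restriction is given by an isotropic subspace of the space of boundary
values of the deficiency spaces that has maximal dimension. -/
theorem exists_eq_restriction [CompleteSpace H] {T : Set (H × H)}
    (hT : T ⊆ LinearMap.range S.rel) (hT' : T = relAdjoint T) :
    ∃ V ≤ S.defectBdry, Module.finrank ℂ V = Module.finrank ℂ (S.defect Complex.I) ∧
      V ≤ formPerp M V ∧ T = S.restriction (formPerp M V) := by
  -- Being an adjoint makes `T` a linear subspace.
  let T' : Submodule ℂ (H × H) :=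
    { carrier := T
      zero_mem' := by rw [hT']; intro r _; simp
      add_mem' := by rw [hT']; exact relAdjoint_add_mem
      smul_mem' := by rw [hT']; exact fun c x hx => relAdjoint_smul_mem c hx }
  have memT' : ∀ x, x ∈ T' ↔ x ∈ T := fun _ => Iff.rfl
  let L : Submodule ℂ (ι → ℂ) := (T'.comap S.rel).map S.β
  have hNL : S.nullBdry ≤ L := by
    refine Submodule.map_mono fun y hy => ?_
    rw [Submodule.mem_comap, S.rel_eq_zero.2 hy]
    exact zero_mem _
  have hzero : ∀ p, S.β p = 0 → S.rel p ∈ T := by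
    intro p hp
    rw [hT']
    intro x hx
    obtain ⟨r, rfl⟩ := hT hx
    have := S.green p r
    rw [hp, star_zero, zero_dotProduct, neg_zero, sub_eq_zero] at this
    exact this.symm
  -- Since `T` contains every pair with zero boundary values, membership in `T` depends on the
  -- boundary values alone.
  have hmem : ∀ p, S.β p ∈ L ↔ S.rel p ∈ T := by
    intro p
    refine ⟨?_, fun h => ⟨p, h, rfl⟩⟩
    rintro ⟨r, hr, hrp⟩
    have h0 : S.rel (p - r) ∈ T' := hzero _ (by rw [map_sub, hrp, sub_self])
    have := T'.add_mem h0 hr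
    rwa [← map_add, sub_add_cancel] at this
  have hL : formPerp M L = L := by
    apply le_antisymm
    · intro z hz
      have hz' : z ∈ LinearMap.range S.β := by
        rw [range_eq]
        exact formPerp_anti hNL hz
      obtain ⟨p, rfl⟩ := hz'
      rw [hmem, hT']
      intro x hx
      obtain ⟨r, rfl⟩ := hT hx
      have := S.green p r
      rw [form_eq_zero_symm S.skew (hz _ ((hmem r).2 hx)), neg_zero, sub_eq_zero] at this
      exact this.symm
    · rintro _ ⟨p, hp, rfl⟩ _ ⟨r, hr, rfl⟩
      have h1 : S.rel r ∈ relAdjoint T := hT' ▸ hr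
      have h2 := S.green r p
      rw [show inner ℂ (S.c₂ r) (S.c₁ p) = inner ℂ (S.c₁ r) (S.c₂ p) from h1 _ hp, sub_self] at h2
      exact neg_eq_zero.1 h2.symm
  have hLr : L ≤ LinearMap.range S.β := LinearMap.map_le_range
  -- Modular law, using `nullBdry ≤ L` and `range β = defectBdry ⊔ nullBdry`.
  have hsup : (L ⊓ S.defectBdry) ⊔ S.nullBdry = L := by
    rw [inf_sup_assoc_of_le _ hNL, ← range_eq_sup, inf_eq_left.2 hLr]
  refine ⟨L ⊓ S.defectBdry, inf_le_right, ?_, ?_, ?_⟩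
  · have h1 := finrank_add_of_disjoint
      (S.disjoint_defectBdry.mono_left (inf_le_right : L ⊓ S.defectBdry ≤ _))
    rw [hsup] at h1
    have h2 := finrank_formPerp S.isUnit L
    rw [hL] at h2
    have h3 := S.two_mul_finrank_defect_add
    omega
  · calc L ⊓ S.defectBdry ≤ L := inf_le_left
      _ = formPerp M L := hL.symm
      _ ≤ _ := formPerp_anti inf_le_left
  · rw [restriction_perp, hsup, hL]
    ext x
    constructor
    · intro hx
      obtain ⟨p, rfl⟩ := hT hx
      exact ⟨p, rfl, (hmem p).2 hx⟩
    · rintro ⟨p, rfl, hp⟩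
      exact (hmem p).1 hp

end BoundarySystem

end

end DistSystem

namespace DistSystem

noncomputable section

/-! ### Measurable solutions of singular linear systems; inequalities for semidefinite matrices -/

section MatrixSolution

variable {n : ℕ}

/-- The least squares solution of `A v = g` with support in `s`. -/
def supportedSolution (A : Matrix (Fin n) (Fin n) ℂ) (s : Finset (Fin n)) (g : Fin n → ℂ) :
    Fin n → ℂ :=
  let d : Matrix (Fin n) (Fin n) ℂ := Matrix.diagonal fun i => if i ∈ s then 1 else 0
  ((A * d)ᴴ * (A * d) + (1 - d))⁻¹ *ᵥ ((A * d)ᴴ *ᵥ g)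

/-- For a solution `x` whose support lies in a set `s` of minimal size, the columns of `A` in `s`
are independent. The normal equations on `s`, completed by the identity off `s`, are then invertible
with solution `x`. This provides finitely many explicit candidates, each measurable in `A` and `g`.
-/
lemma exists_mulVec_supportedSolution (A : Matrix (Fin n) (Fin n) ℂ) (v : Fin n → ℂ) :
    ∃ s, A *ᵥ supportedSolution A s (A *ᵥ v) = A *ᵥ v := by
  classical
  have hne : (Finset.univ.filter fun s : Finset (Fin n) =>
      ∃ x, A *ᵥ x = A *ᵥ v ∧ ∀ i ∉ s, x i = 0).Nonempty :=
    ⟨Finset.univ, Finset.mem_filter.2 ⟨Finset.mem_univ _, v, rfl, by simp⟩⟩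
  obtain ⟨s, hs, hmin⟩ := Finset.exists_min_image _ Finset.card hne
  obtain ⟨x, hx, hxs⟩ := (Finset.mem_filter.1 hs).2
  have hker : ∀ y, A *ᵥ y = 0 → (∀ i ∉ s, y i = 0) → y = 0 := by
    intro y hy hys
    by_contra hne
    obtain ⟨i, hi⟩ := Function.ne_iff.1 hne
    have his : i ∈ s := by
      by_contra h
      exact hi (hys i h)
    -- A kernel vector `y` supported in `s` with `y i ≠ 0` allows the coordinate `i` of `x` to be
    -- eliminated, contradicting minimality.
    have := hmin (s.erase i) (Finset.mem_filter.2 ⟨Finset.mem_univ _, x - (x i / y i) • y, ?_, ?_⟩)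
    · exact absurd this (not_le.2 (Finset.card_erase_lt_of_mem his))
    · rw [Matrix.mulVec_sub, Matrix.mulVec_smul, hy, smul_zero, sub_zero, hx]
    · intro j hj
      by_cases hji : j = i
      · subst hji
        simp only [Pi.sub_apply, Pi.smul_apply, smul_eq_mul]
        rw [div_mul_cancel₀ _ hi, sub_self]
      · have hjs : j ∉ s := fun h => hj (Finset.mem_erase.2 ⟨hji, h⟩)
        simp [hxs j hjs, hys j hjs]
  refine ⟨s, ?_⟩
  let d : Matrix (Fin n) (Fin n) ℂ := Matrix.diagonal fun i => if i ∈ s then 1 else 0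
  let B := A * d
  let N := Bᴴ * B + (1 - d)
  change A *ᵥ (N⁻¹ *ᵥ (Bᴴ *ᵥ (A *ᵥ v))) = _
  have hd : ∀ (y : Fin n → ℂ) i, (d *ᵥ y) i = if i ∈ s then y i else 0 := by
    intro y i
    simp [d, Matrix.mulVec_diagonal]
  have hdx : d *ᵥ x = x := by
    ext i
    rw [hd]
    split_ifs with h
    · rfl
    · exact (hxs i h).symm
  have hdd : d * d = d := by
    simp [d, Matrix.diagonal_mul_diagonal]
  have hdH : dᴴ = d := by
    simp only [d, Matrix.diagonal_conjTranspose]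
    congr 1
    ext i
    simp only [Pi.star_apply]
    split_ifs <;> simp
  have hN : N *ᵥ x = Bᴴ *ᵥ (A *ᵥ v) := by
    rw [Matrix.add_mulVec, Matrix.sub_mulVec, hdx, Matrix.one_mulVec, sub_self, add_zero,
      ← Matrix.mulVec_mulVec, ← Matrix.mulVec_mulVec, hdx, hx]
  have hNu : IsUnit N := by
    rw [← Matrix.mulVec_injective_iff_isUnit]
    refine (injective_iff_map_eq_zero N.mulVecLin).2 fun y hy => ?_
    rw [Matrix.mulVecLin_apply] at hy
    have h1 : d *ᵥ (N *ᵥ y) = Bᴴ *ᵥ (B *ᵥ y) := by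
      rw [Matrix.mulVec_mulVec, Matrix.mulVec_mulVec]
      congr 1
      simp only [N, B, Matrix.conjTranspose_mul, hdH, mul_add, mul_sub, mul_one, hdd, sub_self,
        add_zero]
      simp only [← mul_assoc, hdd]
    rw [hy, Matrix.mulVec_zero, Matrix.mulVec_mulVec] at h1
    have h2 := (Matrix.conjTranspose_mul_self_mulVec_eq_zero B y).1 h1.symm
    have h3 : d *ᵥ y = 0 := by
      refine hker _ (by rw [Matrix.mulVec_mulVec]; exact h2) fun i hi => ?_
      rw [hd, if_neg hi]
    rw [Matrix.add_mulVec, ← h1, zero_add, Matrix.sub_mulVec, Matrix.one_mulVec, h3,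
      sub_zero] at hy
    exact hy
  have h5 := (Matrix.isUnit_iff_isUnit_det N).1 hNu
  have h6 : N⁻¹ *ᵥ (N *ᵥ x) = x := by
    rw [Matrix.mulVec_mulVec, Matrix.nonsing_inv_mul _ h5, Matrix.one_mulVec]
  rw [← hN, h6, hx]

lemma measurable_matrix_inv_apply {α m : Type*} [MeasurableSpace α] [Fintype m] [DecidableEq m]
    {A : α → Matrix m m ℂ} (hA : ∀ i j, Measurable fun x => A x i j) (i j : m) :
    Measurable fun x => (A x)⁻¹ i j := by
  have hm : Measurable (β := m → m → ℂ) fun x => A x :=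
    measurable_pi_iff.2 fun i => measurable_pi_iff.2 fun j => hA i j
  have hof : Continuous fun B : m → m → ℂ => Matrix.of B := continuous_id
  have h1 : Measurable fun x => (A x).det := (hof.matrix_det.measurable).comp hm
  have h2 : Measurable fun x => (A x).adjugate i j :=
    ((hof.matrix_adjugate.matrix_elem i j).measurable).comp hm
  simp only [Matrix.inv_def, Matrix.smul_apply, Ring.inverse_eq_inv', smul_eq_mul]
  exact h1.inv.mul h2

lemma measurable_matrix_mul_apply {α m : Type*} [MeasurableSpace α] [Fintype m]
    {A B : α → Matrix m m ℂ} (hA : ∀ i j, Measurable fun x => A x i j)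
    (hB : ∀ i j, Measurable fun x => B x i j) (i j : m) :
    Measurable fun x => (A x * B x) i j := by
  simp only [Matrix.mul_apply]
  exact Finset.measurable_fun_sum _ fun k _ => (hA i k).mul (hB k j)

lemma measurable_mulVec {α m : Type*} [MeasurableSpace α] [Fintype m]
    {A : α → Matrix m m ℂ} {v : α → m → ℂ} (hA : ∀ i j, Measurable fun x => A x i j)
    (hv : Measurable v) : Measurable fun x => A x *ᵥ v x := by
  refine measurable_pi_iff.2 fun i => ?_
  simp only [Matrix.mulVec, dotProduct]
  exact Finset.measurable_fun_sum _ fun k _ => (hA i k).mul (measurable_pi_iff.1 hv k)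

lemma measurable_supportedSolution {α : Type*} [MeasurableSpace α]
    {A : α → Matrix (Fin n) (Fin n) ℂ} {g : α → Fin n → ℂ} (s : Finset (Fin n))
    (hA : ∀ i j, Measurable fun x => A x i j) (hg : Measurable g) :
    Measurable fun x => supportedSolution (A x) s (g x) := by
  have hB : ∀ i j, Measurable fun x =>
      (A x * Matrix.diagonal fun i => if i ∈ s then (1 : ℂ) else 0) i j :=
    measurable_matrix_mul_apply hA fun _ _ => measurable_const
  have hBH : ∀ i j, Measurable fun x =>
      (A x * Matrix.diagonal fun i => if i ∈ s then (1 : ℂ) else 0)ᴴ i j := fun i j => by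
    simp only [Matrix.conjTranspose_apply]
    exact (continuous_star.measurable).comp (hB j i)
  refine measurable_mulVec (measurable_matrix_inv_apply fun i j => ?_) (measurable_mulVec hBH hg)
  simp only [Matrix.add_apply]
  exact (measurable_matrix_mul_apply hBH hB i j).add measurable_const

/-- A measurable solution `f` of `A f = g`, where `g` takes values in the range of `A`. -/
lemma exists_measurable_mulVec_eq {α : Type*} [MeasurableSpace α] {μ : Measure α}
    {A : α → Matrix (Fin n) (Fin n) ℂ} {g : α → Fin n → ℂ}
    (hA : ∀ i j, Measurable fun x => A x i j) (hg : AEStronglyMeasurable g μ)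
    (h : ∀ᵐ x ∂μ, ∃ v, A x *ᵥ v = g x) :
    ∃ f : α → Fin n → ℂ, Measurable f ∧ ∀ᵐ x ∂μ, A x *ᵥ f x = g x := by
  classical
  obtain ⟨g', hg', hgg'⟩ := hg
  obtain ⟨e, he⟩ := exists_surjective_nat (Finset (Fin n))
  have hm : ∀ k, Measurable fun x => supportedSolution (A x) (e k) (g' x) := fun k =>
    measurable_supportedSolution _ hA hg'.measurable
  let good : ℕ → Set α := fun k => {x | A x *ᵥ supportedSolution (A x) (e k) (g' x) = g' x}
  have hgood : ∀ k, MeasurableSet (good k) := fun k =>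
    measurableSet_eq_fun (measurable_mulVec hA (hm k)) hg'.measurable
  -- The second alternative makes the search succeed at every point, including the null set on which
  -- the system has no solution.
  let p : ℕ → α → Prop := fun k x => x ∈ good k ∨ ∀ j, x ∉ good j
  have hp : ∀ x, ∃ k, p k x := fun x => by
    by_cases hx : ∃ k, x ∈ good k
    · obtain ⟨k, hk⟩ := hx
      exact ⟨k, Or.inl hk⟩
    · exact ⟨0, Or.inr fun j hj => hx ⟨j, hj⟩⟩
  refine ⟨fun x => supportedSolution (A x) (e (Nat.find (hp x))) (g' x),
    Measurable.find (f := fun k x => supportedSolution (A x) (e k) (g' x)) hm (fun k => ?_) hp, ?_⟩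
  · refine (hgood k).union ?_
    have : {x | ∀ j, x ∉ good j} = ⋂ j, (good j)ᶜ := by
      ext x
      simp
    change MeasurableSet {x | ∀ j, x ∉ good j}
    rw [this]
    exact MeasurableSet.iInter fun j => (hgood j).compl
  · filter_upwards [h, hgg'] with x ⟨v, hv⟩ hx
    rw [hx] at hv ⊢
    rcases Nat.find_spec (hp x) with h1 | h1
    · exact h1
    · obtain ⟨s, hs⟩ := exists_mulVec_supportedSolution (A x) v
      obtain ⟨k, rfl⟩ := he s
      exact absurd (show x ∈ good k by rwa [hv] at hs) (h1 k)

/-- Cauchy-Schwarz in additive form: the form of `A` is non-negative at `t c̄ eᵢ - v`, where `c` is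
the phase that makes `(A v)ᵢ` positive. The free parameter `t` balances the two terms later. -/
lemma norm_mulVec_apply_le {A : Matrix (Fin n) (Fin n) ℂ} (hA : A.PosSemidef) (v : Fin n → ℂ)
    (i : Fin n) {t : ℝ} (ht : 0 < t) :
    2 * ‖(A *ᵥ v) i‖ ≤ t * (A i i).re + t⁻¹ * (star v ⬝ᵥ (A *ᵥ v)).re := by
  obtain ⟨c, hc, hcz⟩ := RCLike.exists_norm_eq_mul_self ((A *ᵥ v) i)
  replace hcz : ((‖(A *ᵥ v) i‖ : ℝ) : ℂ) = c * (A *ᵥ v) i := hcz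
  have hcc : star c * c = 1 := by
    rw [Complex.star_def, ← Complex.normSq_eq_conj_mul_self, Complex.normSq_eq_norm_sq, hc]
    simp
  have h := hA.dotProduct_mulVec_nonneg (Pi.single i ((t : ℂ) * star c) - v)
  have h1 : star v ⬝ᵥ (A *ᵥ Pi.single i ((t : ℂ) * star c)) = t * ‖(A *ᵥ v) i‖ := by
    have : star (star v ⬝ᵥ (A *ᵥ Pi.single i ((t : ℂ) * star c))) = t * ‖(A *ᵥ v) i‖ := by
      rw [← Matrix.star_dotProduct, Matrix.star_mulVec, hA.1.eq, ← Matrix.dotProduct_mulVec,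
        ← Pi.single_star, single_dotProduct]
      rw [hcz]
      simp [mul_assoc]
    have h2 := congrArg star this
    rw [star_star] at h2
    rw [h2]
    simp
  have h2 : star (Pi.single i ((t : ℂ) * star c)) ⬝ᵥ (A *ᵥ v) = t * ‖(A *ᵥ v) i‖ := by
    rw [← Pi.single_star, single_dotProduct]
    rw [hcz]
    simp [mul_assoc]
  have h3 : star (Pi.single i ((t : ℂ) * star c)) ⬝ᵥ (A *ᵥ Pi.single i ((t : ℂ) * star c)) =
      t ^ 2 * A i i := by
    rw [← Pi.single_star, single_dotProduct, Matrix.mulVec_single]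
    simp only [star_mul', Complex.star_def, Complex.conj_ofReal, Complex.conj_conj, Pi.smul_apply,
      MulOpposite.smul_eq_mul_unop, MulOpposite.unop_op, Matrix.col_apply]
    rw [Complex.star_def] at hcc
    linear_combination (t : ℂ) ^ 2 * A i i * hcc
  rw [star_sub, Matrix.mulVec_sub, dotProduct_sub, sub_dotProduct, sub_dotProduct, h1, h2, h3] at h
  have h4 := (Complex.le_def.1 h).1
  have h5 : ((t : ℂ) ^ 2 * A i i).re = t ^ 2 * (A i i).re := by
    rw [← Complex.ofReal_pow, Complex.re_ofReal_mul]
  have h6 : ((t : ℂ) * (‖(A *ᵥ v) i‖ : ℂ)).re = t * ‖(A *ᵥ v) i‖ := by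
    rw [← Complex.ofReal_mul, Complex.ofReal_re]
  simp only [Complex.sub_re, h5, h6, Complex.zero_re] at h4
  have h7 : 0 ≤ t⁻¹ * (t ^ 2 * (A i i).re - t * ‖(A *ᵥ v) i‖ -
    (t * ‖(A *ᵥ v) i‖ - (star v ⬝ᵥ (A *ᵥ v)).re)) := mul_nonneg (by positivity) h4
  have h8 : t⁻¹ * (t ^ 2 * (A i i).re - t * ‖(A *ᵥ v) i‖ -
      (t * ‖(A *ᵥ v) i‖ - (star v ⬝ᵥ (A *ᵥ v)).re)) =
      t * (A i i).re - 2 * ‖(A *ᵥ v) i‖ + t⁻¹ * (star v ⬝ᵥ (A *ᵥ v)).re := by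
    field_simp
    ring
  linarith

lemma norm_mulVec_le {A : Matrix (Fin n) (Fin n) ℂ} (hA : A.PosSemidef) (v : Fin n → ℂ)
    {t : ℝ} (ht : 0 < t) :
    ‖A *ᵥ v‖ ≤ t * ∑ i, ‖A i i‖ + t⁻¹ * (star v ⬝ᵥ (A *ᵥ v)).re := by
  have h0 := (Complex.le_def.1 (hA.dotProduct_mulVec_nonneg v)).1
  rw [Complex.zero_re] at h0
  refine (pi_norm_le_iff_of_nonneg (by positivity)).2 fun i => ?_
  have h1 := norm_mulVec_apply_le hA v i ht
  have h2 : (A i i).re ≤ ∑ i, ‖A i i‖ := (Complex.re_le_norm _).trans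
    (Finset.single_le_sum (f := fun i => ‖A i i‖) (fun _ _ => norm_nonneg _) (Finset.mem_univ i))
  have h3 := norm_nonneg ((A *ᵥ v) i)
  have h4 := mul_le_mul_of_nonneg_left h2 ht.le
  linarith

/-- Lower semicontinuity of the quadratic form of `A` as a function of `A v`. -/
lemma quadratic_le_liminf {A : Matrix (Fin n) (Fin n) ℂ} (hA : A.PosSemidef) {v : Fin n → ℂ}
    {u : ℕ → Fin n → ℂ} (h : Tendsto (fun k => A *ᵥ u k) atTop (𝓝 (A *ᵥ v))) :
    ENNReal.ofReal (star v ⬝ᵥ (A *ᵥ v)).re ≤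
      liminf (fun k => ENNReal.ofReal (star (u k) ⬝ᵥ (A *ᵥ u k)).re) atTop := by
  -- Non-negativity at `u k - v` bounds the quadratic form from below by an affine function of `A (u
  -- k)`, which converges.
  have h1 : ∀ k, 2 * (star v ⬝ᵥ (A *ᵥ u k)).re - (star v ⬝ᵥ (A *ᵥ v)).re ≤
      (star (u k) ⬝ᵥ (A *ᵥ u k)).re := by
    intro k
    have h2 := (Complex.le_def.1 (hA.dotProduct_mulVec_nonneg (u k - v))).1
    have h3 : star (u k) ⬝ᵥ (A *ᵥ v) = star (star v ⬝ᵥ (A *ᵥ u k)) := by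
      rw [← Matrix.star_dotProduct, Matrix.star_mulVec, hA.1.eq, Matrix.dotProduct_mulVec]
    rw [star_sub, Matrix.mulVec_sub, dotProduct_sub, sub_dotProduct, sub_dotProduct, h3] at h2
    simp only [Complex.sub_re, Complex.star_def, Complex.conj_re, Complex.zero_re] at h2
    linarith
  have h2 : Tendsto (fun k => ENNReal.ofReal (2 * (star v ⬝ᵥ (A *ᵥ u k)).re -
      (star v ⬝ᵥ (A *ᵥ v)).re)) atTop (𝓝 (ENNReal.ofReal (star v ⬝ᵥ (A *ᵥ v)).re)) := by
    have hc : Continuous fun z : Fin n → ℂ => (star v ⬝ᵥ z).re :=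
      Complex.continuous_re.comp (continuous_const.dotProduct continuous_id)
    have h3 := ((hc.tendsto _).comp h).const_mul 2 |>.sub_const (star v ⬝ᵥ (A *ᵥ v)).re
    have h4 := ENNReal.tendsto_ofReal h3
    rw [two_mul, add_sub_cancel_right] at h4
    exact h4
  rw [← h2.liminf_eq]
  exact liminf_le_liminf (Eventually.of_forall fun k => ENNReal.ofReal_le_ofReal (h1 k))

end MatrixSolution

/-! ### Completeness of the semi-inner product space 𝓛²(w) -/

section Completeness

variable {a b : EReal} {n : ℕ} {w : DistMatrix a b n}

lemma form_re_nonneg (f : ℝ → Fin n → ℂ) (x : ℝ) : 0 ≤ (form w f f x).re :=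
  (Complex.le_def.1 (form_self_nonneg w f x)).1

lemma integrable_form_re {f g : ℝ → Fin n → ℂ} (hf : f ∈ preL2 w) (hg : g ∈ preL2 w) :
    Integrable (fun x => (form w f g x).re) (traceMeasure w) :=
  (integrable_form w hf hg).re

lemma norm_sq_eq_integral (f : PreL2 w) :
    ‖f‖ ^ 2 = ∫ x, (form w f.toFun f.toFun x).re ∂(traceMeasure w) := by
  rw [@norm_sq_eq_re_inner ℂ]
  exact (integral_re (integrable_form w f.mem f.mem)).symm

lemma ofReal_norm_sq_eq_lintegral (f : PreL2 w) :
    ENNReal.ofReal (‖f‖ ^ 2) =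
      ∫⁻ x, ENNReal.ofReal (form w f.toFun f.toFun x).re ∂(traceMeasure w) := by
  rw [← ofReal_integral_eq_lintegral_ofReal (integrable_form_re f.mem f.mem)
    (Eventually.of_forall fun x => form_re_nonneg _ x), norm_sq_eq_integral]

lemma mem_preL2_iff {f : ℝ → Fin n → ℂ} (hf : AEStronglyMeasurable f (traceMeasure w)) :
    f ∈ preL2 w ↔ ∫⁻ x, ENNReal.ofReal (form w f f x).re ∂(traceMeasure w) ≠ ⊤ := by
  have h : ∀ x, ENNReal.ofReal (form w f f x).re = ‖form w f f x‖ₑ := fun x => by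
    rw [Complex.re_eq_norm.2 (form_self_nonneg w f x), ofReal_norm]
  simp only [h]
  refine ⟨fun hf' => hf'.2.2.ne, fun h' => ⟨hf, aestronglyMeasurable_form w hf hf, ?_⟩⟩
  exact h'.lt_top

lemma integrable_rnMatrix (w : DistMatrix a b n) (i j : Fin n) :
    Integrable (fun x => rnMatrix w x i j) (traceMeasure w) :=
  ComplexMeasure.integrable_rnDeriv _ _

lemma integrable_density (w : DistMatrix a b n) (i j : Fin n) :
    Integrable (fun x => density w x i j) (traceMeasure w) := by
  refine (integrable_rnMatrix w i j).mono (measurable_density w i j).aestronglyMeasurable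
    (Eventually.of_forall fun x => ?_)
  unfold density
  split_ifs
  · exact le_rfl
  · simp

lemma integrable_sum_norm_density (w : DistMatrix a b n) :
    Integrable (fun x => ∑ i, ‖density w x i i‖) (traceMeasure w) :=
  integrable_finsetSum _ fun i _ => (integrable_density w i i).norm

lemma aestronglyMeasurable_mulVec {m : Type*} [Fintype m] {α : Type*} [MeasurableSpace α]
    {μ : Measure α} {A : α → Matrix m m ℂ} {v : α → m → ℂ}
    (hA : ∀ i j, AEStronglyMeasurable (fun x => A x i j) μ) (hv : AEStronglyMeasurable v μ) :
    AEStronglyMeasurable (fun x => A x *ᵥ v x) μ := by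
  have hv' : ∀ i, AEStronglyMeasurable (fun x => v x i) μ := fun i =>
    (continuous_apply i).comp_aestronglyMeasurable hv
  refine (aemeasurable_pi_iff.2 fun i => ?_).aestronglyMeasurable
  simp only [Matrix.mulVec, dotProduct]
  exact (Finset.aestronglyMeasurable_fun_sum _ fun j _ => (hA i j).mul (hv' j)).aemeasurable

lemma aestronglyMeasurable_density_mulVec {f : ℝ → Fin n → ℂ}
    (hf : AEStronglyMeasurable f (traceMeasure w)) :
    AEStronglyMeasurable (fun x => density w x *ᵥ f x) (traceMeasure w) :=
  aestronglyMeasurable_mulVec (fun i j => (measurable_density w i j).aestronglyMeasurable) hf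

lemma integrable_density_mulVec {f : ℝ → Fin n → ℂ} (hf : f ∈ preL2 w) :
    Integrable (fun x => density w x *ᵥ f x) (traceMeasure w) := by
  refine ((integrable_sum_norm_density w).add (integrable_form w hf hf).re).mono'
    (aestronglyMeasurable_density_mulVec hf.1) (Eventually.of_forall fun x => ?_)
  have := norm_mulVec_le (density_posSemidef w x) (f x) one_pos
  rwa [inv_one, one_mul, one_mul] at this

lemma lintegral_density_mulVec_le (f : PreL2 w) {t : ℝ} (ht : 0 < t) :
    eLpNorm (fun x => density w x *ᵥ f.toFun x) 1 (traceMeasure w) ≤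
      ENNReal.ofReal (t * ∫ x, ∑ i, ‖density w x i i‖ ∂(traceMeasure w) + t⁻¹ * ‖f‖ ^ 2) := by
  rw [eLpNorm_one_eq_lintegral_enorm]
  have h1 : ∀ x, ‖density w x *ᵥ f.toFun x‖ₑ ≤ ENNReal.ofReal (t * ∑ i, ‖density w x i i‖ +
      t⁻¹ * (form w f.toFun f.toFun x).re) := fun x => by
    rw [← ofReal_norm]
    exact ENNReal.ofReal_le_ofReal (norm_mulVec_le (density_posSemidef w x) (f.toFun x) ht)
  refine (lintegral_mono h1).trans ?_
  have hi1 := (integrable_sum_norm_density w).const_mul t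
  have hi2 := (integrable_form_re f.mem f.mem).const_mul t⁻¹
  have h2 := ofReal_integral_eq_lintegral_ofReal (hi1.add hi2) (Eventually.of_forall fun x => by
    have := form_re_nonneg (w := w) f.toFun x
    have : 0 ≤ ∑ i, ‖density w x i i‖ := Finset.sum_nonneg fun _ _ => norm_nonneg _
    exact add_nonneg (by positivity) (by positivity))
  refine h2.symm.le.trans (ENNReal.ofReal_le_ofReal (le_of_eq ?_))
  refine (integral_add hi1 hi2).trans ?_
  rw [integral_const_mul, integral_const_mul, norm_sq_eq_integral]

/-- The density may be singular, so a Cauchy sequence `u k` itself need not converge pointwise. The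
products of the density with `u k` converge almost everywhere along fast Cauchy sequences. A
measurable preimage `f` of the limit is selected, and Fatou's lemma together with lower
semicontinuity of the quadratic form shows that `f` is the limit in norm. -/
instance completeSpace_preL2 : CompleteSpace (PreL2 w) := by
  set C := ∫ x, ∑ i, ‖density w x i i‖ ∂(traceMeasure w) with hC
  have hC0 : 0 ≤ C := integral_nonneg fun x => Finset.sum_nonneg fun i _ => norm_nonneg _
  refine Metric.complete_of_convergent_controlled_sequences (fun N => (1 / 2 : ℝ) ^ N)
    (fun N => by positivity) fun u hu => ?_
  have hcau : ∀ᵐ x ∂(traceMeasure w), ∃ l,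
      Tendsto (fun k => density w x *ᵥ (u k).toFun x) atTop (𝓝 l) := by
    refine Lp.ae_tendsto_of_cauchy_eLpNorm (p := 1)
      (B := fun N => ENNReal.ofReal ((C + 2) * (1 / 2 : ℝ) ^ N))
      (fun k => aestronglyMeasurable_density_mulVec (u k).mem.1) le_rfl ?_ fun N k m hk hm => ?_
    · have h := ENNReal.ofReal_tsum_of_nonneg (f := fun N => (C + 2) * (1 / 2 : ℝ) ^ N)
        (fun N => by positivity) (summable_geometric_two.mul_left _)
      rw [← h]
      exact ENNReal.ofReal_ne_top
    -- With `t = 2⁻ᴺ` both `C t` and `t⁻¹ ‖u k - u m‖²` are of order `2⁻ᴺ`; the constant `C + 2`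
    -- leaves room for a strict inequality.
    · have h1 := lintegral_density_mulVec_le (u k - u m) (t := (1 / 2 : ℝ) ^ N) (by positivity)
      have h2 := hu N k m hk hm
      rw [dist_eq_norm] at h2
      have h3 : (fun x => density w x *ᵥ (u k - u m).toFun x) =
          (fun x => density w x *ᵥ (u k).toFun x) - fun x => density w x *ᵥ (u m).toFun x := by
        funext x
        exact Matrix.mulVec_sub _ _ _
      rw [h3] at h1
      refine h1.trans_lt ((ENNReal.ofReal_lt_ofReal_iff (by positivity)).2 ?_)
      have h4 : ((1 / 2 : ℝ) ^ N)⁻¹ * ‖u k - u m‖ ^ 2 ≤ (1 / 2 : ℝ) ^ N := by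
        rw [inv_mul_le_iff₀ (by positivity), ← sq]
        exact pow_le_pow_left₀ (norm_nonneg _) h2.le 2
      have h5 : (0 : ℝ) < (1 / 2 : ℝ) ^ N := by positivity
      nlinarith
  obtain ⟨g, hg, hgl⟩ := exists_stronglyMeasurable_limit_of_tendsto_ae
    (fun k => aestronglyMeasurable_density_mulVec (u k).mem.1) hcau
  -- The range of each matrix is finite-dimensional, hence closed, and contains the limit.
  obtain ⟨f, hf, hfg⟩ := exists_measurable_mulVec_eq (measurable_density w)
    hg.aestronglyMeasurable (by
      filter_upwards [hgl] with x hx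
      have hcl : IsClosed (LinearMap.range (density w x).mulVecLin : Set (Fin n → ℂ)) :=
        Submodule.closed_of_finiteDimensional _
      obtain ⟨v, hv⟩ := hcl.mem_of_tendsto hx (Eventually.of_forall fun k => ⟨(u k).toFun x, rfl⟩)
      exact ⟨v, hv⟩)
  have key : ∀ N, ∀ k ≥ N, ∫⁻ x, ENNReal.ofReal
      (form w (f - (u k).toFun) (f - (u k).toFun) x).re ∂(traceMeasure w) ≤
        ENNReal.ofReal (((1 / 2 : ℝ) ^ N) ^ 2) := by
    intro N k hk
    calc _ ≤ ∫⁻ x, liminf (fun m => ENNReal.ofReal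
          (form w (u m - u k).toFun (u m - u k).toFun x).re) atTop ∂(traceMeasure w) := by
          refine lintegral_mono_ae ?_
          filter_upwards [hgl, hfg] with x hx hx'
          refine quadratic_le_liminf (density_posSemidef w x) ?_
          have h1 : ∀ m, density w x *ᵥ (u m - u k).toFun x =
              density w x *ᵥ (u m).toFun x - density w x *ᵥ (u k).toFun x := fun m =>
            Matrix.mulVec_sub _ _ _
          simp only [h1, Pi.sub_apply, Matrix.mulVec_sub, hx']
          exact hx.sub_const _
      _ ≤ liminf (fun m => ∫⁻ x, ENNReal.ofReal
          (form w (u m - u k).toFun (u m - u k).toFun x).re ∂(traceMeasure w)) atTop := by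
          refine lintegral_liminf_le' fun m => ?_
          exact ((integrable_form w (u m - u k).mem (u m - u k).mem).re.1.aemeasurable).ennreal_ofReal
      _ ≤ _ := by
          refine liminf_le_of_frequently_le' (Eventually.frequently ?_)
          filter_upwards [eventually_ge_atTop N] with m hm
          rw [← ofReal_norm_sq_eq_lintegral, ← dist_eq_norm]
          exact ENNReal.ofReal_le_ofReal (pow_le_pow_left₀ dist_nonneg (hu N m k hm hk).le 2)
  have hmem : ∀ k, f - (u k).toFun ∈ preL2 w := fun k =>
    (mem_preL2_iff (hf.aestronglyMeasurable.sub (u k).mem.1)).2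
      (ne_top_of_le_ne_top ENNReal.ofReal_ne_top (key k k le_rfl))
  have hfm : f ∈ preL2 w := by
    have := (preL2 w).add_mem (hmem 0) (u 0).mem
    rwa [sub_add_cancel] at this
  obtain ⟨F, hF⟩ : ∃ F : PreL2 w, F.toFun = f := ⟨⟨f, hfm⟩, rfl⟩
  refine ⟨F, ?_⟩
  rw [tendsto_iff_norm_sub_tendsto_zero]
  refine squeeze_zero (fun _ => norm_nonneg _) (fun k => ?_)
    (tendsto_pow_atTop_nhds_zero_of_lt_one (r := (1 / 2 : ℝ)) (by norm_num) (by norm_num))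
  rw [norm_sub_rev]
  have h1 := ofReal_norm_sq_eq_lintegral (F - u k)
  rw [← hF] at key
  have h2 := h1.trans_le (key k k le_rfl)
  rw [ENNReal.ofReal_le_ofReal_iff (by positivity)] at h2
  exact (pow_le_pow_iff_left₀ (norm_nonneg _) (by positivity) two_ne_zero).1 h2

end Completeness

end

end DistSystem

namespace DistSystem

noncomputable section

/-! ### Linear Volterra equations with respect to a finite measure -/

section Volterra

variable {m : Measure ℝ} {n : ℕ}

/-- The sum of the absolute values of the entries of a matrix. -/
def entrySum (A : Matrix (Fin n) (Fin n) ℂ) : ℝ := ∑ i, ∑ j, ‖A i j‖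

lemma entrySum_nonneg (A : Matrix (Fin n) (Fin n) ℂ) : 0 ≤ entrySum A :=
  Finset.sum_nonneg fun _ _ => Finset.sum_nonneg fun _ _ => norm_nonneg _

lemma norm_mulVec_le_entrySum (A : Matrix (Fin n) (Fin n) ℂ) (v : Fin n → ℂ) :
    ‖A *ᵥ v‖ ≤ entrySum A * ‖v‖ := by
  refine (pi_norm_le_iff_of_nonneg (mul_nonneg (entrySum_nonneg _) (norm_nonneg _))).2 fun i => ?_
  calc ‖(A *ᵥ v) i‖ = ‖∑ j, A i j * v j‖ := rfl
    _ ≤ ∑ j, ‖A i j * v j‖ := norm_sum_le _ _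
    _ ≤ ∑ j, ‖A i j‖ * ‖v‖ := Finset.sum_le_sum fun j _ => by
        rw [norm_mul]
        exact mul_le_mul_of_nonneg_left (norm_le_pi_norm v j) (norm_nonneg _)
    _ = (∑ j, ‖A i j‖) * ‖v‖ := (Finset.sum_mul _ _ _).symm
    _ ≤ entrySum A * ‖v‖ := mul_le_mul_of_nonneg_right
        (Finset.single_le_sum (f := fun i => ∑ j, ‖A i j‖)
          (fun _ _ => Finset.sum_nonneg fun _ _ => norm_nonneg _) (Finset.mem_univ i))
        (norm_nonneg _)

lemma integrable_entrySum {K : ℝ → Matrix (Fin n) (Fin n) ℂ}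
    (hK : ∀ i j, Integrable (fun x => K x i j) m) : Integrable (fun x => entrySum (K x)) m :=
  integrable_finsetSum _ fun i _ => integrable_finsetSum _ fun j _ => (hK i j).norm

lemma integrable_mulVec_of_bounded {K : ℝ → Matrix (Fin n) (Fin n) ℂ} {v : ℝ → Fin n → ℂ}
    (hK : ∀ i j, Integrable (fun x => K x i j) m) (hv : AEStronglyMeasurable v m) {C : ℝ}
    (hC : ∀ᵐ x ∂m, ‖v x‖ ≤ C) : Integrable (fun x => K x *ᵥ v x) m := by
  refine ((integrable_entrySum hK).mul_const C).mono'
    (aestronglyMeasurable_mulVec (fun i j => (hK i j).1) hv) ?_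
  filter_upwards [hC] with x hx
  exact (norm_mulVec_le_entrySum _ _).trans
    (mul_le_mul_of_nonneg_left hx (entrySum_nonneg _))

lemma integrable_mulVec_const {v : ℝ → Fin n → ℂ} (A : Matrix (Fin n) (Fin n) ℂ)
    (hv : Integrable v m) : Integrable (fun x => A *ᵥ v x) m :=
  (A.mulVecLin.toContinuousLinearMap).integrable_comp hv

lemma measurable_setIntegral_Iio [SFinite m] {E : Type*} [NormedAddCommGroup E] [NormedSpace ℝ E]
    {h : ℝ → E} (hh : AEStronglyMeasurable h m) :
    StronglyMeasurable fun x => ∫ t in Iio x, h t ∂m := by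
  obtain ⟨h', hh', he⟩ := hh
  have h1 : (fun x => ∫ t in Iio x, h t ∂m) = fun x => ∫ t, (Iio x).indicator h' t ∂m := by
    funext x
    rw [integral_indicator measurableSet_Iio]
    exact integral_congr_ae (ae_restrict_of_ae he)
  rw [h1]
  have h2 : StronglyMeasurable fun p : ℝ × ℝ => {p : ℝ × ℝ | p.2 < p.1}.indicator
      (fun p => h' p.2) p :=
    (hh'.comp_measurable measurable_snd).indicator (measurableSet_lt measurable_snd measurable_fst)
  exact h2.integral_prod_right'

/-- The iterated integrals `J (k + 1) x = ∫_{t < x} J k t`. -/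
def iterIntegral (μ : Measure ℝ) : ℕ → ℝ → ENNReal
  | 0, _ => 1
  | k + 1, x => ∫⁻ t in Iio x, iterIntegral μ k t ∂μ

lemma monotone_iterIntegral (μ : Measure ℝ) : ∀ k, Monotone (iterIntegral μ k)
  | 0 => monotone_const
  | _ + 1 => fun _ _ hxy => lintegral_mono_set (Iio_subset_Iio hxy)

/-- Without atoms the iterated integral would be `μ(Iio x)ᵏ / k!`; with atoms only an inequality
survives. In the induction Tonelli rewrites the next iterated integral as the integral over `s < x`
of the previous one times `μ (Ioo s x)`. Since `Iio s` and `Ioo s x` are disjoint subsets of `Iio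
x`, omitting only the atom at `s`, the sum of their masses is at most `μ (Iio x)`. -/
lemma iterIntegral_mul_le (μ : Measure ℝ) [SFinite μ] (k : ℕ) (x : ℝ) :
    (k + 1) * iterIntegral μ (k + 1) x ≤ iterIntegral μ k x * μ (Iio x) := by
  induction k generalizing x with
  | zero => simp [iterIntegral]
  | succ k ih =>
    have hJ := (monotone_iterIntegral μ k).measurable
    have h1 : ∀ s ∈ Iio x, iterIntegral μ k s * μ (Iio s) +
        ∫⁻ t in Iio x, (Iio t).indicator (iterIntegral μ k) s ∂μ ≤
          iterIntegral μ k s * μ (Iio x) := by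
      intro s hs
      have h2 : ∫⁻ t in Iio x, (Iio t).indicator (iterIntegral μ k) s ∂μ =
          iterIntegral μ k s * μ (Ioo s x) := by
        rw [← setLIntegral_const, ← Iio_inter_Ioi, inter_comm,
          ← Measure.restrict_restrict measurableSet_Ioi,
          ← lintegral_indicator measurableSet_Ioi]
        rfl
      rw [h2, ← mul_add]
      gcongr
      rw [← measure_union (by
        rw [Set.disjoint_left]
        intro y hy hy'
        exact lt_asymm hy hy'.1) measurableSet_Ioo]
      exact measure_mono (union_subset (Iio_subset_Iio (le_of_lt hs)) Ioo_subset_Iio_self)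
    have hmeas : Measurable fun p : ℝ × ℝ => (Iio p.2).indicator (iterIntegral μ k) p.1 := by
      have : (fun p : ℝ × ℝ => (Iio p.2).indicator (iterIntegral μ k) p.1) =
          {p : ℝ × ℝ | p.1 < p.2}.indicator fun p => iterIntegral μ k p.1 := rfl
      rw [this]
      exact (hJ.comp measurable_fst).indicator (measurableSet_lt measurable_fst measurable_snd)
    have h3 : ∫⁻ s in Iio x, ∫⁻ t in Iio x, (Iio t).indicator (iterIntegral μ k) s ∂μ ∂μ =
        iterIntegral μ (k + 2) x := by
      rw [lintegral_lintegral_swap hmeas.aemeasurable]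
      refine setLIntegral_congr_fun measurableSet_Iio fun t ht => ?_
      rw [lintegral_indicator measurableSet_Iio, Measure.restrict_restrict measurableSet_Iio,
        Iio_inter_Iio, inf_eq_left.2 (le_of_lt ht)]
      rfl
    calc ((k + 1 : ℕ) + 1 : ENNReal) * iterIntegral μ (k + 1 + 1) x
        = (k + 1) * (∫⁻ t in Iio x, iterIntegral μ (k + 1) t ∂μ) + iterIntegral μ (k + 2) x := by
          push_cast
          rw [add_mul _ (1 : ENNReal), one_mul]
          rfl
      _ = (∫⁻ t in Iio x, (k + 1) * iterIntegral μ (k + 1) t ∂μ) + iterIntegral μ (k + 2) x := by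
          rw [lintegral_const_mul _ (monotone_iterIntegral μ (k + 1)).measurable]
      _ ≤ (∫⁻ t in Iio x, iterIntegral μ k t * μ (Iio t) ∂μ) + iterIntegral μ (k + 2) x := by
          exact add_le_add_left (lintegral_mono fun t => ih t) _
      _ = ∫⁻ s in Iio x, (iterIntegral μ k s * μ (Iio s) +
            ∫⁻ t in Iio x, (Iio t).indicator (iterIntegral μ k) s ∂μ) ∂μ := by
          rw [lintegral_add_left, h3]
          refine hJ.mul (Monotone.measurable fun s t hst => measure_mono (Iio_subset_Iio hst))
      _ ≤ ∫⁻ s in Iio x, iterIntegral μ k s * μ (Iio x) ∂μ :=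
          setLIntegral_mono' measurableSet_Iio h1
      _ = iterIntegral μ (k + 1) x * μ (Iio x) := by
          rw [lintegral_mul_const _ hJ]
          rfl

lemma factorial_mul_iterIntegral_le (μ : Measure ℝ) [SFinite μ] (k : ℕ) (x : ℝ) :
    (k.factorial : ENNReal) * iterIntegral μ k x ≤ μ univ ^ k := by
  induction k with
  | zero => simp [iterIntegral]
  | succ k ih =>
    calc ((k + 1).factorial : ENNReal) * iterIntegral μ (k + 1) x
        = k.factorial * ((k + 1) * iterIntegral μ (k + 1) x) := by
          rw [Nat.factorial_succ]
          push_cast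
          ring
      _ ≤ k.factorial * (iterIntegral μ k x * μ (Iio x)) := by
          exact mul_le_mul_right (iterIntegral_mul_le μ k x) _
      _ ≤ μ univ ^ k * μ univ := by
          rw [← mul_assoc]
          gcongr
          exact subset_univ _
      _ = μ univ ^ (k + 1) := (pow_succ _ _).symm

/-- The terms of the Neumann series of a Volterra equation. -/
def volterraTerm (m : Measure ℝ) (K : ℝ → Matrix (Fin n) (Fin n) ℂ) (g : ℝ → Fin n → ℂ) :
    ℕ → ℝ → Fin n → ℂ
  | 0 => g
  | k + 1 => fun x => ∫ t in Iio x, K t *ᵥ volterraTerm m K g k t ∂m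

/-- Existence for linear Volterra equations with respect to a finite measure. -/
theorem exists_volterra [IsFiniteMeasure m] {K : ℝ → Matrix (Fin n) (Fin n) ℂ}
    {g : ℝ → Fin n → ℂ} (hK : ∀ i j, Integrable (fun x => K x i j) m)
    (hg : Measurable g) {C : ℝ} (hC : ∀ x, ‖g x‖ ≤ C) :
    ∃ v : ℝ → Fin n → ℂ, Measurable v ∧ (∃ B, ∀ x, ‖v x‖ ≤ B) ∧
      ∀ x, v x = g x + ∫ t in Iio x, K t *ᵥ v t ∂m := by
  have hC0 : 0 ≤ C := (norm_nonneg _).trans (hC 0)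
  -- The size of the kernel is absorbed into the measure, so the Neumann terms are dominated by
  -- iterated integrals of `μ` and hence by `C Lᵏ / k!`.
  set μ := m.withDensity fun t => ENNReal.ofReal (entrySum (K t)) with hμ
  have hKi := integrable_entrySum hK
  have hfin : IsFiniteMeasure μ := isFiniteMeasure_withDensity_ofReal hKi.2
  set L := (μ univ).toReal with hL
  set v := volterraTerm m K g with hv
  have hmeas : ∀ k, Measurable (v k) := by
    intro k
    induction k with
    | zero => exact hg
    | succ k ih =>
      exact (measurable_setIntegral_Iio (aestronglyMeasurable_mulVec (fun i j => (hK i j).1)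
        ih.aestronglyMeasurable)).measurable
  have hbd : ∀ k x, ‖v k x‖ₑ ≤ ENNReal.ofReal C * iterIntegral μ k x := by
    intro k
    induction k with
    | zero =>
      intro x
      rw [iterIntegral, mul_one, ← ofReal_norm]
      exact ENNReal.ofReal_le_ofReal (hC x)
    | succ k ih =>
      intro x
      refine (enorm_integral_le_lintegral_enorm _).trans ?_
      have hJ := (monotone_iterIntegral μ k).measurable
      rw [iterIntegral, hμ, restrict_withDensity measurableSet_Iio,
        lintegral_withDensity_eq_lintegral_mul₀' hKi.1.aemeasurable.ennreal_ofReal.restrict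
          hJ.aemeasurable, ← lintegral_const_mul' _ _ ENNReal.ofReal_ne_top]
      refine lintegral_mono fun t => ?_
      simp only [Pi.mul_apply]
      calc ‖K t *ᵥ v k t‖ₑ ≤ ENNReal.ofReal (entrySum (K t)) * ‖v k t‖ₑ := by
            rw [← ofReal_norm, ← ofReal_norm, ← ENNReal.ofReal_mul (entrySum_nonneg _)]
            exact ENNReal.ofReal_le_ofReal (norm_mulVec_le_entrySum _ _)
        _ ≤ ENNReal.ofReal (entrySum (K t)) * (ENNReal.ofReal C * iterIntegral μ k t) := by
            gcongr
            exact ih t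
        _ = _ := by ring
  have hbd' : ∀ k x, ‖v k x‖ ≤ C * (L ^ k / k.factorial) := by
    intro k x
    have hf : ((k.factorial : ℕ) : ENNReal) ≠ 0 := by exact_mod_cast k.factorial_ne_zero
    have h1 : iterIntegral μ k x ≤ μ univ ^ k / k.factorial := by
      rw [ENNReal.le_div_iff_mul_le (Or.inl hf) (Or.inl (ENNReal.natCast_ne_top _)), mul_comm]
      exact factorial_mul_iterIntegral_le μ k x
    have h2 : ‖v k x‖ₑ ≤ ENNReal.ofReal C * (μ univ ^ k / k.factorial) :=
      (hbd k x).trans (by gcongr)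
    have h3 := ENNReal.toReal_mono (by
      refine ENNReal.mul_ne_top ENNReal.ofReal_ne_top (ENNReal.div_ne_top ?_ hf)
      exact ENNReal.pow_ne_top (measure_ne_top _ _)) h2
    rwa [toReal_enorm, ENNReal.toReal_mul, ENNReal.toReal_ofReal hC0, ENNReal.toReal_div,
      ENNReal.toReal_pow, ENNReal.toReal_natCast] at h3
  have hs : Summable fun k : ℕ => C * (L ^ k / k.factorial) :=
    (Real.summable_pow_div_factorial L).mul_left C
  have hsum : ∀ x, Summable fun k => v k x := fun x => Summable.of_norm_bounded hs fun k => hbd' k x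
  refine ⟨fun x => ∑' k, v k x, ?_, ⟨∑' k : ℕ, C * (L ^ k / k.factorial), fun x => ?_⟩, fun x => ?_⟩
  · refine measurable_of_tendsto_metrizable (f := fun N x => ∑ k ∈ Finset.range N, v k x)
      (fun N => Finset.measurable_fun_sum _ fun k _ => hmeas k)
      (tendsto_pi_nhds.2 fun x => (hsum x).hasSum.tendsto_sum_nat)
  · exact tsum_of_norm_bounded hs.hasSum fun k => hbd' k x
  · have hi : ∀ k, Integrable (fun t => K t *ᵥ v k t) (m.restrict (Iio x)) := fun k =>
      (integrable_mulVec_of_bounded hK (hmeas k).aestronglyMeasurable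
        (Eventually.of_forall (hbd' k))).restrict
    have h1 := hasSum_integral_of_summable_integral_norm hi (by
      refine Summable.of_nonneg_of_le (fun k => integral_nonneg fun t => norm_nonneg _)
        (fun k => ?_) (hs.mul_left (∫ t in Iio x, entrySum (K t) ∂m))
      rw [← integral_mul_const]
      refine integral_mono_of_nonneg (Eventually.of_forall fun t => norm_nonneg _)
        (hKi.restrict.mul_const _) (Eventually.of_forall fun t => ?_)
      exact (norm_mulVec_le_entrySum _ _).trans
        (mul_le_mul_of_nonneg_left (hbd' k t) (entrySum_nonneg _)))
    have h2 : ∀ t, ∑' k, K t *ᵥ v k t = K t *ᵥ ∑' k, v k t := fun t =>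
      ((hsum t).hasSum.mapL (K t).mulVecLin.toContinuousLinearMap).tsum_eq
    simp only [h2] at h1
    change ∑' k, v k x = g x + ∫ t in Iio x, K t *ᵥ ∑' k, v k t ∂m
    rw [(hsum x).tsum_eq_zero_add, ← h1.tsum_eq]
    rfl

end Volterra

end

end DistSystem

namespace DistSystem

noncomputable section

/-! ### Balanced primitives and integration by parts -/

section Primitive

variable {m : Measure ℝ} {n : ℕ} {E : Type*} [NormedAddCommGroup E] [NormedSpace ℝ E]

/-- The balanced primitive `(∫_{t < x} ξ + ∫_{t ≤ x} ξ) / 2`. -/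
def balPrim (m : Measure ℝ) (ξ : ℝ → E) (x : ℝ) : E :=
  ∫ t in Iio x, ξ t ∂m + (m.real {x} / 2) • ξ x

lemma setIntegral_Iic_eq [CompleteSpace E] [IsFiniteMeasure m] {ξ : ℝ → E} (hξ : Integrable ξ m)
    (x : ℝ) : ∫ t in Iic x, ξ t ∂m = ∫ t in Iio x, ξ t ∂m + m.real {x} • ξ x := by
  rw [← Iio_union_right, setIntegral_union (by simp) (measurableSet_singleton x) hξ.integrableOn
    hξ.integrableOn, integral_singleton]

lemma real_singleton_mul_norm_le {E : Type*} [NormedAddCommGroup E] [IsFiniteMeasure m] {ξ : ℝ → E}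
    (hξ : Integrable ξ m) (x : ℝ) : m.real {x} * ‖ξ x‖ ≤ ∫ t, ‖ξ t‖ ∂m := by
  have h := setIntegral_le_integral (s := {x}) hξ.norm (Eventually.of_forall fun t => norm_nonneg _)
  rwa [integral_singleton, smul_eq_mul] at h

lemma norm_setIntegral_le [CompleteSpace E] {ξ : ℝ → E} (hξ : Integrable ξ m) (s : Set ℝ) :
    ‖∫ t in s, ξ t ∂m‖ ≤ ∫ t, ‖ξ t‖ ∂m :=
  (norm_integral_le_integral_norm _).trans
    (setIntegral_le_integral hξ.norm (Eventually.of_forall fun _ => norm_nonneg _))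

lemma measurable_real_singleton (m : Measure ℝ) [IsFiniteMeasure m] :
    Measurable fun x => m.real {x} := by
  have h : (fun x => m.real {x}) = fun x => m.real (Iic x) - m.real (Iio x) := by
    funext x
    rw [← Iio_union_right, measureReal_union (by simp) (measurableSet_singleton x)]
    ring
  rw [h]
  exact (Monotone.measurable fun x y hxy => measureReal_mono (Iic_subset_Iic.2 hxy)).sub
    (Monotone.measurable fun x y hxy => measureReal_mono (Iio_subset_Iio hxy))

lemma aestronglyMeasurable_balPrim [CompleteSpace E] [IsFiniteMeasure m] {ξ : ℝ → E}
    (hξ : AEStronglyMeasurable ξ m) : AEStronglyMeasurable (balPrim m ξ) m :=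
  (measurable_setIntegral_Iio hξ).aestronglyMeasurable.add
    (((measurable_real_singleton m).div_const 2).aestronglyMeasurable.smul hξ)

lemma norm_balPrim_le [CompleteSpace E] [IsFiniteMeasure m] {ξ : ℝ → E} (hξ : Integrable ξ m)
    (x : ℝ) : ‖balPrim m ξ x‖ ≤ 2 * ∫ t, ‖ξ t‖ ∂m := by
  have h1 := norm_setIntegral_le hξ (Iio x)
  have h2 := real_singleton_mul_norm_le hξ x
  have h3 : ‖(m.real {x} / 2) • ξ x‖ = m.real {x} * ‖ξ x‖ / 2 := by
    rw [norm_smul, Real.norm_of_nonneg (by positivity)]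
    ring
  have h4 : 0 ≤ ∫ t, ‖ξ t‖ ∂m := integral_nonneg fun _ => norm_nonneg _
  refine (norm_add_le _ _).trans ?_
  rw [h3]
  linarith

/-- Integration by parts for two primitives with respect to the same measure. -/
lemma integral_mul_integral [IsFiniteMeasure m] {ξ η : ℝ → ℂ} (hξ : Integrable ξ m)
    (hη : Integrable η m) : (∫ t, ξ t ∂m) * ∫ t, η t ∂m =
      ∫ t, (balPrim m ξ t * η t + ξ t * balPrim m η t) ∂m := by
  have hb : ∀ {f g : ℝ → ℂ}, Integrable f m → Integrable g m →
      Integrable (fun t => balPrim m f t * g t) m := fun {f g} hf hg =>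
    hg.bdd_mul (aestronglyMeasurable_balPrim hf.1) (Eventually.of_forall (norm_balPrim_le hf))
  have hd : Integrable (fun t => (m.real {t} / 2) • ξ t * η t) m := by
    refine hη.bdd_mul (c := ∫ t, ‖ξ t‖ ∂m)
      (((measurable_real_singleton m).div_const 2).aestronglyMeasurable.smul hξ.1)
      (Eventually.of_forall fun t => ?_)
    have h2 := real_singleton_mul_norm_le hξ t
    have h3 : ‖(m.real {t} / 2) • ξ t‖ = m.real {t} * ‖ξ t‖ / 2 := by
      rw [norm_smul, Real.norm_of_nonneg (by positivity)]
      ring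
    have h4 : 0 ≤ ∫ t, ‖ξ t‖ ∂m := integral_nonneg fun _ => norm_nonneg _
    rw [h3]
    linarith
  have hprod : Integrable (fun p : ℝ × ℝ => ξ p.2 * η p.1) (m.prod m) := by
    simpa only [mul_comm] using hη.mul_prod hξ
  have hind : Integrable (fun p : ℝ × ℝ => (Ioi p.1).indicator ξ p.2 * η p.1) (m.prod m) := by
    have : (fun p : ℝ × ℝ => (Ioi p.1).indicator ξ p.2 * η p.1) =
        {p : ℝ × ℝ | p.1 < p.2}.indicator fun p => ξ p.2 * η p.1 := by
      funext p
      by_cases h : p.1 < p.2 <;> simp [h]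
    rw [this]
    exact hprod.indicator (measurableSet_lt measurable_fst measurable_snd)
  -- The total integral of `ξ` is cut at `t`. Fubini turns the part over `s > t` into the balanced
  -- primitive of `η` less half an atom, which cancels the half atom appearing here. This
  -- cancellation makes the balanced choice free of a diagonal correction.
  have h1 : ∀ t, (∫ s, ξ s ∂m) * η t = (balPrim m ξ t * η t + (m.real {t} / 2) • ξ t * η t) +
      ∫ s, (Ioi t).indicator ξ s * η t ∂m := by
    intro t
    rw [integral_mul_const, integral_indicator measurableSet_Ioi, ← add_mul, ← add_mul]
    congr 1
    rw [← integral_add_compl (measurableSet_Iic (a := t)) hξ, compl_Iic, setIntegral_Iic_eq hξ,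
      balPrim]
    congr 1
    module
  have h2 : ∫ t, ∫ s, (Ioi t).indicator ξ s * η t ∂m ∂m =
      ∫ s, (ξ s * balPrim m η s - (m.real {s} / 2) • ξ s * η s) ∂m := by
    rw [integral_integral_swap hind]
    refine integral_congr_ae (Eventually.of_forall fun s => ?_)
    have h3 : ∀ t, (Ioi t).indicator ξ s * η t = ξ s * (Iio s).indicator η t := by
      intro t
      by_cases h : t < s <;> simp [h]
    simp only [h3]
    rw [integral_const_mul, integral_indicator measurableSet_Iio, balPrim, mul_add,
      Complex.real_smul, Complex.real_smul]
    ring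
  rw [← integral_mul_const]
  have h3 : (∫ t, (∫ s, ξ s ∂m) * η t ∂m) = ∫ t, (balPrim m ξ t * η t +
      (m.real {t} / 2) • ξ t * η t) ∂m + ∫ t, ∫ s, (Ioi t).indicator ξ s * η t ∂m ∂m := by
    refine (integral_congr_ae (Eventually.of_forall h1)).trans ?_
    exact integral_add ((hb hξ hη).add hd) hind.integral_prod_left
  have hb' : Integrable (fun t => ξ t * balPrim m η t) m := by
    simpa only [mul_comm] using hb hη hξ
  have h4 : (∫ t, ξ t ∂m) * (∫ t, η t ∂m) = ∫ t, (∫ s, ξ s ∂m) * η t ∂m :=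
    (integral_const_mul _ _).symm
  rw [integral_mul_const, h4, h3, h2, integral_add (hb hξ hη) hd, integral_sub hb' hd,
    integral_add (hb hξ hη) hb']
  ring

lemma integrable_apply {ξ : ℝ → Fin n → ℂ} (hξ : Integrable ξ m) (i : Fin n) :
    Integrable (fun t => ξ t i) m :=
  (ContinuousLinearMap.proj (R := ℂ) (φ := fun _ : Fin n => ℂ) i).integrable_comp hξ

lemma integral_apply' {ξ : ℝ → Fin n → ℂ} (hξ : Integrable ξ m) (i : Fin n) :
    (∫ t, ξ t ∂m) i = ∫ t, ξ t i ∂m :=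
  eval_integral (fun i => integrable_apply hξ i) i

lemma balPrim_apply {ξ : ℝ → Fin n → ℂ} (hξ : Integrable ξ m) (x : ℝ) (i : Fin n) :
    balPrim m ξ x i = balPrim m (fun t => ξ t i) x := by
  rw [balPrim, balPrim, Pi.add_apply, Pi.smul_apply, integral_apply' hξ.restrict]

lemma integrable_star {ξ : ℝ → ℂ} (hξ : Integrable ξ m) : Integrable (fun t => star (ξ t)) m :=
  (Complex.conjCLE : ℂ →L[ℝ] ℂ).integrable_comp hξ

lemma integral_star (ξ : ℝ → ℂ) : star (∫ t, ξ t ∂m) = ∫ t, star (ξ t) ∂m :=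
  integral_conj.symm

lemma balPrim_star (ξ : ℝ → ℂ) (x : ℝ) :
    star (balPrim m ξ x) = balPrim m (fun t => star (ξ t)) x := by
  rw [balPrim, balPrim, star_add, integral_star, star_smul, star_trivial]

lemma integrable_balPrim_mul [IsFiniteMeasure m] {f g : ℝ → ℂ} (hf : Integrable f m)
    (hg : Integrable g m) : Integrable (fun t => balPrim m f t * g t) m :=
  hg.bdd_mul (aestronglyMeasurable_balPrim hf.1) (Eventually.of_forall (norm_balPrim_le hf))

lemma integrable_mul_primitive [IsFiniteMeasure m] {ξ η : ℝ → ℂ} (hξ : Integrable ξ m)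
    (hη : Integrable η m) (c d : ℂ) :
    Integrable (fun t => (d + balPrim m η t) * ξ t + η t * (c + balPrim m ξ t)) m := by
  simp only [add_mul, mul_add]
  refine ((hξ.const_mul d).add (integrable_balPrim_mul hη hξ)).add ((hη.mul_const c).add ?_)
  simpa only [mul_comm] using integrable_balPrim_mul hξ hη

lemma mul_primitive [IsFiniteMeasure m] {ξ η : ℝ → ℂ} (hξ : Integrable ξ m)
    (hη : Integrable η m) (c d : ℂ) :
    (d + ∫ t, η t ∂m) * (c + ∫ t, ξ t ∂m) = d * c +
      ∫ t, ((d + balPrim m η t) * ξ t + η t * (c + balPrim m ξ t)) ∂m := by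
  have h1 : Integrable (fun t => balPrim m η t * ξ t + η t * balPrim m ξ t) m := by
    simpa using integrable_mul_primitive hξ hη 0 0
  have h2 : ∀ t, (d + balPrim m η t) * ξ t + η t * (c + balPrim m ξ t) =
      (d * ξ t + c * η t) + (balPrim m η t * ξ t + η t * balPrim m ξ t) := fun t => by ring
  simp only [h2]
  have h3 : Integrable (fun t => d * ξ t + c * η t) m := (hξ.const_mul d).add (hη.const_mul c)
  rw [integral_add h3 h1, integral_add (hξ.const_mul d) (hη.const_mul c), integral_const_mul, integral_const_mul,
    ← integral_mul_integral hη hξ]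
  ring

lemma integral_sum_sum {f : Fin n → Fin n → ℝ → ℂ} (hf : ∀ i j, Integrable (f i j) m) :
    ∫ t, ∑ i, ∑ j, f i j t ∂m = ∑ i, ∑ j, ∫ t, f i j t ∂m := by
  rw [integral_finsetSum _ fun i _ => integrable_finsetSum _ fun j _ => hf i j]
  exact Finset.sum_congr rfl fun i _ => integral_finsetSum _ fun j _ => hf i j

lemma sesq_eq_sum (J : Matrix (Fin n) (Fin n) ℂ) (x y : Fin n → ℂ) :
    star x ⬝ᵥ (J *ᵥ y) = ∑ i, ∑ j, J i j * (star (x i) * y j) := by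
  simp only [dotProduct, Matrix.mulVec, Finset.mul_sum, Pi.star_apply]
  exact Finset.sum_congr rfl fun i _ => Finset.sum_congr rfl fun j _ => by ring

/-- Integration by parts for the sesquilinear form of `J`. -/
lemma form_primitive [IsFiniteMeasure m] (J : Matrix (Fin n) (Fin n) ℂ) {ξ η : ℝ → Fin n → ℂ}
    (hξ : Integrable ξ m) (hη : Integrable η m) (c d : Fin n → ℂ) :
    star (d + ∫ t, η t ∂m) ⬝ᵥ (J *ᵥ (c + ∫ t, ξ t ∂m)) = star d ⬝ᵥ (J *ᵥ c) +
      ∫ t, (star (d + balPrim m η t) ⬝ᵥ (J *ᵥ ξ t) + star (η t) ⬝ᵥ (J *ᵥ (c + balPrim m ξ t))) ∂m := by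
  have hi : ∀ i j, Integrable (fun t => (star (d i) + balPrim m (fun s => star (η s i)) t) * ξ t j +
      star (η t i) * (c j + balPrim m (fun s => ξ s j) t)) m := fun i j =>
    integrable_mul_primitive (integrable_apply hξ j) (integrable_star (integrable_apply hη i)) _ _
  have h1 : ∀ t, star (d + balPrim m η t) ⬝ᵥ (J *ᵥ ξ t) +
      star (η t) ⬝ᵥ (J *ᵥ (c + balPrim m ξ t)) = ∑ i, ∑ j, J i j *
        ((star (d i) + balPrim m (fun s => star (η s i)) t) * ξ t j +
          star (η t i) * (c j + balPrim m (fun s => ξ s j) t)) := by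
    intro t
    rw [sesq_eq_sum, sesq_eq_sum, ← Finset.sum_add_distrib]
    refine Finset.sum_congr rfl fun i _ => ?_
    rw [← Finset.sum_add_distrib]
    refine Finset.sum_congr rfl fun j _ => ?_
    rw [Pi.add_apply, Pi.add_apply, star_add, balPrim_apply hη, balPrim_apply hξ, balPrim_star]
    ring
  have h2 := (integral_congr_ae (μ := m) (Eventually.of_forall h1)).trans
    (integral_sum_sum fun i j => (hi i j).const_mul (J i j))
  rw [h2, sesq_eq_sum, sesq_eq_sum, ← Finset.sum_add_distrib]
  refine Finset.sum_congr rfl fun i _ => ?_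
  rw [← Finset.sum_add_distrib]
  refine Finset.sum_congr rfl fun j _ => ?_
  rw [integral_const_mul, ← mul_add, Pi.add_apply, Pi.add_apply, star_add, integral_apply' hξ,
    integral_apply' hη, integral_star,
    mul_primitive (integrable_apply hξ j) (integrable_star (integrable_apply hη i))]

end Primitive

/-! ### Existence of solutions in the presence of atoms -/

section GlobalSolution

variable {m : Measure ℝ} {n : ℕ}

/-- The density `J⁻¹ (F - k u)` of the derivative of a solution `u` of `J u' + k u = F`. -/
def solDensity (J : Matrix (Fin n) (Fin n) ℂ) (k : ℝ → Matrix (Fin n) (Fin n) ℂ)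
    (F u : ℝ → Fin n → ℂ) (x : ℝ) : Fin n → ℂ := J⁻¹ *ᵥ (F x - k x *ᵥ u x)

/-- `u` is a bounded balanced solution of `J u' + k u = F`, with respect to the measure `m`, with
limit `c` at `-∞`. -/
structure IsGlobalSol (m : Measure ℝ) (J : Matrix (Fin n) (Fin n) ℂ)
    (k : ℝ → Matrix (Fin n) (Fin n) ℂ) (F : ℝ → Fin n → ℂ) (c : Fin n → ℂ)
    (u : ℝ → Fin n → ℂ) : Prop where
  integrable : Integrable (solDensity J k F u) m
  eq_add : ∀ x, u x = c + balPrim m (solDensity J k F u) x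

/-- The weak non-degeneracy condition at the atoms of the measure. -/
def Regular (m : Measure ℝ) (J : Matrix (Fin n) (Fin n) ℂ) (k : ℝ → Matrix (Fin n) (Fin n) ℂ) :
    Prop := ∀ x, IsUnit (J + (m.real {x} / 2 : ℂ) • k x)

variable {J : Matrix (Fin n) (Fin n) ℂ} {k : ℝ → Matrix (Fin n) (Fin n) ℂ}

/-- A finite measure has only finitely many atoms at which `k` contributes more than a given amount.
Away from them the perturbation of `J` is small and the inverse is bounded by `2 e`; the finitely
many remaining inverses are added to the constant. -/
lemma exists_bound_inv (hJ : IsUnit J) (hk : ∀ i j, Integrable (fun x => k x i j) m)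
    (hr : Regular m J k) :
    ∃ C, ∀ x z, ‖(J + (m.real {x} / 2 : ℂ) • k x)⁻¹ *ᵥ z‖ ≤ C * ‖z‖ := by
  set e := entrySum J⁻¹
  have he : 0 ≤ e := entrySum_nonneg _
  set μ := m.withDensity fun t => ENNReal.ofReal (entrySum (k t)) with hμ
  have hfin : IsFiniteMeasure μ := isFiniteMeasure_withDensity_ofReal (integrable_entrySum hk).2
  -- Below this threshold `e` times the norm of the half-jump is at most `1 / 2`, so `‖y‖ ≤ e ‖z‖ +
  -- ‖y‖ / 2`.
  set ε : ENNReal := ENNReal.ofReal (1 / (e + 1)) with hε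
  have hbad : {x | ε ≤ μ {x}}.Finite := by
    refine Measure.finite_const_le_meas_of_disjoint_iUnion μ (by rw [hε]; positivity)
      (fun x => measurableSet_singleton x) (fun x y hxy => disjoint_singleton.2 hxy)
      (measure_ne_top _ _)
  set R := fun x => (J + (m.real {x} / 2 : ℂ) • k x)⁻¹ with hR
  refine ⟨2 * e + ∑ x ∈ hbad.toFinset, entrySum (R x), fun x z => ?_⟩
  have h0 : 0 ≤ ∑ x ∈ hbad.toFinset, entrySum (R x) :=
    Finset.sum_nonneg fun _ _ => entrySum_nonneg _
  by_cases hx : ε ≤ μ {x}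
  · refine (norm_mulVec_le_entrySum _ _).trans (mul_le_mul_of_nonneg_right ?_ (norm_nonneg _))
    have := Finset.single_le_sum (f := fun x => entrySum (R x)) (s := hbad.toFinset)
      (fun _ _ => entrySum_nonneg _) (hbad.mem_toFinset.2 hx)
    exact this.trans (by linarith)
  · have h1 : m.real {x} * entrySum (k x) ≤ 1 / (e + 1) := by
      have h2 : μ {x} = ENNReal.ofReal (entrySum (k x)) * m {x} := by
        rw [hμ, withDensity_apply _ (measurableSet_singleton x), lintegral_singleton]
      rw [not_le, h2] at hx
      have h3 := ENNReal.toReal_mono ENNReal.ofReal_ne_top hx.le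
      rwa [ENNReal.toReal_mul, ENNReal.toReal_ofReal (entrySum_nonneg _),
        ENNReal.toReal_ofReal (by positivity), mul_comm] at h3
    set y := R x *ᵥ z with hy
    have hA : (J + (m.real {x} / 2 : ℂ) • k x) *ᵥ y = z := by
      rw [hy, hR, Matrix.mulVec_mulVec,
        Matrix.mul_nonsing_inv _ ((Matrix.isUnit_iff_isUnit_det _).1 (hr x)), Matrix.one_mulVec]
    have h4 : y = J⁻¹ *ᵥ (z - (m.real {x} / 2 : ℂ) • (k x *ᵥ y)) := by
      rw [← hA, Matrix.add_mulVec, Matrix.smul_mulVec, add_sub_cancel_right, Matrix.mulVec_mulVec,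
        Matrix.nonsing_inv_mul _ ((Matrix.isUnit_iff_isUnit_det _).1 hJ), Matrix.one_mulVec]
    have h5 : ‖y‖ ≤ e * (‖z‖ + m.real {x} / 2 * (entrySum (k x) * ‖y‖)) := by
      conv_lhs => rw [h4]
      refine (norm_mulVec_le_entrySum _ _).trans (mul_le_mul_of_nonneg_left ?_ he)
      refine (norm_sub_le _ _).trans (add_le_add_right ?_ _)
      rw [norm_smul]
      have : ‖(m.real {x} / 2 : ℂ)‖ = m.real {x} / 2 := by
        rw [norm_div, Complex.norm_real, Real.norm_of_nonneg measureReal_nonneg]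
        simp
      rw [this]
      exact mul_le_mul_of_nonneg_left (norm_mulVec_le_entrySum _ _) (by positivity)
    have h6 : e * (m.real {x} / 2 * (entrySum (k x) * ‖y‖)) ≤ ‖y‖ / 2 := by
      have h7 : e * (m.real {x} * entrySum (k x)) ≤ 1 :=
        (mul_le_mul_of_nonneg_left h1 he).trans (by
          rw [mul_one_div, div_le_one (by positivity)]
          linarith)
      have h8 := mul_le_mul_of_nonneg_right h7 (norm_nonneg y)
      linarith
    have h7 : 0 ≤ (∑ x ∈ hbad.toFinset, entrySum (R x)) * ‖z‖ := mul_nonneg h0 (norm_nonneg _)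
    change ‖y‖ ≤ _
    linarith

variable [IsFiniteMeasure m]

/-- Existence of solutions with prescribed limit at `-∞`. -/
theorem exists_globalSol (hJ : IsUnit J) (hk : ∀ i j, Integrable (fun x => k x i j) m)
    (hkm : ∀ i j, Measurable fun x => k x i j) (hr : Regular m J k) {F : ℝ → Fin n → ℂ}
    (hF : Integrable F m) (c : Fin n → ℂ) :
    ∃ u, IsGlobalSol m J k F c u ∧ AEStronglyMeasurable u m ∧ ∃ B, ∀ x, ‖u x‖ ≤ B := by
  obtain ⟨C, hC⟩ := exists_bound_inv hJ hk hr
  -- A balanced solution `u` with left limit `v` satisfies `(J + m{x}/2 k) u = J v + G`, where `G =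
  -- m{x}/2 F`. Hence `u = R (J v + G)`, and inserting this under the integral leaves a Volterra
  -- equation for `v` with kernel `-J⁻¹ k R J`.
  set R := fun x => (J + (m.real {x} / 2 : ℂ) • k x)⁻¹ with hR
  have hRm : ∀ i j, Measurable fun x => R x i j := by
    refine measurable_matrix_inv_apply fun i j => ?_
    simp only [Matrix.add_apply, Matrix.smul_apply, smul_eq_mul]
    exact measurable_const.add (((Complex.measurable_ofReal.comp (measurable_real_singleton m)
      ).div_const 2).mul (hkm i j))
  set G := fun x => (m.real {x} / 2 : ℂ) • F x with hG
  have hGm : AEStronglyMeasurable G m :=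
    (((Complex.measurable_ofReal.comp (measurable_real_singleton m)
      ).div_const 2).aestronglyMeasurable).smul hF.1
  have hGb : ∀ x, ‖G x‖ ≤ ∫ t, ‖F t‖ ∂m := fun x => by
    have h1 := real_singleton_mul_norm_le hF x
    have h2 : ‖(m.real {x} / 2 : ℂ)‖ = m.real {x} / 2 := by
      rw [norm_div, Complex.norm_real, Real.norm_of_nonneg measureReal_nonneg]
      simp
    have h3 : 0 ≤ ∫ t, ‖F t‖ ∂m := integral_nonneg fun _ => norm_nonneg _
    rw [hG, norm_smul, h2]
    linarith
  have hC' : ∀ x z, ‖R x *ᵥ z‖ ≤ |C| * ‖z‖ := fun x z =>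
    (hC x z).trans (mul_le_mul_of_nonneg_right (le_abs_self C) (norm_nonneg _))
  have hRG : Integrable (fun x => k x *ᵥ (R x *ᵥ G x)) m :=
    integrable_mulVec_of_bounded hk
      (aestronglyMeasurable_mulVec (fun i j => (hRm i j).aestronglyMeasurable) hGm)
      (Eventually.of_forall fun x => (hC' x _).trans
        (mul_le_mul_of_nonneg_left (hGb x) (abs_nonneg C)))
  have hf : Integrable (fun x => J⁻¹ *ᵥ (F x - k x *ᵥ (R x *ᵥ G x))) m :=
    integrable_mulVec_const _ (hF.sub hRG)
  set g := fun x => c + ∫ t in Iio x, J⁻¹ *ᵥ (F t - k t *ᵥ (R t *ᵥ G t)) ∂m with hg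
  have hK : ∀ i j, Integrable (fun x => (-(J⁻¹ * (k x * (R x * J)))) i j) m := by
    intro i j
    have h1 : Integrable (fun x => k x *ᵥ (R x *ᵥ (J *ᵥ Pi.single j 1))) m :=
      integrable_mulVec_of_bounded hk
        (measurable_mulVec hRm measurable_const).aestronglyMeasurable
        (Eventually.of_forall fun x => hC' x _)
    have h2 := integrable_apply (integrable_mulVec_const J⁻¹ h1).neg i
    refine h2.congr (Eventually.of_forall fun x => ?_)
    have h3 : J⁻¹ *ᵥ (k x *ᵥ (R x *ᵥ (J *ᵥ Pi.single j 1))) =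
        (J⁻¹ * (k x * (R x * J))) *ᵥ Pi.single j 1 := by
      simp only [← Matrix.mulVec_mulVec]
    have h4 : ((J⁻¹ * (k x * (R x * J))) *ᵥ Pi.single j 1) i = (J⁻¹ * (k x * (R x * J))) i j := by
      rw [Matrix.mulVec_single_one]
      rfl
    exact congrArg Neg.neg ((congrFun h3 i).trans h4)
  obtain ⟨v, hvm, ⟨B, hB⟩, hv⟩ := exists_volterra hK (g := g)
    (measurable_const.add (measurable_setIntegral_Iio hf.1).measurable)
    (fun x => (norm_add_le _ _).trans (add_le_add_right (norm_setIntegral_le hf (Iio x)) _))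
  set u := fun x => R x *ᵥ (J *ᵥ v x + G x) with hu
  have hJd := (Matrix.isUnit_iff_isUnit_det _).1 hJ
  have hum : AEStronglyMeasurable u m := by
    refine aestronglyMeasurable_mulVec (fun i j => (hRm i j).aestronglyMeasurable) ?_
    exact (measurable_mulVec (A := fun _ => J) (fun _ _ => measurable_const)
      hvm).aestronglyMeasurable.add hGm
  have hub : ∀ x, ‖u x‖ ≤ |C| * (entrySum J * B + ∫ t, ‖F t‖ ∂m) := fun x => by
    refine (hC' x _).trans (mul_le_mul_of_nonneg_left ?_ (abs_nonneg C))
    refine (norm_add_le _ _).trans (add_le_add ?_ (hGb x))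
    exact (norm_mulVec_le_entrySum _ _).trans
      (mul_le_mul_of_nonneg_left (hB x) (entrySum_nonneg _))
  have hξ : Integrable (solDensity J k F u) m :=
    integrable_mulVec_const _ (hF.sub (integrable_mulVec_of_bounded hk hum
      (Eventually.of_forall hub)))
  have hvξ : ∀ x, v x = c + ∫ t in Iio x, solDensity J k F u t ∂m := by
    intro x
    have h1 : ∀ t, -(J⁻¹ * (k t * (R t * J))) *ᵥ v t = solDensity J k F u t -
        J⁻¹ *ᵥ (F t - k t *ᵥ (R t *ᵥ G t)) := by
      intro t
      simp only [solDensity, hu, Matrix.neg_mulVec, ← Matrix.mulVec_mulVec, Matrix.mulVec_sub,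
        Matrix.mulVec_add]
      abel
    rw [hv x]
    simp only [h1]
    rw [integral_sub hξ.restrict hf.restrict, hg, add_assoc, add_sub_cancel]
  refine ⟨u, ⟨hξ, fun x => ?_⟩, hum, _, hub⟩
  have h1 : (J + (m.real {x} / 2 : ℂ) • k x) *ᵥ u x = J *ᵥ v x + G x := by
    rw [hu, Matrix.mulVec_mulVec,
        Matrix.mul_nonsing_inv _ ((Matrix.isUnit_iff_isUnit_det _).1 (hr x)), Matrix.one_mulVec]
  have h2 : u x = v x + (m.real {x} / 2 : ℂ) • solDensity J k F u x := by
    have h3 : J *ᵥ u x = J *ᵥ v x + (m.real {x} / 2 : ℂ) • (F x - k x *ᵥ u x) := by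
      rw [Matrix.add_mulVec, Matrix.smul_mulVec] at h1
      rw [smul_sub, eq_sub_of_add_eq h1]
      abel
    have h4 := congrArg (J⁻¹ *ᵥ ·) h3
    rw [solDensity]
    simpa only [Matrix.mulVec_add, Matrix.mulVec_smul, Matrix.mulVec_mulVec,
      Matrix.nonsing_inv_mul _ hJd, Matrix.one_mulVec] using h4
  rw [h2, hvξ x, balPrim, add_assoc]
  congr 2
  rw [← Complex.coe_smul]
  push_cast
  rfl

end GlobalSolution

end

end DistSystem

namespace DistSystem

noncomputable section

/-! ### One-sided limits and integrability of functions of bounded variation -/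

section BoundedVariation

variable {E : Type*} [NormedAddCommGroup E] {I : Set ℝ}

lemma exists_Icc_subset (hI : IsOpen I) {x : ℝ} (hx : x ∈ I) :
    ∃ δ > 0, Icc (x - δ) (x + δ) ⊆ I := by
  obtain ⟨δ, hδ, h⟩ := Metric.isOpen_iff.1 hI x hx
  refine ⟨δ / 2, by positivity, fun y hy => h ?_⟩
  rw [Metric.mem_ball, Real.dist_eq, abs_lt]
  constructor <;> linarith [hy.1, hy.2]

lemma tendsto_leftLim_of_mem [CompleteSpace E] (hI : IsOpen I) {u : ℝ → E}
    (hu : LocallyBoundedVariationOn u I) {x : ℝ} (hx : x ∈ I) :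
    Tendsto u (𝓝[<] x) (𝓝 (Function.leftLim u x)) := by
  obtain ⟨δ, hδ, h⟩ := exists_Icc_subset hI hx
  obtain ⟨l, hl⟩ := (hu _ _ (h ⟨le_rfl, by linarith⟩) (h ⟨by linarith, le_rfl⟩)).exists_tendsto_left x
  refine tendsto_leftLim_of_tendsto ⟨l, hl.mono_left ?_⟩
  have h1 : I ∩ Icc (x - δ) (x + δ) ∈ 𝓝 x :=
    inter_mem (hI.mem_nhds hx) (Icc_mem_nhds (by linarith) (by linarith))
  exact le_inf inf_le_left (le_principal_iff.2 (inter_mem (mem_inf_of_left h1) (mem_inf_of_right (mem_principal_self _))))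

lemma tendsto_rightLim_of_mem [CompleteSpace E] (hI : IsOpen I) {u : ℝ → E}
    (hu : LocallyBoundedVariationOn u I) {x : ℝ} (hx : x ∈ I) :
    Tendsto u (𝓝[>] x) (𝓝 (Function.rightLim u x)) := by
  obtain ⟨δ, hδ, h⟩ := exists_Icc_subset hI hx
  obtain ⟨l, hl⟩ := (hu _ _ (h ⟨le_rfl, by linarith⟩) (h ⟨by linarith, le_rfl⟩)).exists_tendsto_right x
  refine tendsto_rightLim_of_tendsto ⟨l, hl.mono_left ?_⟩
  have h1 : I ∩ Icc (x - δ) (x + δ) ∈ 𝓝 x :=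
    inter_mem (hI.mem_nhds hx) (Icc_mem_nhds (by linarith) (by linarith))
  exact le_inf inf_le_left (le_principal_iff.2 (inter_mem (mem_inf_of_left h1) (mem_inf_of_right (mem_principal_self _))))

lemma integrableOn_Icc_of_boundedVariation {m : Measure ℝ} [IsFiniteMeasureOnCompacts m]
    {u : ℝ → ℂ} (hI : I.OrdConnected) (hu : LocallyBoundedVariationOn u I) {x y : ℝ} (hx : x ∈ I)
    (hy : y ∈ I) : IntegrableOn u (Icc x y) m := by
  have h : ∀ v : ℝ → ℝ, LocallyBoundedVariationOn v I → IntegrableOn v (Icc x y) m := by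
    intro v hv
    obtain ⟨p, q, hp, hq, rfl⟩ := hv.exists_monotoneOn_sub_monotoneOn
    have h := hI.out hx hy
    exact ((hp.mono h).integrableOn_isCompact isCompact_Icc).sub
      ((hq.mono h).integrableOn_isCompact isCompact_Icc)
  have h1 := h _ (Complex.reCLM.lipschitz.comp_locallyBoundedVariationOn hu)
  have h2 := h _ (Complex.imCLM.lipschitz.comp_locallyBoundedVariationOn hu)
  have h3 : u = fun t => ((Complex.reCLM ∘ u) t : ℂ) + ((Complex.imCLM ∘ u) t : ℂ) * Complex.I := by
    funext t
    exact (Complex.re_add_im (u t)).symm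
  rw [h3]
  exact h1.ofReal.add (h2.ofReal.mul_const _)

lemma exists_bound_of_boundedVariation {u : ℝ → E}
    (hu : LocallyBoundedVariationOn u I) {x y : ℝ} (hx : x ∈ I) (hy : y ∈ I) (hxy : x ≤ y) :
    ∃ C, ∀ t ∈ I ∩ Icc x y, ‖u t‖ ≤ C := by
  refine ⟨(eVariationOn u (I ∩ Icc x y)).toReal + ‖u x‖, fun t ht => ?_⟩
  have h := (hu x y hx hy).dist_le ht ⟨hx, le_rfl, hxy⟩
  rw [dist_eq_norm] at h
  have := norm_sub_norm_le (u t) (u x)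
  linarith

end BoundedVariation

/-! ### Smooth ramps as test functions -/

section Ramp

/-- A smooth step from `0` to `1` on `[c, d]`. -/
def ramp (c d x : ℝ) : ℝ := Real.smoothTransition ((x - c) / (d - c))

variable {c d : ℝ}

lemma contDiff_ramp (c d : ℝ) (k : ℕ∞) : ContDiff ℝ k (ramp c d) :=
  Real.smoothTransition.contDiff.comp ((contDiff_id.sub contDiff_const).div_const _)

lemma differentiable_ramp (c d : ℝ) : Differentiable ℝ (ramp c d) :=
  (contDiff_ramp c d 1).differentiable (by simp)

lemma continuous_deriv_ramp (c d : ℝ) : Continuous (deriv (ramp c d)) :=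
  (contDiff_ramp c d 1).continuous_deriv (by simp)

lemma ramp_of_le (h : c < d) {x : ℝ} (hx : x ≤ c) : ramp c d x = 0 :=
  Real.smoothTransition.zero_of_nonpos (div_nonpos_of_nonpos_of_nonneg (by linarith) (by linarith))

lemma ramp_of_ge (h : c < d) {x : ℝ} (hx : d ≤ x) : ramp c d x = 1 :=
  Real.smoothTransition.one_of_one_le ((one_le_div (by linarith)).2 (by linarith))

lemma norm_ramp_le (x : ℝ) : ‖ramp c d x‖ ≤ 1 := by
  rw [ramp, Real.norm_of_nonneg (Real.smoothTransition.nonneg _)]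
  exact Real.smoothTransition.le_one _

lemma monotone_ramp (h : c < d) : Monotone (ramp c d) := fun x y hxy =>
  Real.smoothTransition.monotone (div_le_div_of_nonneg_right (by linarith) (by linarith))

lemma deriv_ramp_of_notMem (h : c < d) {x : ℝ} (hx : x ∉ Icc c d) : deriv (ramp c d) x = 0 := by
  rcases not_and_or.1 hx with h1 | h1
  · have : ramp c d =ᶠ[𝓝 x] fun _ => 0 := by
      filter_upwards [Iio_mem_nhds (not_le.1 h1)] with y hy using ramp_of_le h (le_of_lt hy)
    rw [this.deriv_eq, deriv_const]
  · have : ramp c d =ᶠ[𝓝 x] fun _ => 1 := by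
      filter_upwards [Ioi_mem_nhds (not_le.1 h1)] with y hy using ramp_of_ge h (le_of_lt hy)
    rw [this.deriv_eq, deriv_const]

lemma setIntegral_deriv_ramp (h : c < d) : ∫ x in Ioc c d, deriv (ramp c d) x = 1 := by
  rw [← intervalIntegral.integral_of_le h.le, intervalIntegral.integral_deriv_eq_sub
    (fun x _ => differentiable_ramp c d x) ((continuous_deriv_ramp c d).intervalIntegrable _ _),
    ramp_of_ge h le_rfl, ramp_of_le h le_rfl, sub_zero]

lemma integral_deriv_ramp_mul (h : c < d) (u : ℝ → ℂ) :
    ∫ x, ((deriv (ramp c d) x : ℝ) : ℂ) * u x = ∫ x in Ioc c d, ((deriv (ramp c d) x : ℝ) : ℂ) * u x := by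
  rw [← integral_Icc_eq_integral_Ioc, setIntegral_eq_integral_of_forall_compl_eq_zero]
  intro x hx
  rw [deriv_ramp_of_notMem h hx]
  simp

lemma integrableOn_deriv_ramp_mul {u : ℝ → ℂ} (hu : IntegrableOn u (Icc c d)) :
    IntegrableOn (fun x => ((deriv (ramp c d) x : ℝ) : ℂ) * u x) (Icc c d) :=
  hu.continuousOn_mul (Complex.continuous_ofReal.comp (continuous_deriv_ramp c d)).continuousOn
    isCompact_Icc

lemma integrable_deriv_ramp_mul (h : c < d) {u : ℝ → ℂ} (hu : IntegrableOn u (Icc c d)) :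
    Integrable (fun x => ((deriv (ramp c d) x : ℝ) : ℂ) * u x) := by
  refine (integrableOn_iff_integrable_of_support_subset fun x hx => ?_).1
    (integrableOn_deriv_ramp_mul hu)
  by_contra h1
  exact hx (by simp only [deriv_ramp_of_notMem h h1]; simp)

/-- The derivative of a ramp is a probability density on `[c, d]`, so the integral is an average of
`u`. Only the open interval matters, which suits one-sided limits. -/
lemma norm_integral_deriv_ramp_sub_le (h : c < d) {u : ℝ → ℂ} (hu : IntegrableOn u (Icc c d))
    {L : ℂ} {δ : ℝ} (hL : ∀ x ∈ Ioo c d, ‖u x - L‖ ≤ δ) :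
    ‖(∫ x, ((deriv (ramp c d) x : ℝ) : ℂ) * u x) - L‖ ≤ δ := by
  have h1 : (∫ x in Ioc c d, ((deriv (ramp c d) x : ℝ) : ℂ) * L) = L := by
    rw [integral_mul_const, integral_complex_ofReal, setIntegral_deriv_ramp h]
    simp
  have hc : IntegrableOn (fun x => ((deriv (ramp c d) x : ℝ) : ℂ)) (Ioc c d) :=
    ((Complex.continuous_ofReal.comp (continuous_deriv_ramp c d)).integrableOn_Icc).mono_set
      Ioc_subset_Icc_self
  rw [integral_deriv_ramp_mul h]
  rw [← h1]
  rw [← integral_sub ((integrableOn_deriv_ramp_mul hu).mono_set Ioc_subset_Icc_self)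
    (hc.mul_const L)]
  have h2 : ∫ x in Ioc c d, δ * deriv (ramp c d) x = δ := by
    rw [integral_const_mul, setIntegral_deriv_ramp h, mul_one]
  refine le_of_le_of_eq (norm_integral_le_of_norm_le (((continuous_deriv_ramp c d).integrableOn_Icc.mono_set
    Ioc_subset_Icc_self).const_mul δ) ?_) h2
  rw [← restrict_Ioo_eq_restrict_Ioc]
  filter_upwards [ae_restrict_mem measurableSet_Ioo] with x hx
  rw [← mul_sub, norm_mul, Complex.norm_real, Real.norm_of_nonneg (monotone_ramp h).deriv_nonneg,
    mul_comm]
  exact mul_le_mul_of_nonneg_right (hL x hx) (monotone_ramp h).deriv_nonneg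

end Ramp

/-! ### From distributional equations to one-sided limits -/

section WeakEquation

variable {I : Set ℝ} {m : Measure ℝ} {u ξ : ℝ → ℂ}

/-- The equation `u' = ξ m` on `I`, in the sense of distributions. -/
def WeakDeriv (I : Set ℝ) (m : Measure ℝ) (u ξ : ℝ → ℂ) : Prop :=
  ∀ φ : ℝ → ℝ, ContDiff ℝ (⊤ : ℕ∞) φ → HasCompactSupport φ → tsupport φ ⊆ I →
    -(∫ x, ((deriv φ x : ℝ) : ℂ) * u x) = ∫ x, (φ x : ℂ) * ξ x ∂m

/-- The difference of two ramps is an admissible test function although a single ramp is not. As the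
ramps steepen, the averages of `u` tend to its one-sided limits, and dominated convergence replaces
the test functions by differences of indicators. -/
lemma WeakDeriv.sub_eq_of_tendsto (h : WeakDeriv I m u ξ) (hI : I.OrdConnected)
    (hu : ∀ x ∈ I, ∀ y ∈ I, IntegrableOn u (Icc x y))
    (hξ : ∀ x ∈ I, ∀ y ∈ I, IntegrableOn ξ (Icc x y) m)
    {c d c' d' : ℕ → ℝ} {α β : ℝ} (hα : α ∈ I) (hβ : β ∈ I)
    (hc : ∀ k, α ≤ c k ∧ c k < d k ∧ d k ≤ β) (hc' : ∀ k, α ≤ c' k ∧ c' k < d' k ∧ d' k ≤ β)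
    {L L' : ℂ} (hL : Tendsto (fun k => ∫ x, ((deriv (ramp (c k) (d k)) x : ℝ) : ℂ) * u x) atTop (𝓝 L))
    (hL' : Tendsto (fun k => ∫ x, ((deriv (ramp (c' k) (d' k)) x : ℝ) : ℂ) * u x) atTop (𝓝 L'))
    {s s' : Set ℝ}
    (hs : ∀ x, Tendsto (fun k => ramp (c k) (d k) x) atTop (𝓝 (s.indicator 1 x)))
    (hs' : ∀ x, Tendsto (fun k => ramp (c' k) (d' k) x) atTop (𝓝 (s'.indicator 1 x))) :
    L' - L = ∫ x, ((s.indicator 1 x - s'.indicator 1 x : ℝ) : ℂ) * ξ x ∂m := by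
  set φ : ℕ → ℝ → ℝ := fun k => ramp (c k) (d k) - ramp (c' k) (d' k) with hφ
  have hsupp : ∀ k x, x ∉ Icc α β → φ k x = 0 := by
    intro k x hx
    obtain ⟨h1, h2, h3⟩ := hc k
    obtain ⟨h1', h2', h3'⟩ := hc' k
    rcases not_and_or.1 hx with hx | hx <;> rw [not_le] at hx
    · simp [hφ, ramp_of_le h2 (hx.le.trans h1), ramp_of_le h2' (hx.le.trans h1')]
    · simp [hφ, ramp_of_ge h2 (h3.trans hx.le), ramp_of_ge h2' (h3'.trans hx.le)]
  have hts : ∀ k, tsupport (φ k) ⊆ Icc α β := fun k =>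
    closure_minimal (fun x hx => by_contra fun h1 => hx (hsupp k x h1)) isClosed_Icc
  have key : ∀ k, (∫ x, ((deriv (ramp (c' k) (d' k)) x : ℝ) : ℂ) * u x) -
      (∫ x, ((deriv (ramp (c k) (d k)) x : ℝ) : ℂ) * u x) = ∫ x, (φ k x : ℂ) * ξ x ∂m := by
    intro k
    obtain ⟨h1, h2, h3⟩ := hc k
    obtain ⟨h1', h2', h3'⟩ := hc' k
    rw [← h (φ k) ((contDiff_ramp _ _ _).sub (contDiff_ramp _ _ _))
      (HasCompactSupport.of_support_subset_isCompact isCompact_Icc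
        ((subset_tsupport _).trans (hts k))) ((hts k).trans (hI.out hα hβ)),
      ← integral_sub (integrable_deriv_ramp_mul h2' ((hu α hα β hβ).mono_set
        (Icc_subset_Icc h1' h3'))) (integrable_deriv_ramp_mul h2 ((hu α hα β hβ).mono_set
        (Icc_subset_Icc h1 h3))), ← integral_neg]
    refine integral_congr_ae (Eventually.of_forall fun x => ?_)
    have : deriv (φ k) x = deriv (ramp (c k) (d k)) x - deriv (ramp (c' k) (d' k)) x :=
      deriv_sub (differentiable_ramp _ _ x) (differentiable_ramp _ _ x)
    simp only [this]
    push_cast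
    ring
  have hlim := hL'.sub hL
  simp only [key] at hlim
  refine tendsto_nhds_unique hlim ?_
  have hint : Integrable ((Icc α β).indicator ξ) m :=
    (integrable_indicator_iff measurableSet_Icc).2 (hξ α hα β hβ)
  have heq : ∀ k x, (φ k x : ℂ) * ξ x = (φ k x : ℂ) * (Icc α β).indicator ξ x := by
    intro k x
    by_cases hx : x ∈ Icc α β
    · rw [indicator_of_mem hx]
    · rw [hsupp k x hx]; simp
  refine tendsto_integral_of_dominated_convergence (fun x => 2 * ‖(Icc α β).indicator ξ x‖)
    (fun k => ?_) (hint.norm.const_mul 2) (fun k => Eventually.of_forall fun x => ?_)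
    (Eventually.of_forall fun x => ?_)
  · simp only [heq]
    refine AEStronglyMeasurable.mul ?_ hint.1
    exact (Complex.continuous_ofReal.comp ((contDiff_ramp _ _ 0).continuous.sub
      (contDiff_ramp _ _ 0).continuous)).aestronglyMeasurable
  · rw [heq, norm_mul, Complex.norm_real]
    refine mul_le_mul_of_nonneg_right ((norm_sub_le _ _).trans ?_) (norm_nonneg _)
    linarith [norm_ramp_le (c := c k) (d := d k) x, norm_ramp_le (c := c' k) (d := d' k) x]
  · exact ((Complex.continuous_ofReal.tendsto _).comp ((hs x).sub (hs' x))).mul_const _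

lemma tendsto_integral_deriv_ramp {c d : ℕ → ℝ} (hcd : ∀ k, c k < d k)
    (hu : ∀ k, IntegrableOn u (Icc (c k) (d k))) {L : ℂ}
    (h : ∀ δ > 0, ∀ᶠ k in atTop, ∀ x ∈ Ioo (c k) (d k), ‖u x - L‖ ≤ δ) :
    Tendsto (fun k => ∫ x, ((deriv (ramp (c k) (d k)) x : ℝ) : ℂ) * u x) atTop (𝓝 L) := by
  rw [Metric.tendsto_atTop']
  intro ε hε
  obtain ⟨N, hN⟩ := eventually_atTop.1 (h (ε / 2) (by positivity))
  refine ⟨N, fun k hk => ?_⟩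
  rw [dist_eq_norm]
  exact (norm_integral_deriv_ramp_sub_le (hcd k) (hu k) (hN k hk.le)).trans_lt (by linarith)

/-- The ramps rise on `[x - δ/(k+1), x]`, hence equal `1` at `x`: the limit is the indicator of `Ici
x`. Ramps rising to the right of `x` give `Ioi x`, so comparing both isolates the atom at `x`. -/
lemma exists_ramp_left (hI : IsOpen I) (hIc : I.OrdConnected) (hu : LocallyBoundedVariationOn u I) {x : ℝ} (hx : x ∈ I) :
    ∃ (c d : ℕ → ℝ) (α : ℝ), α ∈ I ∧ (∀ k, α ≤ c k ∧ c k < d k ∧ d k ≤ x) ∧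
      Tendsto (fun k => ∫ x, ((deriv (ramp (c k) (d k)) x : ℝ) : ℂ) * u x) atTop
        (𝓝 (Function.leftLim u x)) ∧
      ∀ y, Tendsto (fun k => ramp (c k) (d k) y) atTop (𝓝 ((Ici x).indicator 1 y)) := by
  obtain ⟨δ, hδ, h⟩ := exists_Icc_subset hI hx
  have hlim : Tendsto (fun k : ℕ => x - δ * (1 / ((k : ℝ) + 1))) atTop (𝓝 x) := by
    simpa using tendsto_const_nhds.sub (tendsto_one_div_add_atTop_nhds_zero_nat.const_mul δ)
  have hk : ∀ k : ℕ, 0 < δ * (1 / ((k : ℝ) + 1)) ∧ δ * (1 / ((k : ℝ) + 1)) ≤ δ := fun k => by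
    refine ⟨by positivity, mul_le_of_le_one_right hδ.le ?_⟩
    rw [div_le_one (by positivity)]
    linarith [(Nat.cast_nonneg k : (0 : ℝ) ≤ k)]
  have hα := h ⟨le_rfl, by linarith⟩
  refine ⟨fun k => x - δ * (1 / ((k : ℝ) + 1)), fun _ => x, x - δ, hα, fun k => ⟨by linarith [hk k],
    by linarith [hk k], le_rfl⟩, tendsto_integral_deriv_ramp (fun k => by linarith [hk k])
    (fun k => (integrableOn_Icc_of_boundedVariation hIc hu hα hx).mono_set
      (Icc_subset_Icc (by linarith [hk k]) le_rfl)) fun ε hε => ?_, fun y => ?_⟩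
  · have h1 := Metric.tendsto_nhds.1 (tendsto_leftLim_of_mem hI hu hx) ε hε
    obtain ⟨l, hl, hl'⟩ := (mem_nhdsLT_iff_exists_Ioo_subset).1 h1
    filter_upwards [hlim.eventually (Ioi_mem_nhds hl)] with k hk y hy
    have := hl' ⟨lt_trans hk hy.1, hy.2⟩
    rw [mem_ofPred_eq, dist_eq_norm] at this
    exact this.le
  · by_cases hy : x ≤ y
    · rw [indicator_of_mem (mem_Ici.2 hy)]
      refine tendsto_const_nhds.congr fun k => ?_
      rw [ramp_of_ge (by linarith [hk k]) hy]
      rfl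
    · rw [indicator_of_notMem (by simpa using hy)]
      refine tendsto_const_nhds.congr' ?_
      filter_upwards [hlim.eventually (Ioi_mem_nhds (not_le.1 hy))] with k hk'
      rw [ramp_of_le (by linarith [hk k]) (le_of_lt hk')]

lemma exists_ramp_right (hI : IsOpen I) (hIc : I.OrdConnected) (hu : LocallyBoundedVariationOn u I) {x : ℝ} (hx : x ∈ I) :
    ∃ (c d : ℕ → ℝ) (β : ℝ), β ∈ I ∧ (∀ k, x ≤ c k ∧ c k < d k ∧ d k ≤ β) ∧
      Tendsto (fun k => ∫ x, ((deriv (ramp (c k) (d k)) x : ℝ) : ℂ) * u x) atTop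
        (𝓝 (Function.rightLim u x)) ∧
      ∀ y, Tendsto (fun k => ramp (c k) (d k) y) atTop (𝓝 ((Ioi x).indicator 1 y)) := by
  obtain ⟨δ, hδ, h⟩ := exists_Icc_subset hI hx
  have hlim : Tendsto (fun k : ℕ => x + δ * (1 / ((k : ℝ) + 1))) atTop (𝓝 x) := by
    simpa using tendsto_const_nhds.add (tendsto_one_div_add_atTop_nhds_zero_nat.const_mul δ)
  have hk : ∀ k : ℕ, 0 < δ * (1 / ((k : ℝ) + 1)) ∧ δ * (1 / ((k : ℝ) + 1)) ≤ δ := fun k => by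
    refine ⟨by positivity, mul_le_of_le_one_right hδ.le ?_⟩
    rw [div_le_one (by positivity)]
    linarith [(Nat.cast_nonneg k : (0 : ℝ) ≤ k)]
  have hβ := h ⟨by linarith, le_rfl⟩
  refine ⟨fun _ => x, fun k => x + δ * (1 / ((k : ℝ) + 1)), x + δ, hβ, fun k => ⟨le_rfl,
    by linarith [hk k], by linarith [hk k]⟩, tendsto_integral_deriv_ramp (fun k => by linarith [hk k])
    (fun k => (integrableOn_Icc_of_boundedVariation hIc hu hx hβ).mono_set
      (Icc_subset_Icc le_rfl (by linarith [hk k]))) fun ε hε => ?_, fun y => ?_⟩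
  · have h1 := Metric.tendsto_nhds.1 (tendsto_rightLim_of_mem hI hu hx) ε hε
    obtain ⟨l, hl, hl'⟩ := (mem_nhdsGT_iff_exists_Ioo_subset).1 h1
    filter_upwards [hlim.eventually (Iio_mem_nhds hl)] with k hk y hy
    have := hl' ⟨hy.1, lt_trans hy.2 hk⟩
    rw [mem_ofPred_eq, dist_eq_norm] at this
    exact this.le
  · by_cases hy : x < y
    · rw [indicator_of_mem (mem_Ioi.2 hy)]
      refine tendsto_const_nhds.congr' ?_
      filter_upwards [hlim.eventually (Iio_mem_nhds hy)] with k hk'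
      rw [ramp_of_ge (by linarith [hk k]) (le_of_lt hk')]
      rfl
    · rw [indicator_of_notMem (by simpa using hy)]
      refine tendsto_const_nhds.congr fun k => ?_
      rw [ramp_of_le (by linarith [hk k]) (not_lt.1 hy)]

lemma WeakDeriv.leftLim_sub_leftLim (h : WeakDeriv I m u ξ) (hI : IsOpen I)
    (hIc : I.OrdConnected) (hu : LocallyBoundedVariationOn u I)
    (hξ : ∀ x ∈ I, ∀ y ∈ I, IntegrableOn ξ (Icc x y) m) {x y : ℝ} (hx : x ∈ I) (hy : y ∈ I)
    (hxy : x ≤ y) :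
    Function.leftLim u y - Function.leftLim u x = ∫ t in Ico x y, ξ t ∂m := by
  obtain ⟨c, d, α, hα, hcd, h1, h2⟩ := exists_ramp_left hI hIc hu hx
  obtain ⟨c', d', α', hα', hcd', h1', h2'⟩ := exists_ramp_left hI hIc hu hy
  have hmin : min α α' ∈ I := by rcases min_choice α α' with h | h <;> rwa [h]
  rw [h.sub_eq_of_tendsto hIc (fun _ hx _ hy => integrableOn_Icc_of_boundedVariation hIc hu hx hy) hξ
    hmin hy (fun k => ⟨(min_le_left _ _).trans (hcd k).1, (hcd k).2.1, (hcd k).2.2.trans hxy⟩)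
    (fun k => ⟨(min_le_right _ _).trans (hcd' k).1, (hcd' k).2⟩) h1 h1' h2 h2',
    ← integral_indicator measurableSet_Ico]
  refine integral_congr_ae (Eventually.of_forall fun t => ?_)
  by_cases ht : x ≤ t <;> by_cases ht' : y ≤ t
  · simp [indicator, ht, ht']
  · simp [indicator, ht, ht', not_le.1 ht']
  · exact absurd (hxy.trans ht') ht
  · simp [indicator, ht, ht']

lemma WeakDeriv.rightLim_sub_leftLim (h : WeakDeriv I m u ξ) (hI : IsOpen I)
    (hIc : I.OrdConnected) (hu : LocallyBoundedVariationOn u I)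
    (hξ : ∀ x ∈ I, ∀ y ∈ I, IntegrableOn ξ (Icc x y) m) {x : ℝ} (hx : x ∈ I) :
    Function.rightLim u x - Function.leftLim u x = m.real {x} * ξ x := by
  obtain ⟨c, d, α, hα, hcd, h1, h2⟩ := exists_ramp_left hI hIc hu hx
  obtain ⟨c', d', β, hβ, hcd', h1', h2'⟩ := exists_ramp_right hI hIc hu hx
  have hαx : α ≤ x := (hcd 0).1.trans ((hcd 0).2.1.le.trans (hcd 0).2.2)
  have hxβ : x ≤ β := (hcd' 0).1.trans ((hcd' 0).2.1.le.trans (hcd' 0).2.2)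
  rw [h.sub_eq_of_tendsto hIc (fun _ hx _ hy => integrableOn_Icc_of_boundedVariation hIc hu hx hy) hξ
    hα hβ (fun k => ⟨(hcd k).1, (hcd k).2.1, (hcd k).2.2.trans hxβ⟩)
    (fun k => ⟨hαx.trans (hcd' k).1, (hcd' k).2⟩) h1 h1' h2 h2', ← Complex.real_smul,
    ← integral_singleton, ← integral_indicator (measurableSet_singleton x)]
  refine integral_congr_ae (Eventually.of_forall fun t => ?_)
  rcases lt_trichotomy x t with h | h | h
  · simp [indicator, h, h.le, h.ne']
  · simp [indicator, h]
  · simp [indicator, h.not_ge, h.not_gt, h.ne]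

end WeakEquation

end

end DistSystem

namespace DistSystem

noncomputable section

/-! ### Limits and variation of balanced primitives -/

section Primitive

variable {E : Type*} [NormedAddCommGroup E] [NormedSpace ℝ E] [CompleteSpace E] {m : Measure ℝ}
  [IsFiniteMeasure m] {ξ : ℝ → E}

lemma balPrim_eq (hξ : Integrable ξ m) (x : ℝ) :
    balPrim m ξ x = (1 / 2 : ℝ) • (∫ t in Iic x, ξ t ∂m + ∫ t in Iio x, ξ t ∂m) := by
  rw [setIntegral_Iic_eq hξ, balPrim, div_eq_inv_mul, mul_smul]
  module

/-- Treats one-sided limits and limits at the ends of the interval together: `s` is the set of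
points that the filter finally leaves to the left. Both half-line integrals of the balanced mean
converge to the integral over `s`. -/
lemma tendsto_balPrim (hξ : Integrable ξ m) {l : Filter ℝ} [l.IsCountablyGenerated] {s : Set ℝ}
    (hs : MeasurableSet s)
    (h : ∀ᵐ t ∂m, (t ∈ s → ∀ᶠ y in l, t < y) ∧ (t ∉ s → ∀ᶠ y in l, y < t)) :
    Tendsto (balPrim m ξ) l (𝓝 (∫ t in s, ξ t ∂m)) := by
  have key : ∀ r : ℝ → Set ℝ, (∀ y, MeasurableSet (r y)) → (∀ y t, t < y → t ∈ r y) →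
      (∀ y t, y < t → t ∉ r y) →
      Tendsto (fun y => ∫ t in r y, ξ t ∂m) l (𝓝 (∫ t in s, ξ t ∂m)) := by
    intro r hr h1 h2
    simp only [← integral_indicator hs, ← integral_indicator (hr _)]
    refine tendsto_integral_filter_of_dominated_convergence (fun t => ‖ξ t‖)
      (Eventually.of_forall fun y => hξ.1.indicator (hr y))
      (Eventually.of_forall fun y => Eventually.of_forall fun t => norm_indicator_le_norm_self _ _)
      hξ.norm ?_
    filter_upwards [h] with t ht
    refine tendsto_const_nhds.congr' ?_
    by_cases hts : t ∈ s
    · filter_upwards [ht.1 hts] with y hy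
      rw [indicator_of_mem hts, indicator_of_mem (h1 y t hy)]
    · filter_upwards [ht.2 hts] with y hy
      rw [indicator_of_notMem hts, indicator_of_notMem (h2 y t hy)]
  have h3 := ((key Iic (fun _ => measurableSet_Iic) (fun _ _ h => h.le) fun _ _ h => h.not_ge).add
    (key Iio (fun _ => measurableSet_Iio) (fun _ _ h => h) fun _ _ h => h.not_gt)).const_smul
      (1 / 2 : ℝ)
  have h4 : (1 / 2 : ℝ) • (∫ t in s, ξ t ∂m + ∫ t in s, ξ t ∂m) = ∫ t in s, ξ t ∂m := by
    module
  rw [h4] at h3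
  exact h3.congr fun y => (balPrim_eq hξ y).symm

lemma tendsto_balPrim_left (hξ : Integrable ξ m) (x : ℝ) :
    Tendsto (balPrim m ξ) (𝓝[<] x) (𝓝 (∫ t in Iio x, ξ t ∂m)) := by
  refine tendsto_balPrim hξ measurableSet_Iio (Eventually.of_forall fun t => ⟨fun ht => ?_,
    fun ht => ?_⟩)
  · exact mem_nhdsWithin_of_mem_nhds (Ioi_mem_nhds ht)
  · filter_upwards [self_mem_nhdsWithin] with y hy using lt_of_lt_of_le hy (not_lt.1 ht)

lemma tendsto_balPrim_right (hξ : Integrable ξ m) (x : ℝ) :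
    Tendsto (balPrim m ξ) (𝓝[>] x) (𝓝 (∫ t in Iic x, ξ t ∂m)) := by
  refine tendsto_balPrim hξ measurableSet_Iic (Eventually.of_forall fun t => ⟨fun ht => ?_,
    fun ht => ?_⟩)
  · filter_upwards [self_mem_nhdsWithin] with y hy using lt_of_le_of_lt ht hy
  · exact mem_nhdsWithin_of_mem_nhds (Iio_mem_nhds (not_le.1 ht))

lemma balPrim_sub (hξ : Integrable ξ m) {x y : ℝ} (hxy : x ≤ y) :
    balPrim m ξ y - balPrim m ξ x =
      (1 / 2 : ℝ) • (∫ t in Ioc x y, ξ t ∂m + ∫ t in Ico x y, ξ t ∂m) := by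
  rw [balPrim_eq hξ, balPrim_eq hξ, ← Iic_union_Ioc_eq_Iic hxy, ← Iio_union_Ico_eq_Iio hxy,
    setIntegral_union (Iic_disjoint_Ioc le_rfl) measurableSet_Ioc hξ.integrableOn hξ.integrableOn,
    setIntegral_union ((Iio_disjoint_Ici le_rfl).mono_right Ico_subset_Ici_self) measurableSet_Ico
      hξ.integrableOn hξ.integrableOn]
  module

lemma norm_balPrim_sub_le (hξ : Integrable ξ m) {x y : ℝ} (hxy : x ≤ y) :
    ‖balPrim m ξ y - balPrim m ξ x‖ ≤
      balPrim m (fun t => ‖ξ t‖) y - balPrim m (fun t => ‖ξ t‖) x := by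
  rw [balPrim_sub hξ hxy, balPrim_sub hξ.norm hxy, norm_smul, smul_eq_mul,
    Real.norm_of_nonneg (by norm_num)]
  exact mul_le_mul_of_nonneg_left ((norm_add_le _ _).trans
    (add_le_add (norm_integral_le_integral_norm _) (norm_integral_le_integral_norm _)))
    (by norm_num)

/-- The increments are dominated by those of the balanced primitive of `‖ξ‖`, which is monotone. -/
lemma locallyBoundedVariationOn_balPrim (hξ : Integrable ξ m) (s : Set ℝ) :
    LocallyBoundedVariationOn (balPrim m ξ) s := by
  have hmono : Monotone (balPrim m fun t => ‖ξ t‖) := fun x y hxy =>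
    sub_nonneg.1 ((norm_nonneg _).trans (norm_balPrim_sub_le hξ hxy))
  intro x y hx hy
  have h := (hmono.monotoneOn s).locallyBoundedVariationOn x y hx hy
  refine ne_top_of_le_ne_top h (iSup_mono fun p => Finset.sum_le_sum fun i _ => ?_)
  have hle : p.2.1 i ≤ p.2.1 (i + 1) := p.2.2.1 (Nat.le_succ i)
  rw [edist_dist, edist_dist]
  refine ENNReal.ofReal_le_ofReal ?_
  rw [dist_eq_norm, Real.dist_eq]
  exact (norm_balPrim_sub_le hξ hle).trans (le_abs_self _)

lemma leftLim_const_add_balPrim (hξ : Integrable ξ m) (c : E) (x : ℝ) :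
    Function.leftLim (fun y => c + balPrim m ξ y) x = c + ∫ t in Iio x, ξ t ∂m :=
  leftLim_eq_of_tendsto (tendsto_const_nhds.add (tendsto_balPrim_left hξ x))

lemma rightLim_const_add_balPrim (hξ : Integrable ξ m) (c : E) (x : ℝ) :
    Function.rightLim (fun y => c + balPrim m ξ y) x = c + ∫ t in Iic x, ξ t ∂m :=
  rightLim_eq_of_tendsto (tendsto_const_nhds.add (tendsto_balPrim_right hξ x))

end Primitive

/-! ### Balanced primitives as distributional antiderivatives -/

section Scalar

variable {m : Measure ℝ} [IsFiniteMeasure m] {ξ : ℝ → ℂ}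

/-- The two functions differ only at atoms, which are countably many and hence Lebesgue null. -/
lemma balPrim_ae_eq (m : Measure ℝ) [IsFiniteMeasure m] (ξ : ℝ → ℂ) :
    balPrim m ξ =ᵐ[volume] fun x => ∫ t in Iio x, ξ t ∂m := by
  have h1 : {x : ℝ | 0 < m {x}}.Countable := Measure.countable_meas_pos_of_disjoint_iUnion
    (fun x => measurableSet_singleton x) fun x y hxy => disjoint_singleton.2 hxy
  have h2 : ∀ᵐ x ∂(volume : Measure ℝ), x ∉ {x : ℝ | 0 < m {x}} :=
    measure_eq_zero_iff_ae_notMem.1 (h1.measure_zero _)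
  filter_upwards [h2] with x hx
  have : m {x} = 0 := by simpa using hx
  simp [balPrim, Measure.real, this]

/-- Fubini over `{t < x}` reduces the claim to `∫_{x > t} φ' = -φ(t)`; the constant disappears
because `∫ φ' = 0`. -/
lemma weakDeriv_const_add_balPrim (hξ : Integrable ξ m) (c : ℂ) (I : Set ℝ) :
    WeakDeriv I m (fun x => c + balPrim m ξ x) ξ := by
  intro φ hφ hφc _
  have hφ1 : ContDiff ℝ 1 φ := hφ.of_le (by exact_mod_cast le_top)
  have hd : Continuous (deriv φ) := hφ1.continuous_deriv (by simp)
  have hdi : Integrable (deriv φ) := hd.integrable_of_hasCompactSupport hφc.deriv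
  have hdi' : Integrable fun x => ((deriv φ x : ℝ) : ℂ) := hdi.ofReal
  have h0 : ∫ x, ((deriv φ x : ℝ) : ℂ) = 0 := by
    rw [integral_complex_ofReal, integral_eq_zero_of_hasDerivAt_of_integrable
      (fun x => (hφ1.differentiable (by simp) x).hasDerivAt) hdi
      (hφ.continuous.integrable_of_hasCompactSupport hφc)]
    simp
  have hprod : Integrable (Function.uncurry fun x t => ({z : ℝ × ℝ | z.2 < z.1}.indicator
      (fun z => ((deriv φ z.1 : ℝ) : ℂ) * ξ z.2) (x, t))) (volume.prod m) :=
    (hdi'.mul_prod hξ).indicator (measurableSet_lt measurable_snd measurable_fst)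
  have h1 : ∀ x, ∫ t, {z : ℝ × ℝ | z.2 < z.1}.indicator
      (fun z => ((deriv φ z.1 : ℝ) : ℂ) * ξ z.2) (x, t) ∂m =
      ((deriv φ x : ℝ) : ℂ) * ∫ t in Iio x, ξ t ∂m := by
    intro x
    rw [← integral_const_mul, ← integral_indicator measurableSet_Iio]
    rfl
  have h2 : ∀ t, ∫ x, {z : ℝ × ℝ | z.2 < z.1}.indicator
      (fun z => ((deriv φ z.1 : ℝ) : ℂ) * ξ z.2) (x, t) = -((φ t : ℂ) * ξ t) := by
    intro t
    have h3 : ∫ x in Ioi t, ((deriv φ x : ℝ) : ℂ) = -(φ t : ℂ) := by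
      rw [integral_complex_ofReal, hφc.integral_Ioi_deriv_eq hφ1]
      simp
    rw [← neg_mul, ← h3, ← integral_mul_const, ← integral_indicator measurableSet_Ioi]
    rfl
  have h3 : ∫ x, ((deriv φ x : ℝ) : ℂ) * ∫ t in Iio x, ξ t ∂m = -∫ t, (φ t : ℂ) * ξ t ∂m := by
    simp only [← h1]
    rw [integral_integral_swap hprod]
    simp only [h2]
    rw [integral_neg]
  have h4 : Integrable fun x => ((deriv φ x : ℝ) : ℂ) * ∫ t in Iio x, ξ t ∂m := by
    have := hprod.integral_prod_left
    simp only [Function.uncurry] at this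
    simpa only [h1] using this
  rw [neg_eq_iff_eq_neg, ← h3]
  have h5 : ∀ᵐ x, ((deriv φ x : ℝ) : ℂ) * (c + balPrim m ξ x) =
      ((deriv φ x : ℝ) : ℂ) * c + ((deriv φ x : ℝ) : ℂ) * ∫ t in Iio x, ξ t ∂m := by
    filter_upwards [balPrim_ae_eq m ξ] with x hx
    rw [hx, mul_add]
  rw [integral_congr_ae h5, integral_add (hdi'.mul_const c) h4, integral_mul_const, h0]
  simp

end Scalar

/-! ### The interval (a, b) and limits at its endpoints -/

section Interval

variable (a b : EReal)

lemma isOpen_interval : IsOpen (interval a b : Set ℝ) := (interval a b).2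

lemma ordConnected_interval : (interval a b : Set ℝ).OrdConnected :=
  ⟨fun _ hx _ hy _ hz => ⟨lt_of_lt_of_le hx.1 (EReal.coe_le_coe_iff.2 hz.1),
    lt_of_le_of_lt (EReal.coe_le_coe_iff.2 hz.2) hy.2⟩⟩

variable {a b} {E : Type*} [NormedAddCommGroup E] [NormedSpace ℝ E] [CompleteSpace E]
  {m : Measure ℝ} [IsFiniteMeasure m] {ξ : ℝ → E}

lemma tendsto_balPrim_start (hm : m (interval a b : Set ℝ)ᶜ = 0) (hξ : Integrable ξ m) :
    Tendsto (balPrim m ξ) (comap (fun x : ℝ => (x : EReal)) (𝓝[>] a)) (𝓝 0) := by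
  have h := tendsto_balPrim hξ (l := comap (fun x : ℝ => (x : EReal)) (𝓝[>] a))
    MeasurableSet.empty ?_
  · simpa using h
  filter_upwards [measure_eq_zero_iff_ae_notMem.1 hm] with t ht
  have ht' : t ∈ interval a b := not_not.1 ht
  refine ⟨fun h => h.elim, fun _ => ?_⟩
  filter_upwards [preimage_mem_comap (mem_nhdsWithin_of_mem_nhds (Iio_mem_nhds ht'.1))] with y hy
  exact EReal.coe_lt_coe_iff.1 hy

lemma tendsto_balPrim_end (hm : m (interval a b : Set ℝ)ᶜ = 0) (hξ : Integrable ξ m) :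
    Tendsto (balPrim m ξ) (comap (fun x : ℝ => (x : EReal)) (𝓝[<] b)) (𝓝 (∫ t, ξ t ∂m)) := by
  have h := tendsto_balPrim hξ (l := comap (fun x : ℝ => (x : EReal)) (𝓝[<] b))
    MeasurableSet.univ ?_
  · simpa using h
  filter_upwards [measure_eq_zero_iff_ae_notMem.1 hm] with t ht
  have ht' : t ∈ interval a b := not_not.1 ht
  refine ⟨fun _ => ?_, fun h => (h trivial).elim⟩
  filter_upwards [preimage_mem_comap (mem_nhdsWithin_of_mem_nhds (Ioi_mem_nhds ht'.2))] with y hy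
  exact EReal.coe_lt_coe_iff.1 hy

lemma neBot_start (h : (interval a b : Set ℝ).Nonempty) :
    (comap (fun x : ℝ => (x : EReal)) (𝓝[>] a)).NeBot := by
  obtain ⟨x, hx⟩ := h
  refine comap_neBot fun t ht => ?_
  obtain ⟨y, hy, hyt⟩ := (mem_nhdsGT_iff_exists_Ioo_subset' hx.1).1 ht
  obtain ⟨z, hz, hz'⟩ := EReal.lt_iff_exists_real_btwn.1 (show a < y from hy)
  exact ⟨z, hyt ⟨hz, hz'⟩⟩

lemma neBot_end (h : (interval a b : Set ℝ).Nonempty) :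
    (comap (fun x : ℝ => (x : EReal)) (𝓝[<] b)).NeBot := by
  obtain ⟨x, hx⟩ := h
  refine comap_neBot fun t ht => ?_
  obtain ⟨y, hy, hyt⟩ := (mem_nhdsLT_iff_exists_Ioo_subset' hx.2).1 ht
  obtain ⟨z, hz, hz'⟩ := EReal.lt_iff_exists_real_btwn.1 (show y < b from hy)
  exact ⟨z, hyt ⟨hz, hz'⟩⟩

lemma interval_mem_start (h : (interval a b : Set ℝ).Nonempty) :
    (interval a b : Set ℝ) ∈ comap (fun x : ℝ => (x : EReal)) (𝓝[>] a) := by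
  obtain ⟨x, hx⟩ := h
  exact ⟨Ioo a b, Ioo_mem_nhdsGT (hx.1.trans hx.2), fun y hy => hy⟩

lemma interval_mem_end (h : (interval a b : Set ℝ).Nonempty) :
    (interval a b : Set ℝ) ∈ comap (fun x : ℝ => (x : EReal)) (𝓝[<] b) := by
  obtain ⟨x, hx⟩ := h
  exact ⟨Ioo a b, Ioo_mem_nhdsLT (hx.1.trans hx.2), fun y hy => hy⟩

end Interval

end

end DistSystem

namespace DistSystem

noncomputable section

/-! ### Complex measures and their densities -/

section ComplexMeasure

variable {c : ComplexMeasure ℝ} {m : Measure ℝ}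

lemma variation_le_re_add_im (c : ComplexMeasure ℝ) :
    c.variation ≤ (ComplexMeasure.re c).totalVariation + (ComplexMeasure.im c).totalVariation := by
  refine VectorMeasure.variation_le_of_forall_enorm_le fun s _ => ?_
  have h1 := SignedMeasure.enorm_le_totalVariation (ComplexMeasure.re c) s
  have h2 := SignedMeasure.enorm_le_totalVariation (ComplexMeasure.im c) s
  refine le_trans ?_ (add_le_add h1 h2)
  rw [← ofReal_norm, ← ofReal_norm, ← ofReal_norm,
    ← ENNReal.ofReal_add (norm_nonneg _) (norm_nonneg _)]
  exact ENNReal.ofReal_le_ofReal (Complex.norm_le_abs_re_add_abs_im _)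

instance isFiniteMeasure_variation (c : ComplexMeasure ℝ) : IsFiniteMeasure c.variation :=
  isFiniteMeasure_of_le _ (variation_le_re_add_im c)

/-- Integration against a complex measure with a density. -/
lemma integral_eq_integral_mul {d : ℝ → ℂ} (hd : Integrable d m)
    (hc : ∀ s, MeasurableSet s → c s = ∫ x in s, d x ∂m) (hcm : c.variation ≪ m)
    {f : ℝ → ℂ} (hf : AEStronglyMeasurable f m) {B : ℝ} (hB : ∀ᵐ x ∂m, ‖f x‖ ≤ B) :
    c.integral f (ContinuousLinearMap.mul ℝ ℂ) = ∫ x, f x * d x ∂m := by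
  have hsi : ∀ g : SimpleFunc ℝ ℂ, c.Integrable g := fun g => SimpleFunc.integrable_of_isFiniteMeasure g
  have hsd : ∀ g : SimpleFunc ℝ ℂ, Integrable (fun x => g x * d x) m := fun g => by
    obtain ⟨C, hC⟩ := g.exists_forall_norm_le
    exact hd.bdd_mul g.aestronglyMeasurable (Eventually.of_forall hC)
  have hsimple : ∀ g : SimpleFunc ℝ ℂ, c.integral g (ContinuousLinearMap.mul ℝ ℂ) =
      ∫ x, g x * d x ∂m := by
    classical
    intro g
    induction g using SimpleFunc.induction with
    | @const z s hs =>
      rw [SimpleFunc.coe_piecewise, SimpleFunc.coe_const, SimpleFunc.coe_const,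
        Function.const_zero, piecewise_eq_indicator]
      have h1 : ∀ x, s.indicator (Function.const ℝ z) x * d x = s.indicator (fun x => z * d x) x :=
        fun x => by by_cases hx : x ∈ s <;> simp [hx]
      simp only [h1]
      rw [integral_indicator hs, integral_const_mul, ← hc s hs]
      exact VectorMeasure.integral_indicator_const z hs
    | @add f g _ hf hg =>
      rw [SimpleFunc.coe_add, VectorMeasure.integral_add (hsi f) (hsi g), hf, hg,
        ← integral_add (hsd f) (hsd g)]
      simp only [Pi.add_apply, add_mul]
  -- From simple functions to bounded ones: dominated convergence is applied on both sides, and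
  -- absolute continuity carries almost-everywhere statements from `m` to the variation of `c`.
  set g := hf.mk f with hg
  have hgm : StronglyMeasurable g := hf.stronglyMeasurable_mk
  have hfg : f =ᵐ[m] g := hf.ae_eq_mk
  have hgB : ∀ᵐ x ∂m, ‖g x‖ ≤ B := by
    filter_upwards [hB, hfg] with x h1 h2
    rwa [← h2]
  rw [VectorMeasure.integral_congr_ae (hcm.ae_le hfg), integral_congr_ae (g := fun x => g x * d x)
    (by filter_upwards [hfg] with x hx using by rw [hx])]
  have hB0 : (0 : ℝ) ≤ |B| := abs_nonneg B
  have hgB' : ∀ᵐ x ∂m, ‖g x‖ ≤ |B| := by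
    filter_upwards [hgB] with x hx using hx.trans (le_abs_self B)
  have h1 : Tendsto (fun k => c.integral (hgm.approxBounded |B| k) (ContinuousLinearMap.mul ℝ ℂ))
      atTop (𝓝 (c.integral g (ContinuousLinearMap.mul ℝ ℂ))) :=
    VectorMeasure.tendsto_integral_of_dominated_convergence (fun _ => |B|)
    (fun k => (hgm.approxBounded |B| k).aestronglyMeasurable) (integrable_const _)
    (fun k => Eventually.of_forall fun x => hgm.norm_approxBounded_le hB0 k x)
    (hgm.tendsto_approxBounded_ae (hcm.ae_le hgB'))
  have h2 : Tendsto (fun k => ∫ x, hgm.approxBounded |B| k x * d x ∂m) atTop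
      (𝓝 (∫ x, g x * d x ∂m)) := tendsto_integral_of_dominated_convergence (fun x => |B| * ‖d x‖)
    (fun k => (hgm.approxBounded |B| k).aestronglyMeasurable.mul hd.1) (hd.norm.const_mul _)
    (fun k => Eventually.of_forall fun x => by
      rw [norm_mul]
      exact mul_le_mul_of_nonneg_right (hgm.norm_approxBounded_le hB0 k x) (norm_nonneg _))
    (by filter_upwards [hgm.tendsto_approxBounded_ae hgB'] with x hx using hx.mul_const _)
  simp only [hsimple] at h1
  exact tendsto_nhds_unique h1 h2

variable [IsFiniteMeasure m]

lemma withDensity_rnDeriv_eq (hc : c.variation ≪ m) : m.withDensityᵥ (c.rnDeriv m) = c := by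
  have h0 : ∀ s, m s = 0 → c s = 0 := fun s hs => by
    have h := VectorMeasure.enorm_measure_le_variation c s
    rw [hc hs] at h
    simpa using h
  have h1 : ∀ s : Set ℝ, m.toENNRealVectorMeasure s = 0 → c s = 0 := by
    intro s hs
    by_cases hm : MeasurableSet s
    · rw [Measure.toENNRealVectorMeasure_apply_measurable hm] at hs
      exact h0 s hs
    · exact c.not_measurable hm
  have hre := SignedMeasure.withDensityᵥ_rnDeriv_eq (ComplexMeasure.re c) m fun s hs => by
    change (c s).re = 0
    rw [h1 s hs, Complex.zero_re]
  have him := SignedMeasure.withDensityᵥ_rnDeriv_eq (ComplexMeasure.im c) m fun s hs => by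
    change (c s).im = 0
    rw [h1 s hs, Complex.zero_im]
  have hi := ComplexMeasure.integrable_rnDeriv c m
  refine VectorMeasure.ext fun s hs => ?_
  rw [withDensityᵥ_apply hi hs]
  have h2 := congrArg (fun v : SignedMeasure ℝ => v s) hre
  have h3 := congrArg (fun v : SignedMeasure ℝ => v s) him
  simp only [withDensityᵥ_apply (SignedMeasure.integrable_rnDeriv _ _) hs] at h2 h3
  apply Complex.ext
  · exact (Complex.reCLM.integral_comp_comm hi.integrableOn).symm.trans h2
  · exact (Complex.imCLM.integral_comp_comm hi.integrableOn).symm.trans h3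

lemma apply_eq_setIntegral (hc : c.variation ≪ m) {s : Set ℝ} (hs : MeasurableSet s) :
    c s = ∫ x in s, c.rnDeriv m x ∂m := by
  rw [← withDensityᵥ_apply (ComplexMeasure.integrable_rnDeriv c m) hs, withDensity_rnDeriv_eq hc]

end ComplexMeasure

/-! ### Extension by zero of functions of bounded variation -/

section BoundedVariation

variable {E : Type*} [NormedAddCommGroup E] {f g : ℝ → E} {s t : Set ℝ}

lemma boundedVariationOn_of_edist_le {F : Type*} [NormedAddCommGroup F] {g : ℝ → F}
    (h : ∀ x ∈ s, ∀ y ∈ s, edist (f x) (f y) ≤ edist (g x) (g y)) (hg : BoundedVariationOn g s) :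
    BoundedVariationOn f s :=
  ne_top_of_le_ne_top hg
    (iSup_mono fun p => Finset.sum_le_sum fun _ _ => h _ (p.2.2.2 _) _ (p.2.2.2 _))

lemma boundedVariationOn_congr (h : EqOn f g s) (hg : BoundedVariationOn g s) :
    BoundedVariationOn f s :=
  boundedVariationOn_of_edist_le (fun x hx y hy => by rw [h hx, h hy]) hg

lemma boundedVariationOn_union {x : ℝ} (hs : IsGreatest s x) (ht : IsLeast t x)
    (h1 : BoundedVariationOn f s) (h2 : BoundedVariationOn f t) : BoundedVariationOn f (s ∪ t) := by
  rw [BoundedVariationOn, eVariationOn.union f hs ht]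
  exact ENNReal.add_ne_top.2 ⟨h1, h2⟩

lemma boundedVariationOn_const (hf : ∀ x ∈ s, ∀ y ∈ s, f x = f y) : BoundedVariationOn f s := by
  have h : BoundedVariationOn (fun _ : ℝ => (0 : ℝ)) s :=
    (monotone_const.monotoneOn s).boundedVariationOn (C := 0) (by simp)
  exact boundedVariationOn_of_edist_le (fun x hx y hy => by rw [hf x hx y hy]; simp) h

lemma eVariationOn_add_le {f g : ℝ → E} (s : Set ℝ) :
    eVariationOn (f + g) s ≤ eVariationOn f s + eVariationOn g s := by
  refine iSup_le fun p => ?_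
  refine le_trans ?_ (add_le_add (le_iSup (fun p : ℕ × { u : ℕ → ℝ // Monotone u ∧ ∀ i, u i ∈ s } =>
    ∑ i ∈ Finset.range p.1, edist (f (p.2.1 (i + 1))) (f (p.2.1 i))) p)
    (le_iSup (fun p : ℕ × { u : ℕ → ℝ // Monotone u ∧ ∀ i, u i ∈ s } =>
    ∑ i ∈ Finset.range p.1, edist (g (p.2.1 (i + 1))) (g (p.2.1 i))) p))
  rw [← Finset.sum_add_distrib]
  exact Finset.sum_le_sum fun i _ => edist_add_add_le _ _ _ _

lemma locallyBoundedVariationOn_add (hf : LocallyBoundedVariationOn f s)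
    (hg : LocallyBoundedVariationOn g s) : LocallyBoundedVariationOn (f + g) s := fun x y hx hy =>
  ne_top_of_le_ne_top (ENNReal.add_ne_top.2 ⟨hf x y hx hy, hg x y hx hy⟩) (eVariationOn_add_le _)

lemma locallyBoundedVariationOn_of_edist_le {F : Type*} [NormedAddCommGroup F] {g : ℝ → F}
    (h : ∀ x ∈ s, ∀ y ∈ s, edist (f x) (f y) ≤ edist (g x) (g y))
    (hg : LocallyBoundedVariationOn g s) : LocallyBoundedVariationOn f s := fun x y hx hy =>
  boundedVariationOn_of_edist_le (fun x hx y hy => h x hx.1 y hy.1) (hg x y hx hy)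

lemma locallyBoundedVariationOn_sub (hf : LocallyBoundedVariationOn f s)
    (hg : LocallyBoundedVariationOn g s) : LocallyBoundedVariationOn (f - g) s := by
  rw [sub_eq_add_neg]
  refine locallyBoundedVariationOn_add hf (locallyBoundedVariationOn_of_edist_le (g := g) ?_ hg)
  intro x _ y _
  simp [edist_neg_neg]

/-- A one-sided limit exists at the missing endpoint, so including that point adds just one finite
jump to the variation. -/
lemma boundedVariationOn_Ici_of_Ioi [CompleteSpace E] {a α : ℝ} (ha : a < α)
    (h : BoundedVariationOn f (Ioc a α)) : BoundedVariationOn f (Icc a α) := by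
  obtain ⟨l, hl⟩ := h.exists_tendsto_right a
  have h1 : Ioc a α ∩ Ioi a = Iic α ∩ Ioi a := by ext; simp; tauto
  rw [h1] at hl
  have h2 := eVariationOn.eVariationOn_on_inter_Ici_eq_Ioi_add_edist (f := f) (s := Iic α) (a := a)
    (l := l) ?_ ha.le hl
  · rw [BoundedVariationOn, ← Ici_inter_Iic, inter_comm, h2, inter_comm, Ioi_inter_Iic]
    exact ENNReal.add_ne_top.2 ⟨h, edist_ne_top _ _⟩
  · rw [nhdsWithin_inter_of_mem (mem_nhdsWithin_of_mem_nhds (Iic_mem_nhds ha))]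
    infer_instance

lemma boundedVariationOn_Icc_of_Ico [CompleteSpace E] {β b : ℝ} (hb : β < b)
    (h : BoundedVariationOn f (Ico β b)) : BoundedVariationOn f (Icc β b) := by
  obtain ⟨l, hl⟩ := h.exists_tendsto_left b
  have h1 : Ico β b ∩ Iio b = Ici β ∩ Iio b := by ext; simp
  rw [h1] at hl
  have h2 := eVariationOn.eVariationOn_on_inter_Iic_eq_Iio_add_edist (f := f) (s := Ici β) (a := b)
    (l := l) ?_ hb.le hl
  · rw [BoundedVariationOn, ← Ici_inter_Iic, h2, Ici_inter_Iio]
    exact ENNReal.add_ne_top.2 ⟨h, edist_ne_top _ _⟩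
  · rw [nhdsWithin_inter_of_mem (mem_nhdsWithin_of_mem_nhds (Ici_mem_nhds hb))]
    infer_instance

lemma boundedVariationOn_indicator_Iic [CompleteSpace E] {a b : EReal} {α : ℝ}
    (hα : α ∈ interval a b) (h : BoundedVariationOn f ((interval a b : Set ℝ) ∩ Iic α)) :
    BoundedVariationOn ((interval a b : Set ℝ).indicator f) (Iic α) := by
  have h1 : BoundedVariationOn ((interval a b : Set ℝ).indicator f)
      ((interval a b : Set ℝ) ∩ Iic α) :=
    boundedVariationOn_congr (fun x hx => indicator_of_mem hx.1 f) h
  induction a with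
  | bot =>
    refine h1.mono fun x hx => ⟨⟨EReal.bot_lt_coe x, ?_⟩, hx⟩
    exact lt_of_le_of_lt (EReal.coe_le_coe_iff.2 hx) hα.2
  | top => exact absurd hα.1 not_top_lt
  | coe a =>
    have ha : a < α := EReal.coe_lt_coe_iff.1 hα.1
    rw [← Iic_union_Icc_eq_Iic ha.le]
    refine boundedVariationOn_union isGreatest_Iic (isLeast_Icc ha.le) ?_ ?_
    · have h0 : ∀ x ∈ Iic a, (interval (a : EReal) b : Set ℝ).indicator f x = 0 := fun x hx =>
        indicator_of_notMem (fun h => not_lt.2 hx (EReal.coe_lt_coe_iff.1 h.1)) f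
      exact boundedVariationOn_const fun x hx y hy => by rw [h0 x hx, h0 y hy]
    · refine boundedVariationOn_Ici_of_Ioi ha (h1.mono fun x hx => ⟨⟨?_, ?_⟩, hx.2⟩)
      · exact EReal.coe_lt_coe_iff.2 hx.1
      · exact lt_of_le_of_lt (EReal.coe_le_coe_iff.2 hx.2) hα.2

lemma boundedVariationOn_indicator_Ici [CompleteSpace E] {a b : EReal} {β : ℝ}
    (hβ : β ∈ interval a b) (h : BoundedVariationOn f ((interval a b : Set ℝ) ∩ Ici β)) :
    BoundedVariationOn ((interval a b : Set ℝ).indicator f) (Ici β) := by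
  have h1 : BoundedVariationOn ((interval a b : Set ℝ).indicator f)
      ((interval a b : Set ℝ) ∩ Ici β) :=
    boundedVariationOn_congr (fun x hx => indicator_of_mem hx.1 f) h
  induction b with
  | top =>
    refine h1.mono fun x hx => ⟨⟨?_, EReal.coe_lt_top x⟩, hx⟩
    exact lt_of_lt_of_le hβ.1 (EReal.coe_le_coe_iff.2 hx)
  | bot => exact absurd hβ.2 not_lt_bot
  | coe b =>
    have hb : β < b := EReal.coe_lt_coe_iff.1 hβ.2
    rw [← Icc_union_Ici_eq_Ici hb.le]
    refine boundedVariationOn_union (isGreatest_Icc hb.le) isLeast_Ici ?_ ?_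
    · refine boundedVariationOn_Icc_of_Ico hb (h1.mono fun x hx => ⟨⟨?_, ?_⟩, hx.1⟩)
      · exact lt_of_lt_of_le hβ.1 (EReal.coe_le_coe_iff.2 hx.1)
      · exact EReal.coe_lt_coe_iff.2 hx.2
    · have h0 : ∀ x ∈ Ici b, (interval a (b : EReal) : Set ℝ).indicator f x = 0 := fun x hx =>
        indicator_of_notMem (fun h => not_lt.2 hx (EReal.coe_lt_coe_iff.1 h.2)) f
      exact boundedVariationOn_const fun x hx y hy => by rw [h0 x hx, h0 y hy]

/-- Three pieces are glued: local bounded variation covers a compact middle part, and regularity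
covers the two ends, where extension by zero adds at most one jump each. -/
lemma boundedVariationOn_indicator [CompleteSpace E] {a b : EReal} {c d : ℝ}
    (hf : LocallyBoundedVariationOn f (interval a b))
    (hc : c ∈ interval a b) (hd : d ∈ interval a b)
    (h : BoundedVariationOn f ((interval a b : Set ℝ) ∩ Iio c))
    (h' : BoundedVariationOn f ((interval a b : Set ℝ) ∩ Ioi d)) :
    BoundedVariationOn ((interval a b : Set ℝ).indicator f) univ := by
  obtain ⟨δ, hδ, hδ'⟩ := exists_Icc_subset (isOpen_interval a b) hc
  obtain ⟨ε, hε, hε'⟩ := exists_Icc_subset (isOpen_interval a b) hd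
  have hα := hδ' ⟨le_rfl, by linarith⟩
  have hβ := hε' ⟨by linarith, le_rfl⟩
  set α := c - δ
  set β := max α (d + ε)
  have hβ' : β ∈ interval a b := by
    rcases max_choice α (d + ε) with h | h
    · change max α (d + ε) ∈ _
      rw [h]
      exact hα
    · change max α (d + ε) ∈ _
      rw [h]
      exact hβ
  have hαβ : α ≤ β := le_max_left _ _
  rw [← Iic_union_Ici (a := α), ← Icc_union_Ici_eq_Ici hαβ]
  refine boundedVariationOn_union isGreatest_Iic ⟨Or.inl ⟨le_rfl, hαβ⟩, fun x hx => ?_⟩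
    (boundedVariationOn_indicator_Iic hα (h.mono fun x hx => ⟨hx.1, ?_⟩))
    (boundedVariationOn_union (isGreatest_Icc hαβ) isLeast_Ici ?_
      (boundedVariationOn_indicator_Ici hβ' (h'.mono fun x hx => ⟨hx.1, ?_⟩)))
  · exact hx.elim (fun h => h.1) fun h => hαβ.trans h
  · exact lt_of_le_of_lt (show x ≤ c - δ from hx.2) (by linarith)
  · have hsub := (ordConnected_interval a b).out hα hβ'
    exact boundedVariationOn_congr (fun x hx => indicator_of_mem (hsub hx) f)
      ((hf α β hα hβ').mono fun x hx => ⟨hsub hx, hx⟩)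
  · have h1 : d + ε ≤ β := le_max_right _ _
    exact lt_of_lt_of_le (show d < β by linarith) hx.2

end BoundedVariation

end

end DistSystem

namespace DistSystem

noncomputable section

/-! ### Integrals against test functions -/

section TestFunctions

variable {I : Set ℝ} {φ : ℝ → ℝ}

lemma exists_Icc_of_tsupport_subset (hφ : HasCompactSupport φ) (hφI : tsupport φ ⊆ I)
    (hI : I.Nonempty) : ∃ α ∈ I, ∃ β ∈ I, tsupport φ ⊆ Icc α β := by
  rcases (tsupport φ).eq_empty_or_nonempty with h | h
  · obtain ⟨x, hx⟩ := hI
    exact ⟨x, hx, x, hx, by simp [h]⟩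
  · exact ⟨_, hφI (hφ.isCompact.sInf_mem h), _, hφI (hφ.isCompact.sSup_mem h), fun x hx =>
      ⟨csInf_le hφ.isCompact.bddBelow hx, le_csSup hφ.isCompact.bddAbove hx⟩⟩

lemma deriv_eq_zero_of_notMem_tsupport {x : ℝ} (hx : x ∉ tsupport φ) : deriv φ x = 0 :=
  by_contra fun h => hx (tsupport_deriv_subset (subset_tsupport _ h))

lemma integrable_deriv_mul (hφ : ContDiff ℝ (⊤ : ℕ∞) φ) (hφc : HasCompactSupport φ)
    (hφI : tsupport φ ⊆ I) {u : ℝ → ℂ}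
    (hu : ∀ x ∈ I, ∀ y ∈ I, IntegrableOn u (Icc x y)) :
    Integrable fun x => ((deriv φ x : ℝ) : ℂ) * u x := by
  have hd : Continuous (deriv φ) :=
    (hφ.of_le (by exact_mod_cast le_top) : ContDiff ℝ 1 φ).continuous_deriv (by simp)
  rcases I.eq_empty_or_nonempty with rfl | hI
  · have : ∀ x, ((deriv φ x : ℝ) : ℂ) * u x = 0 := fun x => by
      rw [deriv_eq_zero_of_notMem_tsupport fun h => hφI h]
      simp
    simp only [this]
    exact integrable_zero _ _ _
  obtain ⟨α, hα, β, hβ, h⟩ := exists_Icc_of_tsupport_subset hφc hφI hI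
  refine (integrableOn_iff_integrable_of_support_subset fun x hx => ?_).1
    ((hu α hα β hβ).continuousOn_mul (Complex.continuous_ofReal.comp hd).continuousOn
      isCompact_Icc)
  by_contra h1
  refine hx ?_
  simp only [deriv_eq_zero_of_notMem_tsupport fun h2 => h1 (h h2)]
  simp

lemma integral_deriv_mul_congr_ae {u v : ℝ → ℂ} (hφI : tsupport φ ⊆ I)
    (h : ∀ᵐ x, x ∈ I → u x = v x) :
    ∫ x, ((deriv φ x : ℝ) : ℂ) * u x = ∫ x, ((deriv φ x : ℝ) : ℂ) * v x := by
  refine integral_congr_ae ?_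
  filter_upwards [h] with x hx
  by_cases hxI : x ∈ I
  · rw [hx hxI]
  · rw [deriv_eq_zero_of_notMem_tsupport fun h => hxI (hφI h)]
    simp

end TestFunctions

/-! ### Antiderivatives and the measures of regular distributions -/

section Antiderivative

variable {a b : EReal} {q : 𝓓'^{0}(interval a b, ℂ)} {Q Q' : ℝ → ℂ}

/-- A smooth function with compact support in `(a, b)` as a test function. -/
def toTest (φ : ℝ → ℝ) (hφ : ContDiff ℝ (⊤ : ℕ∞) φ) (hφc : HasCompactSupport φ)
    (hφI : tsupport φ ⊆ interval a b) : 𝓓(interval a b, ℝ) := ⟨φ, hφ, hφc, hφI⟩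

/-- With derivative zero the left limits are constant, and left-continuity identifies them with the
values. -/
lemma eqOn_add_const_of_weakDeriv {D : ℝ → ℂ} (hD : LocallyBoundedVariationOn D (interval a b))
    (hc : ∀ x ∈ interval a b, ContinuousWithinAt D (Iic x) x)
    (h : WeakDeriv (interval a b) 0 D 0) : ∃ C, ∀ x ∈ interval a b, D x = C := by
  have key : ∀ x ∈ interval a b, ∀ y ∈ interval a b, x ≤ y → D y = D x := by
    intro x hx y hy hxy
    have h1 := h.leftLim_sub_leftLim (isOpen_interval a b) (ordConnected_interval a b) hD
      (fun _ _ _ _ => integrableOn_zero) hx hy hxy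
    rw [(hc x hx).leftLim_eq, (hc y hy).leftLim_eq] at h1
    simpa [sub_eq_zero] using h1
  rcases (interval a b : Set ℝ).eq_empty_or_nonempty with h0 | ⟨x, hx⟩
  · refine ⟨0, fun x hx => ?_⟩
    have : x ∈ (interval a b : Set ℝ) := hx
    rw [h0] at this
    exact this.elim
  · refine ⟨D x, fun y hy => ?_⟩
    rcases le_total x y with hxy | hxy
    · exact key x hx y hy hxy
    · exact (key y hy x hx hxy).symm

lemma IsAntiderivative.integrable (h : IsAntiderivative q Q) (φ : 𝓓(interval a b, ℝ)) :
    Integrable fun x => ((deriv φ x : ℝ) : ℂ) * Q x :=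
  integrable_deriv_mul φ.contDiff φ.hasCompactSupport φ.tsupport_subset fun _ hx _ hy =>
    integrableOn_Icc_of_boundedVariation (ordConnected_interval a b) h.1 hx hy

lemma IsAntiderivative.eq_add_const (h : IsAntiderivative q Q) (h' : IsAntiderivative q Q') :
    ∃ C, ∀ x ∈ interval a b, Q x = Q' x + C := by
  have hw : WeakDeriv (interval a b) 0 (Q - Q') 0 := by
    intro φ hφ hφc hφI
    have h1 := h.2.2 (toTest φ hφ hφc hφI)
    rw [h'.2.2 (toTest φ hφ hφc hφI), neg_inj] at h1
    simp only [Pi.sub_apply, mul_sub, Pi.zero_apply, mul_zero, integral_zero]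
    have h2 := integral_sub (h.integrable (toTest φ hφ hφc hφI))
      (h'.integrable (toTest φ hφ hφc hφI))
    rw [h1, sub_self] at h2
    exact neg_eq_zero.2 h2
  obtain ⟨C, hC⟩ := eqOn_add_const_of_weakDeriv (locallyBoundedVariationOn_sub h.1 h'.1)
    (fun x hx => (h.2.1 x hx).sub (h'.2.1 x hx)) hw
  exact ⟨C, fun x hx => by rw [← hC x hx]; simp⟩

variable (q) in
/-- Both endpoints are regular for the distribution `q`. -/
def IsRegularDist : Prop :=
  (∃ c ∈ interval a b, ∃ Q, IsAntiderivative q Q ∧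
    BoundedVariationOn Q ((interval a b : Set ℝ) ∩ Iio c)) ∧
  ∃ c ∈ interval a b, ∃ Q, IsAntiderivative q Q ∧
    BoundedVariationOn Q ((interval a b : Set ℝ) ∩ Ioi c)

namespace IsRegularDist

lemma isAntiderivative (h : IsRegularDist q) : IsAntiderivative q (antideriv q) := by
  obtain ⟨⟨c, hc, Q, hQ, -⟩, -⟩ := h
  have : ∃ Q, IsAntiderivative q Q := ⟨Q, hQ⟩
  rw [antideriv, dif_pos this]
  exact this.choose_spec

/-- Regularity at the two ends may be witnessed by different antiderivatives; both differ from
`antideriv q` by a constant on the interval, which does not affect variation. -/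
lemma boundedVariationOn_indicator (h : IsRegularDist q) :
    BoundedVariationOn ((interval a b : Set ℝ).indicator (antideriv q)) univ := by
  have hA := h.isAntiderivative
  have key : ∀ Q, IsAntiderivative q Q → ∀ s, BoundedVariationOn Q ((interval a b : Set ℝ) ∩ s) →
      BoundedVariationOn (antideriv q) ((interval a b : Set ℝ) ∩ s) := by
    intro Q hQ s hs
    obtain ⟨C, hC⟩ := hA.eq_add_const hQ
    refine boundedVariationOn_of_edist_le (fun x hx y hy => ?_) hs
    rw [hC x hx.1, hC y hy.1, edist_add_right]
  obtain ⟨⟨c, hc, Q, hQ, h1⟩, d, hd, Q', hQ', h2⟩ := h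
  exact DistSystem.boundedVariationOn_indicator hA.1 hc hd (key Q hQ _ h1) (key Q' hQ' _ h2)

lemma distMeasure_eq (h : IsRegularDist q) :
    distMeasure q = h.boundedVariationOn_indicator.vectorMeasure.restrict (interval a b) := by
  rw [distMeasure, stieltjes, dif_pos h.boundedVariationOn_indicator]

lemma leftLim_indicator (h : IsRegularDist q) {x : ℝ} (hx : x ∈ interval a b) :
    Function.leftLim ((interval a b : Set ℝ).indicator (antideriv q)) x =
      Function.leftLim (antideriv q) x := by
  refine leftLim_eq_of_tendsto ((tendsto_leftLim_of_mem (isOpen_interval a b)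
    h.isAntiderivative.1 hx).congr' ?_)
  filter_upwards [mem_nhdsWithin_of_mem_nhds ((isOpen_interval a b).mem_nhds hx)] with y hy
  rw [indicator_of_mem hy]

lemma rightLim_indicator (h : IsRegularDist q) {x : ℝ} (hx : x ∈ interval a b) :
    Function.rightLim ((interval a b : Set ℝ).indicator (antideriv q)) x =
      Function.rightLim (antideriv q) x := by
  refine rightLim_eq_of_tendsto ((tendsto_rightLim_of_mem (isOpen_interval a b)
    h.isAntiderivative.1 hx).congr' ?_)
  filter_upwards [mem_nhdsWithin_of_mem_nhds ((isOpen_interval a b).mem_nhds hx)] with y hy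
  rw [indicator_of_mem hy]

lemma distMeasure_singleton (h : IsRegularDist q) {x : ℝ} (hx : x ∈ interval a b) :
    distMeasure q {x} =
      Function.rightLim (antideriv q) x - Function.leftLim (antideriv q) x := by
  rw [h.distMeasure_eq, VectorMeasure.restrict_eq_self _ (isOpen_interval a b).measurableSet
    (measurableSet_singleton x) (singleton_subset_iff.2 hx), BoundedVariationOn.vectorMeasure_singleton,
    h.leftLim_indicator hx, h.rightLim_indicator hx]

lemma distMeasure_Ico (h : IsRegularDist q) {x y : ℝ} (hx : x ∈ interval a b)
    (hy : y ∈ interval a b) (hxy : x ≤ y) :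
    distMeasure q (Ico x y) = antideriv q y - antideriv q x := by
  rw [h.distMeasure_eq, VectorMeasure.restrict_eq_self _ (isOpen_interval a b).measurableSet
    measurableSet_Ico (Ico_subset_Icc_self.trans ((ordConnected_interval a b).out hx hy)),
    BoundedVariationOn.vectorMeasure_Ico _ hxy, h.leftLim_indicator hx, h.leftLim_indicator hy,
    (h.isAntiderivative.2.1 x hx).leftLim_eq, (h.isAntiderivative.2.1 y hy).leftLim_eq]

lemma variation_compl (h : IsRegularDist q) :
    (distMeasure q).variation (interval a b : Set ℝ)ᶜ = 0 := by
  rw [h.distMeasure_eq, VectorMeasure.variation_restrict (isOpen_interval a b).measurableSet,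
    Measure.restrict_apply (isOpen_interval a b).measurableSet.compl]
  simp

variable {m : Measure ℝ} [IsFiniteMeasure m]

lemma exists_antideriv_eq (h : IsRegularDist q) (hm : (distMeasure q).variation ≪ m) :
    ∃ C, ∀ x ∈ interval a b, antideriv q x = C + ∫ t in Iio x, (distMeasure q).rnDeriv m t ∂m := by
  have hi := ComplexMeasure.integrable_rnDeriv (distMeasure q) m
  have key : ∀ x ∈ interval a b, ∀ y ∈ interval a b, x ≤ y →
      antideriv q y - ∫ t in Iio y, (distMeasure q).rnDeriv m t ∂m =
        antideriv q x - ∫ t in Iio x, (distMeasure q).rnDeriv m t ∂m := by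
    intro x hx y hy hxy
    have h1 := h.distMeasure_Ico hx hy hxy
    rw [apply_eq_setIntegral hm measurableSet_Ico] at h1
    rw [← Iio_union_Ico_eq_Iio hxy, setIntegral_union ((Iio_disjoint_Ici le_rfl).mono_right
      Ico_subset_Ici_self) measurableSet_Ico hi.integrableOn hi.integrableOn, h1]
    ring
  obtain ⟨x, hx, -⟩ := h.1
  refine ⟨antideriv q x - ∫ t in Iio x, (distMeasure q).rnDeriv m t ∂m, fun y hy => ?_⟩
  rcases le_total x y with hxy | hxy
  · rw [← key x hx y hy hxy]; ring
  · rw [key y hy x hx hxy]; ring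

/-- On the interval the antiderivative is, up to a constant, the primitive of the density over `Iio
x`. It agrees almost everywhere with the balanced primitive, whose weak derivative is known. -/
lemma apply_eq_integral (h : IsRegularDist q) (hm : (distMeasure q).variation ≪ m)
    (φ : 𝓓(interval a b, ℝ)) :
    q (TestFunction.monoCLM ℝ φ) = ∫ x, (φ x : ℂ) * (distMeasure q).rnDeriv m x ∂m := by
  obtain ⟨C, hC⟩ := h.exists_antideriv_eq hm
  have hi := ComplexMeasure.integrable_rnDeriv (distMeasure q) m
  rw [h.isAntiderivative.2.2, ← weakDeriv_const_add_balPrim hi C (interval a b) φ φ.contDiff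
    φ.hasCompactSupport φ.tsupport_subset, neg_inj]
  refine integral_deriv_mul_congr_ae φ.tsupport_subset ?_
  filter_upwards [balPrim_ae_eq m ((distMeasure q).rnDeriv m)] with x hx hxI
  rw [hx, hC x hxI]

end IsRegularDist

/-- An integrable function is determined by its integrals against test functions. -/
lemma ae_eq_zero_of_integral_test_eq_zero {m : Measure ℝ} {f : ℝ → ℂ} (hm : m (interval a b : Set ℝ)ᶜ = 0)
    (hf : Integrable f m) (h : ∀ φ : 𝓓(interval a b, ℝ), ∫ x, (φ x : ℂ) * f x ∂m = 0) :
    ∀ᵐ x ∂m, f x = 0 := by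
  have h1 := IsOpen.ae_eq_zero_of_integral_contDiff_smul_eq_zero (isOpen_interval a b)
    (hf.locallyIntegrable.locallyIntegrableOn _) (fun φ hφ hφc hφI => by
      simpa only [Complex.real_smul] using! h (toTest φ hφ hφc hφI))
  filter_upwards [h1, measure_eq_zero_iff_ae_notMem.1 hm] with x hx hxI
  exact hx (not_not.1 hxI)

end Antiderivative

/-! ### Hermitian symmetry of the densities -/

section Hermitian

variable {a b : EReal} {n : ℕ} {q : DistMatrix a b n} {m : Measure ℝ} [IsFiniteMeasure m]

lemma integrable_test_mul {m : Measure ℝ} {f : ℝ → ℂ} (hf : Integrable f m)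
    (φ : 𝓓(interval a b, ℝ)) : Integrable (fun x => (φ x : ℂ) * f x) m := by
  obtain ⟨C, hC⟩ := φ.hasCompactSupport.exists_bound_of_continuous φ.continuous
  refine hf.bdd_mul (c := C)
    (Complex.continuous_ofReal.comp φ.continuous).aestronglyMeasurable (Eventually.of_forall fun x => ?_)
  rw [Complex.norm_real]
  exact hC x

lemma ae_rnDeriv_hermitian (hq : IsHermitianDist q) (hr : ∀ i j, IsRegularDist (q i j))
    (hm : ∀ i j, (distMeasure (q i j)).variation ≪ m) (hmI : m (interval a b : Set ℝ)ᶜ = 0)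
    (i j : Fin n) :
    ∀ᵐ x ∂m, (distMeasure (q i j)).rnDeriv m x = star ((distMeasure (q j i)).rnDeriv m x) := by
  have hi : ∀ i j, Integrable ((distMeasure (q i j)).rnDeriv m) m := fun i j =>
    ComplexMeasure.integrable_rnDeriv _ m
  have h := ae_eq_zero_of_integral_test_eq_zero hmI ((hi i j).sub (integrable_star (hi j i)))
    fun φ => by
      have h1 := (hr i j).apply_eq_integral (hm i j) φ
      have h2 := (hr j i).apply_eq_integral (hm j i) φ
      have h3 := hq i j (TestFunction.monoCLM ℝ φ)
      rw [h1, h2, integral_star] at h3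
      simp only [Pi.sub_apply, mul_sub]
      rw [integral_sub (integrable_test_mul (hi i j) φ)
        (integrable_test_mul (integrable_star (hi j i)) φ), h3, sub_eq_zero]
      refine integral_congr_ae (Eventually.of_forall fun x => ?_)
      simp
  filter_upwards [h] with x hx
  exact sub_eq_zero.1 hx

end Hermitian

end

end DistSystem

namespace DistSystem

noncomputable section

/-! ### Solutions with respect to a measure, and Green's formula -/

section Solutions

variable {a b : EReal} {n : ℕ} {m : Measure ℝ} {J : Matrix (Fin n) (Fin n) ℂ}
  {k : ℝ → Matrix (Fin n) (Fin n) ℂ} {F G u v : ℝ → Fin n → ℂ}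

/-- The hypotheses on the coefficients of the equation `J u' + k u = F` with respect to `m`. -/
structure IsSystem (m : Measure ℝ) (J : Matrix (Fin n) (Fin n) ℂ)
    (k : ℝ → Matrix (Fin n) (Fin n) ℂ) : Prop where
  isUnit : IsUnit J
  skew : Jᴴ = -J
  measurable : ∀ i j, Measurable fun x => k x i j
  integrable : ∀ i j, Integrable (fun x => k x i j) m
  hermitian : ∀ x, (k x)ᴴ = k x
  regular : Regular m J k

/-- `u` is a balanced solution of `J u' + k u = F` on `(a, b)`, with respect to `m`. -/
structure IsSol (a b : EReal) (m : Measure ℝ) (J : Matrix (Fin n) (Fin n) ℂ)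
    (k : ℝ → Matrix (Fin n) (Fin n) ℂ) (F u : ℝ → Fin n → ℂ) : Prop where
  balanced : IsBalancedBV a b u
  weak : ∀ i, WeakDeriv (interval a b) m (fun x => u x i) fun x => solDensity J k F u x i

lemma IsSystem.mul_inv (h : IsSystem m J k) : J * J⁻¹ = 1 :=
  Matrix.mul_nonsing_inv _ ((Matrix.isUnit_iff_isUnit_det _).1 h.isUnit)

lemma IsSystem.inv_mul (h : IsSystem m J k) : J⁻¹ * J = 1 :=
  Matrix.nonsing_inv_mul _ ((Matrix.isUnit_iff_isUnit_det _).1 h.isUnit)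

/-- The pointwise Lagrange identity. -/
lemma IsSystem.lagrange (h : IsSystem m J k) (F G u v : ℝ → Fin n → ℂ) (x : ℝ) :
    star (v x) ⬝ᵥ (J *ᵥ solDensity J k F u x) + star (solDensity J k G v x) ⬝ᵥ (J *ᵥ u x) =
      star (v x) ⬝ᵥ F x - star (G x) ⬝ᵥ u x := by
  have h1 : J *ᵥ solDensity J k F u x = F x - k x *ᵥ u x := by
    rw [solDensity, Matrix.mulVec_mulVec, h.mul_inv, Matrix.one_mulVec]
  have h2 : star (solDensity J k G v x) ⬝ᵥ (J *ᵥ u x) = -(star (G x - k x *ᵥ v x) ⬝ᵥ u x) := by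
    have h3 : (J⁻¹)ᴴ * J = -1 := by
      rw [Matrix.conjTranspose_nonsing_inv, h.skew]
      have : (-J)⁻¹ = -J⁻¹ := Matrix.inv_eq_right_inv (by simp [h.mul_inv])
      rw [this, Matrix.neg_mul, h.inv_mul]
    rw [solDensity, Matrix.star_mulVec, ← Matrix.dotProduct_mulVec, Matrix.mulVec_mulVec, h3,
      Matrix.neg_mulVec, Matrix.one_mulVec, dotProduct_neg]
  have h3 : star (k x *ᵥ v x) ⬝ᵥ u x = star (v x) ⬝ᵥ (k x *ᵥ u x) := by
    rw [Matrix.star_mulVec, h.hermitian, ← Matrix.dotProduct_mulVec]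
  rw [h1, h2, dotProduct_sub, star_sub, sub_dotProduct, h3]
  ring

lemma balPrim_restrict {E : Type*} [NormedAddCommGroup E] [NormedSpace ℝ E] {s r : Set ℝ}
    {ξ : ℝ → E} {x : ℝ} (hx : x ∈ s) (hr : Iio x ∩ s = r) :
    balPrim (m.restrict s) ξ x = ∫ t in r, ξ t ∂m + (m.real {x} / 2) • ξ x := by
  rw [balPrim, Measure.restrict_restrict measurableSet_Iio, hr, measureReal_restrict_apply
    (measurableSet_singleton x), inter_eq_left.2 (singleton_subset_iff.2 hx)]

/-- Green's formula on a set `s`, for solutions with "initial values" `c` and `d`. -/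
lemma IsSystem.green [IsFiniteMeasure m] (h : IsSystem m J k) {s : Set ℝ} (hs : MeasurableSet s)
    (hu : IntegrableOn (solDensity J k F u) s m) (hv : IntegrableOn (solDensity J k G v) s m)
    {c d : Fin n → ℂ}
    (hc : ∀ x ∈ s, u x = c + balPrim (m.restrict s) (solDensity J k F u) x)
    (hd : ∀ x ∈ s, v x = d + balPrim (m.restrict s) (solDensity J k G v) x) :
    star (d + ∫ t in s, solDensity J k G v t ∂m) ⬝ᵥ
      (J *ᵥ (c + ∫ t in s, solDensity J k F u t ∂m)) = star d ⬝ᵥ (J *ᵥ c) +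
      ∫ t in s, (star (v t) ⬝ᵥ F t - star (G t) ⬝ᵥ u t) ∂m := by
  rw [form_primitive J hu hv c d]
  congr 1
  refine setIntegral_congr_fun hs fun x hx => ?_
  rw [← hc x hx, ← hd x hx, h.lagrange]

section Local

lemma leftLim_apply (hu : LocallyBoundedVariationOn u (interval a b)) {x : ℝ}
    (hx : x ∈ interval a b) (i : Fin n) :
    Function.leftLim (fun x => u x i) x = Function.leftLim u x i :=
  leftLim_eq_of_tendsto ((tendsto_pi_nhds.1
    (tendsto_leftLim_of_mem (isOpen_interval a b) hu hx)) i)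

lemma rightLim_apply (hu : LocallyBoundedVariationOn u (interval a b)) {x : ℝ}
    (hx : x ∈ interval a b) (i : Fin n) :
    Function.rightLim (fun x => u x i) x = Function.rightLim u x i :=
  rightLim_eq_of_tendsto ((tendsto_pi_nhds.1
    (tendsto_rightLim_of_mem (isOpen_interval a b) hu hx)) i)

lemma locallyBoundedVariationOn_apply {s : Set ℝ} (hu : LocallyBoundedVariationOn u s) (i : Fin n) :
    LocallyBoundedVariationOn (fun x => u x i) s :=
  locallyBoundedVariationOn_of_edist_le (fun x _ y _ => edist_le_pi_edist (u x) (u y) i) hu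

variable [IsFiniteMeasure m]

lemma aestronglyMeasurable_of_boundedVariation (hu : LocallyBoundedVariationOn u (interval a b))
    {x y : ℝ} (hx : x ∈ interval a b) (hy : y ∈ interval a b) :
    AEStronglyMeasurable u (m.restrict (Icc x y)) :=
  (aemeasurable_pi_iff.2 fun i => (integrableOn_Icc_of_boundedVariation
    (ordConnected_interval a b) (locallyBoundedVariationOn_apply hu i) hx hy).1.aemeasurable
    ).aestronglyMeasurable

lemma integrableOn_mulVec_of_boundedVariation (hk : ∀ i j, Integrable (fun x => k x i j) m)
    (hu : LocallyBoundedVariationOn u (interval a b)) {x y : ℝ} (hx : x ∈ interval a b)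
    (hy : y ∈ interval a b) : IntegrableOn (fun t => k t *ᵥ u t) (Icc x y) m := by
  rcases le_or_gt x y with hxy | hxy
  · obtain ⟨C, hC⟩ := exists_bound_of_boundedVariation hu hx hy hxy
    refine integrable_mulVec_of_bounded (fun i j => (hk i j).integrableOn)
      (aestronglyMeasurable_of_boundedVariation hu hx hy) (C := C) ?_
    filter_upwards [ae_restrict_mem measurableSet_Icc] with t ht
    exact hC t ⟨(ordConnected_interval a b).out hx hy ht, ht⟩
  · rw [Icc_eq_empty hxy.not_ge]
    exact integrableOn_empty

lemma integrableOn_solDensity (hk : ∀ i j, Integrable (fun x => k x i j) m) (hF : Integrable F m)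
    (hu : LocallyBoundedVariationOn u (interval a b)) {x y : ℝ} (hx : x ∈ interval a b)
    (hy : y ∈ interval a b) : IntegrableOn (solDensity J k F u) (Icc x y) m :=
  integrable_mulVec_const _ (hF.integrableOn.sub
    (integrableOn_mulVec_of_boundedVariation hk hu hx hy))

namespace IsSol

lemma leftLim_eq_add (h : IsSol a b m J k F u) (hk : ∀ i j, Integrable (fun x => k x i j) m)
    (hF : Integrable F m) {x y : ℝ} (hx : x ∈ interval a b) (hy : y ∈ interval a b) (hxy : x ≤ y) :
    Function.leftLim u y = Function.leftLim u x + ∫ t in Ico x y, solDensity J k F u t ∂m := by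
  funext i
  have h1 := (h.weak i).leftLim_sub_leftLim (isOpen_interval a b) (ordConnected_interval a b)
    (locallyBoundedVariationOn_apply h.balanced.1 i) (fun x hx y hy =>
      integrable_apply (integrableOn_solDensity hk hF h.balanced.1 hx hy) i) hx hy hxy
  rw [leftLim_apply h.balanced.1 hx, leftLim_apply h.balanced.1 hy, sub_eq_iff_eq_add'] at h1
  rw [h1, Pi.add_apply, integral_apply' ((integrableOn_solDensity hk hF h.balanced.1 hx hy).mono_set
    Ico_subset_Icc_self)]

/-- A balanced value is the left limit plus half the jump, and the jump is the atom times the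
density. -/
lemma eq_leftLim_add (h : IsSol a b m J k F u) (hk : ∀ i j, Integrable (fun x => k x i j) m)
    (hF : Integrable F m) {x : ℝ} (hx : x ∈ interval a b) :
    u x = Function.leftLim u x + (m.real {x} / 2) • solDensity J k F u x := by
  have h0 : Function.rightLim u x = Function.leftLim u x + m.real {x} • solDensity J k F u x := by
    funext i
    have h1 := (h.weak i).rightLim_sub_leftLim (isOpen_interval a b) (ordConnected_interval a b)
      (locallyBoundedVariationOn_apply h.balanced.1 i) (fun x hx y hy =>
        integrable_apply (integrableOn_solDensity hk hF h.balanced.1 hx hy) i) hx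
    rw [leftLim_apply h.balanced.1 hx, rightLim_apply h.balanced.1 hx, sub_eq_iff_eq_add'] at h1
    rw [h1, Pi.add_apply, Pi.smul_apply, Complex.real_smul]
  have h2 := h.balanced.2 x hx
  rw [h0] at h2
  conv_lhs => rw [h2]
  funext i
  simp only [Pi.add_apply, Pi.smul_apply, smul_eq_mul, Complex.real_smul]
  push_cast
  ring

lemma eq_add_balPrim (h : IsSol a b m J k F u) (hk : ∀ i j, Integrable (fun x => k x i j) m)
    (hF : Integrable F m) {x y t : ℝ} (hx : x ∈ interval a b) (hy : y ∈ interval a b)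
    (ht : t ∈ Ico x y) :
    u t = Function.leftLim u x + balPrim (m.restrict (Ico x y)) (solDensity J k F u) t := by
  have htI : t ∈ interval a b := (ordConnected_interval a b).out hx hy (Ico_subset_Icc_self ht)
  rw [balPrim_restrict ht (r := Ico x t), h.eq_leftLim_add hk hF htI,
    h.leftLim_eq_add hk hF hx htI ht.1, add_assoc]
  ext z
  simp only [mem_inter_iff, mem_Iio, mem_Ico]
  exact ⟨fun h => ⟨h.2.1, h.1⟩, fun h => ⟨h.2, h.1, h.2.trans ht.2⟩⟩

/-- Green's formula for solutions. -/
lemma green (hS : IsSystem m J k) (hu : IsSol a b m J k F u) (hv : IsSol a b m J k G v)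
    (hF : Integrable F m) (hG : Integrable G m) {x y : ℝ} (hx : x ∈ interval a b)
    (hy : y ∈ interval a b) (hxy : x ≤ y) :
    star (Function.leftLim v y) ⬝ᵥ (J *ᵥ Function.leftLim u y) =
      star (Function.leftLim v x) ⬝ᵥ (J *ᵥ Function.leftLim u x) +
      ∫ t in Ico x y, (star (v t) ⬝ᵥ F t - star (G t) ⬝ᵥ u t) ∂m := by
  rw [hu.leftLim_eq_add hS.integrable hF hx hy hxy, hv.leftLim_eq_add hS.integrable hG hx hy hxy]
  exact hS.green measurableSet_Ico
    ((integrableOn_solDensity hS.integrable hF hu.balanced.1 hx hy).mono_set Ico_subset_Icc_self)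
    ((integrableOn_solDensity hS.integrable hG hv.balanced.1 hx hy).mono_set Ico_subset_Icc_self)
    (fun t ht => hu.eq_add_balPrim hS.integrable hF hx hy ht)
    (fun t ht => hv.eq_add_balPrim hS.integrable hG hx hy ht)

lemma green_zero (hS : IsSystem m J k) (hu : IsSol a b m J k 0 u) (hv : IsSol a b m J k 0 v)
    {x y : ℝ} (hx : x ∈ interval a b) (hy : y ∈ interval a b) :
    star (Function.leftLim v y) ⬝ᵥ (J *ᵥ Function.leftLim u y) =
      star (Function.leftLim v x) ⬝ᵥ (J *ᵥ Function.leftLim u x) := by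
  have h0 : Integrable (0 : ℝ → Fin n → ℂ) m := integrable_zero _ _ _
  rcases le_total x y with h | h
  · simpa using green hS hu hv h0 h0 hx hy h
  · simpa using (green hS hu hv h0 h0 hy hx h).symm

end IsSol

end Local

section Global

variable {c d : Fin n → ℂ}

lemma IsGlobalSol.eq_fun (h : IsGlobalSol m J k F c u) :
    u = fun x => c + balPrim m (solDensity J k F u) x := funext h.eq_add

lemma solDensity_add (F G u v : ℝ → Fin n → ℂ) :
    solDensity J k (F + G) (u + v) = solDensity J k F u + solDensity J k G v := by
  funext x
  simp only [solDensity, Pi.add_apply, ← Matrix.mulVec_add]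
  congr 1
  rw [Matrix.mulVec_add]
  abel

lemma solDensity_smul (z : ℂ) (F u : ℝ → Fin n → ℂ) :
    solDensity J k (z • F) (z • u) = z • solDensity J k F u := by
  funext x
  simp only [solDensity, Pi.smul_apply, ← Matrix.mulVec_smul, smul_sub]

lemma balPrim_add {E : Type*} [NormedAddCommGroup E] [NormedSpace ℝ E] {ξ η : ℝ → E}
    (hξ : Integrable ξ m) (hη : Integrable η m) (x : ℝ) :
    balPrim m (ξ + η) x = balPrim m ξ x + balPrim m η x := by
  simp only [balPrim, Pi.add_apply, smul_add]
  rw [integral_add hξ.integrableOn hη.integrableOn]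
  abel

lemma IsGlobalSol.add (hu : IsGlobalSol m J k F c u) (hv : IsGlobalSol m J k G d v) :
    IsGlobalSol m J k (F + G) (c + d) (u + v) := by
  refine ⟨by rw [solDensity_add]; exact hu.integrable.add hv.integrable, fun x => ?_⟩
  rw [solDensity_add, balPrim_add hu.integrable hv.integrable, Pi.add_apply, hu.eq_add, hv.eq_add]
  abel

lemma IsGlobalSol.smul (z : ℂ) (hu : IsGlobalSol m J k F c u) :
    IsGlobalSol m J k (z • F) (z • c) (z • u) := by
  refine ⟨by rw [solDensity_smul]; exact hu.integrable.smul z, fun x => ?_⟩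
  rw [solDensity_smul, Pi.smul_apply, hu.eq_add, smul_add, balPrim, balPrim, smul_add,
    smul_comm z (_ : ℝ), ← integral_smul]
  rfl

variable [IsFiniteMeasure m]

namespace IsGlobalSol

lemma leftLim_eq (h : IsGlobalSol m J k F c u) (x : ℝ) :
    Function.leftLim u x = c + ∫ t in Iio x, solDensity J k F u t ∂m := by
  conv_lhs => rw [h.eq_fun]
  exact leftLim_const_add_balPrim h.integrable c x

lemma rightLim_eq (h : IsGlobalSol m J k F c u) (x : ℝ) :
    Function.rightLim u x = c + ∫ t in Iic x, solDensity J k F u t ∂m := by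
  conv_lhs => rw [h.eq_fun]
  exact rightLim_const_add_balPrim h.integrable c x

lemma isSol (h : IsGlobalSol m J k F c u) (a b : EReal) : IsSol a b m J k F u := by
  refine ⟨⟨?_, fun x _ => ?_⟩, fun i => ?_⟩
  · refine locallyBoundedVariationOn_of_edist_le (fun x _ y _ => ?_)
      (locallyBoundedVariationOn_balPrim h.integrable (interval a b : Set ℝ))
    rw [h.eq_add x, h.eq_add y, edist_add_left]
  · rw [h.leftLim_eq, h.rightLim_eq, h.eq_add x, balPrim_eq h.integrable]
    funext i
    simp only [Pi.add_apply, Pi.smul_apply, smul_eq_mul, Complex.real_smul]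
    push_cast
    ring
  · have h1 := weakDeriv_const_add_balPrim (integrable_apply h.integrable i) (c i)
      (interval a b : Set ℝ)
    have h2 : (fun x => u x i) = fun x => c i + balPrim m (fun t => solDensity J k F u t i) x := by
      funext x
      rw [← balPrim_apply h.integrable, ← Pi.add_apply, ← h.eq_add]
    rw [h2]
    exact h1

lemma hasBoundaryValues (h : IsGlobalSol m J k F c u) (hm : m (interval a b : Set ℝ)ᶜ = 0) :
    HasBoundaryValues a b u (Sum.elim c (c + ∫ t, solDensity J k F u t ∂m)) := by
  constructor
  · have h1 := (tendsto_balPrim_start hm h.integrable).const_add c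
    rw [add_zero] at h1
    rw [h.eq_fun]
    exact h1
  · have h1 := (tendsto_balPrim_end hm h.integrable).const_add c
    conv => arg 1; rw [h.eq_fun]
    exact h1

lemma green_Iio (hS : IsSystem m J k) (hu : IsGlobalSol m J k F c u)
    (hv : IsGlobalSol m J k G d v) (x : ℝ) :
    star (Function.leftLim v x) ⬝ᵥ (J *ᵥ Function.leftLim u x) = star d ⬝ᵥ (J *ᵥ c) +
      ∫ t in Iio x, (star (v t) ⬝ᵥ F t - star (G t) ⬝ᵥ u t) ∂m := by
  have h1 : ∀ {F u c}, IsGlobalSol m J k F c u → ∀ t ∈ Iio x,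
      u t = c + balPrim (m.restrict (Iio x)) (solDensity J k F u) t := by
    intro F u c h t ht
    rw [balPrim_restrict ht (r := Iio t) (inter_eq_left.2 (Iio_subset_Iio (le_of_lt ht)))]
    exact h.eq_add t
  rw [hu.leftLim_eq, hv.leftLim_eq]
  exact hS.green measurableSet_Iio hu.integrable.integrableOn hv.integrable.integrableOn (h1 hu)
    (h1 hv)

lemma green (hS : IsSystem m J k) (hu : IsGlobalSol m J k F c u) (hv : IsGlobalSol m J k G d v) :
    star (d + ∫ t, solDensity J k G v t ∂m) ⬝ᵥ (J *ᵥ (c + ∫ t, solDensity J k F u t ∂m)) =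
      star d ⬝ᵥ (J *ᵥ c) + ∫ t, (star (v t) ⬝ᵥ F t - star (G t) ⬝ᵥ u t) ∂m := by
  have h := hS.green MeasurableSet.univ hu.integrable.integrableOn hv.integrable.integrableOn
    (c := c) (d := d) (fun x _ => by rw [Measure.restrict_univ]; exact hu.eq_add x)
    (fun x _ => by rw [Measure.restrict_univ]; exact hv.eq_add x)
  simpa only [Measure.restrict_univ] using h

end IsGlobalSol

end Global

end Solutions

end

end DistSystem

namespace DistSystem

noncomputable section

/-! ### Uniqueness, and extension of solutions to the whole line -/

section Representation

variable {a b : EReal} {n : ℕ} {m : Measure ℝ} {J : Matrix (Fin n) (Fin n) ℂ}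
  {k : ℝ → Matrix (Fin n) (Fin n) ℂ} {F G u v : ℝ → Fin n → ℂ}

lemma integrable_test_mul_of_integrableOn {I : Set ℝ} {φ : ℝ → ℝ} {ξ : ℝ → ℂ} (hφ : Continuous φ)
    (hφc : HasCompactSupport φ) (hφI : tsupport φ ⊆ I)
    (hξ : ∀ x ∈ I, ∀ y ∈ I, IntegrableOn ξ (Icc x y) m) :
    Integrable (fun x => (φ x : ℂ) * ξ x) m := by
  rcases I.eq_empty_or_nonempty with rfl | hI
  · have : ∀ x, (φ x : ℂ) * ξ x = 0 := fun x => by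
      rw [image_eq_zero_of_notMem_tsupport fun h => hφI h]
      simp
    simp only [this]
    exact integrable_zero _ _ _
  obtain ⟨α, hα, β, hβ, h⟩ := exists_Icc_of_tsupport_subset hφc hφI hI
  refine (integrableOn_iff_integrable_of_support_subset fun x hx => ?_).1
    ((hξ α hα β hβ).continuousOn_mul (Complex.continuous_ofReal.comp hφ).continuousOn
      isCompact_Icc)
  by_contra h1
  refine hx ?_
  simp only [image_eq_zero_of_notMem_tsupport fun h2 => h1 (h h2)]
  simp

lemma WeakDeriv.sub {I : Set ℝ} {u v ξ η : ℝ → ℂ} (hu : WeakDeriv I m u ξ) (hv : WeakDeriv I m v η)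
    (hui : ∀ x ∈ I, ∀ y ∈ I, IntegrableOn u (Icc x y))
    (hvi : ∀ x ∈ I, ∀ y ∈ I, IntegrableOn v (Icc x y))
    (hξ : ∀ x ∈ I, ∀ y ∈ I, IntegrableOn ξ (Icc x y) m)
    (hη : ∀ x ∈ I, ∀ y ∈ I, IntegrableOn η (Icc x y) m) :
    WeakDeriv I m (fun x => u x - v x) fun x => ξ x - η x := by
  intro φ hφ hφc hφI
  simp only [mul_sub]
  rw [integral_sub (integrable_deriv_mul hφ hφc hφI hui) (integrable_deriv_mul hφ hφc hφI hvi),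
    integral_sub (integrable_test_mul_of_integrableOn hφ.continuous hφc hφI hξ)
      (integrable_test_mul_of_integrableOn hφ.continuous hφc hφI hη), ← hu φ hφ hφc hφI,
    ← hv φ hφ hφc hφI]
  ring

lemma WeakDeriv.congr {I : Set ℝ} {u v ξ η : ℝ → ℂ} (hu : WeakDeriv I m u ξ) (huv : EqOn v u I)
    (hξη : EqOn η ξ I) : WeakDeriv I m v η := by
  intro φ hφ hφc hφI
  rw [integral_deriv_mul_congr_ae hφI (Eventually.of_forall huv), hu φ hφ hφc hφI]
  refine integral_congr_ae (Eventually.of_forall fun x => ?_)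
  by_cases hx : x ∈ I
  · simp only [hξη hx]
  · simp only [image_eq_zero_of_notMem_tsupport fun h => hx (hφI h)]
    simp

lemma leftLim_congr {E : Type*} [NormedAddCommGroup E] [CompleteSpace E] {u v : ℝ → E}
    (hu : LocallyBoundedVariationOn u (interval a b)) (h : EqOn v u (interval a b)) {x : ℝ}
    (hx : x ∈ interval a b) : Function.leftLim v x = Function.leftLim u x := by
  refine leftLim_eq_of_tendsto ((tendsto_leftLim_of_mem (isOpen_interval a b) hu hx).congr' ?_)
  filter_upwards [mem_nhdsWithin_of_mem_nhds ((isOpen_interval a b).mem_nhds hx)] with y hy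
  exact (h hy).symm

lemma rightLim_congr {E : Type*} [NormedAddCommGroup E] [CompleteSpace E] {u v : ℝ → E}
    (hu : LocallyBoundedVariationOn u (interval a b)) (h : EqOn v u (interval a b)) {x : ℝ}
    (hx : x ∈ interval a b) : Function.rightLim v x = Function.rightLim u x := by
  refine rightLim_eq_of_tendsto ((tendsto_rightLim_of_mem (isOpen_interval a b) hu hx).congr' ?_)
  filter_upwards [mem_nhdsWithin_of_mem_nhds ((isOpen_interval a b).mem_nhds hx)] with y hy
  exact (h hy).symm

lemma IsBalancedBV.congr (hu : IsBalancedBV a b u) (h : EqOn v u (interval a b)) :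
    IsBalancedBV a b v :=
  ⟨locallyBoundedVariationOn_of_edist_le (fun x hx y hy => by rw [h hx, h hy]) hu.1,
    fun x hx => by rw [h hx, leftLim_congr hu.1 h hx, rightLim_congr hu.1 h hx, hu.2 x hx]⟩

lemma IsSol.congr (hu : IsSol a b m J k F u) (h : EqOn v u (interval a b)) :
    IsSol a b m J k F v :=
  ⟨hu.balanced.congr h, fun i => (hu.weak i).congr (fun x hx => by simp only [h hx])
    fun x hx => by simp only [solDensity, h hx]⟩

lemma leftLim_sub (hu : LocallyBoundedVariationOn u (interval a b))
    (hv : LocallyBoundedVariationOn v (interval a b)) {x : ℝ} (hx : x ∈ interval a b) :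
    Function.leftLim (u - v) x = Function.leftLim u x - Function.leftLim v x :=
  leftLim_eq_of_tendsto ((tendsto_leftLim_of_mem (isOpen_interval a b) hu hx).sub
    (tendsto_leftLim_of_mem (isOpen_interval a b) hv hx))

lemma rightLim_sub (hu : LocallyBoundedVariationOn u (interval a b))
    (hv : LocallyBoundedVariationOn v (interval a b)) {x : ℝ} (hx : x ∈ interval a b) :
    Function.rightLim (u - v) x = Function.rightLim u x - Function.rightLim v x :=
  rightLim_eq_of_tendsto ((tendsto_rightLim_of_mem (isOpen_interval a b) hu hx).sub
    (tendsto_rightLim_of_mem (isOpen_interval a b) hv hx))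

lemma IsBalancedBV.sub (hu : IsBalancedBV a b u) (hv : IsBalancedBV a b v) :
    IsBalancedBV a b (u - v) := by
  refine ⟨locallyBoundedVariationOn_sub hu.1 hv.1, fun x hx => ?_⟩
  rw [leftLim_sub hu.1 hv.1 hx, rightLim_sub hu.1 hv.1 hx, Pi.sub_apply, hu.2 x hx, hv.2 x hx]
  module

variable [IsFiniteMeasure m]

lemma IsSol.sub (hu : IsSol a b m J k F u) (hv : IsSol a b m J k G v)
    (hk : ∀ i j, Integrable (fun x => k x i j) m) (hF : Integrable F m) (hG : Integrable G m) :
    IsSol a b m J k (F - G) (u - v) := by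
  have hi : ∀ {u : ℝ → Fin n → ℂ}, LocallyBoundedVariationOn u (interval a b) → ∀ i : Fin n,
      ∀ x ∈ (interval a b : Set ℝ), ∀ y ∈ (interval a b : Set ℝ),
        IntegrableOn (fun x => u x i) (Icc x y) := fun hu i x hx y hy =>
    integrableOn_Icc_of_boundedVariation (ordConnected_interval a b)
      (locallyBoundedVariationOn_apply hu i) hx hy
  refine ⟨hu.balanced.sub hv.balanced, fun i => ?_⟩
  refine ((hu.weak i).sub (hv.weak i) (hi hu.balanced.1 i) (hi hv.balanced.1 i)
    (fun x hx y hy => integrable_apply (integrableOn_solDensity hk hF hu.balanced.1 hx hy) i)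
    fun x hx y hy => integrable_apply (integrableOn_solDensity hk hG hv.balanced.1 hx hy) i).congr
    (fun x _ => rfl) fun x _ => ?_
  have h1 := congrFun (solDensity_add (J := J) (k := k) (F - G) G (u - v) v) x
  rw [sub_add_cancel, sub_add_cancel] at h1
  simp only [h1, Pi.add_apply, add_sub_cancel_right]

lemma exists_fundamental (hS : IsSystem m J k) :
    ∃ Y : Fin n → ℝ → Fin n → ℂ, ∀ j, IsGlobalSol m J k 0 (Pi.single j 1) (Y j) := by
  have h : ∀ j : Fin n, ∃ u, IsGlobalSol m J k 0 (Pi.single j 1) u := fun j => by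
    obtain ⟨u, hu, -⟩ := exists_globalSol hS.isUnit hS.integrable hS.measurable hS.regular
      (integrable_zero _ (Fin n → ℂ) m) (Pi.single j 1)
    exact ⟨u, hu⟩
  exact ⟨fun j => (h j).choose, fun j => (h j).choose_spec⟩

/-- The left limits at `x` of a fundamental system are linearly independent. -/
lemma exists_inverse_leftLim (hS : IsSystem m J k) {Y : Fin n → ℝ → Fin n → ℂ}
    (hY : ∀ j, IsGlobalSol m J k 0 (Pi.single j 1) (Y j)) (x : ℝ) :
    IsUnit (Matrix.of fun i j => Function.leftLim (Y j) x i) := by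
  set M : Matrix (Fin n) (Fin n) ℂ := Matrix.of fun i j => Function.leftLim (Y j) x i
  -- For homogeneous solutions Green's formula has no integral term, so the form of `J` on the left
  -- limits at `x` equals that on the initial values `eᵢ`, `eⱼ`. Taking determinants shows that `M`
  -- is invertible.
  have h : Mᴴ * J * M = J := by
    ext i j
    have h1 := (hY j).green_Iio hS (hY i) x
    have h2 : star (Pi.single i (1 : ℂ) : Fin n → ℂ) ⬝ᵥ (J *ᵥ Pi.single j 1) = J i j := by
      rw [Matrix.mulVec_single_one, ← Pi.single_star, star_one, single_one_dotProduct]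
      rfl
    simp only [Pi.zero_apply, dotProduct_zero, star_zero, zero_dotProduct, sub_zero,
      integral_zero, add_zero, h2] at h1
    rw [← h1, Matrix.mul_assoc]
    rfl
  rw [Matrix.isUnit_iff_isUnit_det]
  have h3 := congrArg Matrix.det h
  rw [Matrix.det_mul] at h3
  have h4 := (Matrix.isUnit_iff_isUnit_det _).1 hS.isUnit
  rw [← h3] at h4
  exact isUnit_of_mul_isUnit_right h4

/-- A homogeneous solution with vanishing left limit at some point vanishes. -/
lemma IsSol.eq_zero (hS : IsSystem m J k) (hu : IsSol a b m J k 0 u) {x : ℝ}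
    (hx : x ∈ interval a b) (h0 : Function.leftLim u x = 0) {y : ℝ} (hy : y ∈ interval a b) :
    u y = 0 := by
  obtain ⟨Y, hY⟩ := exists_fundamental hS
  have h1 : Function.leftLim u y = 0 := by
    -- The form of `u` with each fundamental solution has the same value at `x`, where it is zero,
    -- and at `y`, where the fundamental solutions span.
    have h2 : (Matrix.of fun i j => Function.leftLim (Y j) y i)ᴴ *ᵥ
        (J *ᵥ Function.leftLim u y) = 0 := by
      funext j
      have h3 := IsSol.green_zero hS hu ((hY j).isSol a b) hx hy
      rw [h0, Matrix.mulVec_zero, dotProduct_zero] at h3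
      exact h3
    have h4 : IsUnit ((Matrix.of fun i j => Function.leftLim (Y j) y i)ᴴ) :=
      (exists_inverse_leftLim hS hY y).star
    have h5 := (Matrix.mulVec_injective_of_isUnit h4) (h2.trans (Matrix.mulVec_zero _).symm)
    exact (Matrix.mulVec_injective_of_isUnit hS.isUnit) (h5.trans (Matrix.mulVec_zero _).symm)
  have h2 := hu.eq_leftLim_add hS.integrable (integrable_zero _ _ _) hy
  rw [h1, zero_add] at h2
  -- A vanishing left limit leaves an equation for the value at the possible atom `y`, settled by
  -- regularity.
  have h3 : (J + (m.real {y} / 2 : ℂ) • k y) *ᵥ u y = 0 := by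
    have h4 := congrArg (J *ᵥ ·) h2
    simp only [solDensity, Pi.zero_apply, zero_sub, Matrix.mulVec_smul, Matrix.mulVec_mulVec,
      hS.mul_inv, Matrix.one_mulVec, smul_neg] at h4
    rw [Matrix.add_mulVec, h4, Matrix.smul_mulVec, ← Complex.coe_smul]
    push_cast
    exact neg_add_cancel _
  exact (Matrix.mulVec_injective_of_isUnit (hS.regular y)) (h3.trans (Matrix.mulVec_zero _).symm)

/-- Every solution on `(a, b)` is the restriction of a global solution. -/
theorem IsSol.exists_globalSol (hS : IsSystem m J k) (hF : Integrable F m)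
    (hne : (interval a b : Set ℝ).Nonempty) (hu : IsSol a b m J k F u) :
    ∃ c U, IsGlobalSol m J k F c U ∧ EqOn u U (interval a b) := by
  obtain ⟨x, hx⟩ := hne
  obtain ⟨Y, hY⟩ := exists_fundamental hS
  obtain ⟨U₀, hU₀, -⟩ := DistSystem.exists_globalSol hS.isUnit hS.integrable hS.measurable hS.regular
    hF 0
  set M : Matrix (Fin n) (Fin n) ℂ := Matrix.of fun i j => Function.leftLim (Y j) x i with hM
  have hMu := exists_inverse_leftLim hS hY x
  -- The particular solution `U₀` is corrected by the homogeneous solution that matches the left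
  -- limit of `u` at one point.
  set c := M⁻¹ *ᵥ (Function.leftLim u x - Function.leftLim U₀ x) with hc
  have hMc : M *ᵥ c = Function.leftLim u x - Function.leftLim U₀ x := by
    rw [hc, Matrix.mulVec_mulVec, Matrix.mul_nonsing_inv _ ((Matrix.isUnit_iff_isUnit_det _).1 hMu),
      Matrix.one_mulVec]
  have hsum : ∀ s : Finset (Fin n), IsGlobalSol m J k 0 (∑ j ∈ s, c j • Pi.single j 1)
      (∑ j ∈ s, c j • Y j) ∧ Function.leftLim (∑ j ∈ s, c j • Y j) x =
        ∑ j ∈ s, c j • Function.leftLim (Y j) x := by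
    intro s
    have h1 : IsGlobalSol m J k 0 (∑ j ∈ s, c j • Pi.single j 1) (∑ j ∈ s, c j • Y j) := by
      induction s using Finset.cons_induction with
      | empty =>
        have h0 : solDensity J k 0 (0 : ℝ → Fin n → ℂ) = 0 := by
          funext x
          simp [solDensity]
        simp only [Finset.sum_empty]
        refine ⟨by rw [h0]; exact integrable_zero _ _ _, fun x => ?_⟩
        rw [h0]
        simp [balPrim]
      | cons j s hj ih =>
        rw [Finset.sum_cons, Finset.sum_cons]
        have h2 := ((hY j).smul (c j)).add ih
        rwa [smul_zero, add_zero] at h2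
    refine ⟨h1, leftLim_eq_of_tendsto ?_⟩
    have h3 : (∑ j ∈ s, c j • Y j) = fun y => ∑ j ∈ s, c j • Y j y := by
      funext y
      simp
    rw [h3]
    exact tendsto_finsetSum _ fun j _ => (tendsto_leftLim_of_mem (isOpen_interval a b)
      ((hY j).isSol a b).balanced.1 hx).const_smul (c j)
  obtain ⟨h1, h2⟩ := hsum Finset.univ
  have hU := hU₀.add h1
  rw [add_zero] at hU
  refine ⟨_, _, hU, fun y hy => ?_⟩
  have h3 := hu.sub (hU.isSol a b) hS.integrable hF hF
  rw [sub_self] at h3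
  have h4 : Function.leftLim (u - (U₀ + ∑ j, c j • Y j)) x = 0 := by
    rw [leftLim_sub hu.balanced.1 (hU.isSol a b).balanced.1 hx]
    have h5 : Function.leftLim (U₀ + ∑ j, c j • Y j) x = Function.leftLim U₀ x + M *ᵥ c := by
      refine leftLim_eq_of_tendsto ?_
      have h6 : M *ᵥ c = Function.leftLim (∑ j, c j • Y j) x := by
        rw [h2]
        funext i
        simp [hM, Matrix.mulVec, dotProduct, mul_comm]
      rw [h6]
      exact (tendsto_leftLim_of_mem (isOpen_interval a b) (hU₀.isSol a b).balanced.1 hx).add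
        (tendsto_leftLim_of_mem (isOpen_interval a b) (h1.isSol a b).balanced.1 hx)
    rw [h5, hMc]
    abel
  exact sub_eq_zero.1 (h3.eq_zero hS hx h4 hy)

end Representation

end

end DistSystem

namespace DistSystem

noncomputable section

/-! ### The distributional equation in terms of densities -/

section Link

variable {a b : EReal} {n : ℕ}

/-- The standing hypotheses on the equation `J u' + q u = w f`. -/
structure IsRegularSystem (J : Matrix (Fin n) (Fin n) ℂ) (q w : DistMatrix a b n) : Prop where
  isUnit : IsUnit J
  skew : Jᴴ = -J
  hermitian : IsHermitianDist q
  jump : ∀ x ∈ interval a b, IsUnit ((2 : ℂ) • J + jump q x)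
  regular : ∀ i j, IsRegularDist (q i j)
  regular_weight : ∀ i j, IsRegularDist (w i j)

variable {J : Matrix (Fin n) (Fin n) ℂ} {q w : DistMatrix a b n} {f g u v : ℝ → Fin n → ℂ}

/-- A finite measure with respect to which all coefficients are absolutely continuous. -/
def baseMeasure (q w : DistMatrix a b n) : Measure ℝ :=
  (∑ i, ∑ j, (distMeasure (q i j)).variation) + traceMeasure w

instance isFiniteMeasure_traceMeasure : IsFiniteMeasure (traceMeasure w) :=
  isFiniteMeasure_variation _

instance isFiniteMeasure_baseMeasure : IsFiniteMeasure (baseMeasure q w) := by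
  unfold baseMeasure
  infer_instance

lemma variation_absolutelyContinuous (q w : DistMatrix a b n) (i j : Fin n) :
    (distMeasure (q i j)).variation ≪ baseMeasure q w := by
  refine Measure.absolutelyContinuous_of_le (le_trans ?_ (Measure.le_add_right le_rfl))
  exact (Finset.single_le_sum (f := fun j => (distMeasure (q i j)).variation)
    (fun _ _ => Measure.zero_le _) (Finset.mem_univ j)).trans
    (Finset.single_le_sum (f := fun i => ∑ j, (distMeasure (q i j)).variation)
      (fun _ _ => Measure.zero_le _) (Finset.mem_univ i))

lemma traceMeasure_absolutelyContinuous (q w : DistMatrix a b n) :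
    traceMeasure w ≪ baseMeasure q w :=
  Measure.absolutelyContinuous_of_le (Measure.le_add_left le_rfl)

/-- The matrix of densities of `q` with respect to the base measure. -/
def coeff (q w : DistMatrix a b n) (x : ℝ) : Matrix (Fin n) (Fin n) ℂ :=
  Matrix.of fun i j => (1 / 2 : ℂ) * ((distMeasure (q i j)).rnDeriv (baseMeasure q w) x +
    star ((distMeasure (q j i)).rnDeriv (baseMeasure q w) x))

/-- The density of `w f` with respect to the base measure. -/
def source (q w : DistMatrix a b n) (f : ℝ → Fin n → ℂ) (x : ℝ) : Fin n → ℂ :=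
  ((traceMeasure w).rnDeriv (baseMeasure q w) x).toReal • (density w x *ᵥ f x)

lemma measurable_rnDeriv (c : ComplexMeasure ℝ) (m : Measure ℝ) : Measurable (c.rnDeriv m) := by
  have h1 := SignedMeasure.measurable_rnDeriv (ComplexMeasure.re c) m
  have h2 := SignedMeasure.measurable_rnDeriv (ComplexMeasure.im c) m
  have h := (Complex.measurable_ofReal.comp h1).add
    ((Complex.measurable_ofReal.comp h2).mul_const Complex.I)
  convert h using 1
  funext x
  apply Complex.ext <;> simp [ComplexMeasure.rnDeriv]

lemma measurable_coeff (q w : DistMatrix a b n) (i j : Fin n) :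
    Measurable fun x => coeff q w x i j :=
  ((measurable_rnDeriv _ _).add
    (continuous_star.measurable.comp (measurable_rnDeriv _ _))).const_mul _

lemma integrable_coeff (q w : DistMatrix a b n) (i j : Fin n) :
    Integrable (fun x => coeff q w x i j) (baseMeasure q w) :=
  ((ComplexMeasure.integrable_rnDeriv _ _).add
    (integrable_star (ComplexMeasure.integrable_rnDeriv _ _))).const_mul _

lemma integrable_source (q : DistMatrix a b n) (hf : f ∈ preL2 w) :
    Integrable (source q w f) (baseMeasure q w) :=
  (integrable_rnDeriv_smul_iff (traceMeasure_absolutelyContinuous q w)).2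
    (integrable_density_mulVec hf)

lemma integral_test_source (q : DistMatrix a b n) (f : ℝ → Fin n → ℂ) (φ : ℝ → ℝ) (i : Fin n) :
    ∫ x, (φ x : ℂ) * source q w f x i ∂(baseMeasure q w) =
      ∫ x, (φ x : ℂ) * (density w x *ᵥ f x) i ∂(traceMeasure w) := by
  rw [← integral_rnDeriv_smul (traceMeasure_absolutelyContinuous q w)]
  refine integral_congr_ae (Eventually.of_forall fun x => ?_)
  simp only [source, Pi.smul_apply, mul_smul_comm]

lemma integral_star_dotProduct_source (q : DistMatrix a b n) (f v : ℝ → Fin n → ℂ) :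
    ∫ x, star (v x) ⬝ᵥ source q w f x ∂(baseMeasure q w) = ∫ x, form w v f x ∂(traceMeasure w) := by
  rw [← integral_rnDeriv_smul (traceMeasure_absolutelyContinuous q w)]
  refine integral_congr_ae (Eventually.of_forall fun x => ?_)
  simp only [source, form, dotProduct_smul]

namespace IsRegularSystem

lemma traceMeasure_compl (h : IsRegularSystem J q w) :
    traceMeasure w (interval a b : Set ℝ)ᶜ = 0 := by
  refine le_antisymm ((VectorMeasure.variation_finsetSum_le _ _ _).trans ?_) zero_le
  rw [Measure.finsetSum_apply]
  exact (Finset.sum_eq_zero fun i _ => (h.regular_weight i i).variation_compl).le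

lemma baseMeasure_compl (h : IsRegularSystem J q w) :
    baseMeasure q w (interval a b : Set ℝ)ᶜ = 0 := by
  rw [baseMeasure, Measure.add_apply, h.traceMeasure_compl, add_zero, Measure.finsetSum_apply]
  refine Finset.sum_eq_zero fun i _ => ?_
  rw [Measure.finsetSum_apply]
  exact Finset.sum_eq_zero fun j _ => (h.regular i j).variation_compl

/-- The symmetrization in `coeff` makes the matrix Hermitian at every point rather than almost
everywhere; for Hermitian `q` it changes the density only on a null set. -/
lemma coeff_ae_eq (h : IsRegularSystem J q w) (i j : Fin n) :
    ∀ᵐ x ∂(baseMeasure q w),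
      coeff q w x i j = (distMeasure (q i j)).rnDeriv (baseMeasure q w) x := by
  filter_upwards [ae_rnDeriv_hermitian h.hermitian h.regular
    (variation_absolutelyContinuous q w) h.baseMeasure_compl i j] with x hx
  rw [coeff, Matrix.of_apply, ← hx]
  ring

lemma distMeasure_apply (h : IsRegularSystem J q w) (i j : Fin n) {s : Set ℝ}
    (hs : MeasurableSet s) :
    distMeasure (q i j) s = ∫ x in s, coeff q w x i j ∂(baseMeasure q w) := by
  rw [apply_eq_setIntegral (variation_absolutelyContinuous q w i j) hs]
  exact integral_congr_ae (ae_restrict_of_ae ((h.coeff_ae_eq i j).mono fun x hx => hx.symm))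

lemma isSystem (h : IsRegularSystem J q w) : IsSystem (baseMeasure q w) J (coeff q w) where
  isUnit := h.isUnit
  skew := h.skew
  measurable := measurable_coeff q w
  integrable := integrable_coeff q w
  hermitian x := by
    ext i j
    simp only [coeff, Matrix.conjTranspose_apply, Matrix.of_apply, star_mul', star_add, star_star]
    rw [add_comm]
    simp
  regular x := by
    by_cases hx : x ∈ interval a b
    · have h1 : (J + ((baseMeasure q w).real {x} / 2 : ℂ) • coeff q w x) =
          (1 / 2 : ℂ) • ((2 : ℂ) • J + DistSystem.jump q x) := by
        ext i j
        have h2 : DistSystem.jump q x i j =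
            (baseMeasure q w).real {x} • coeff q w x i j := by
          rw [DistSystem.jump, Matrix.of_apply, ← (h.regular i j).distMeasure_singleton hx,
            h.distMeasure_apply i j (measurableSet_singleton x), integral_singleton]
        simp only [Matrix.add_apply, Matrix.smul_apply, smul_eq_mul, h2, Complex.real_smul]
        ring
      rw [h1]
      exact (h.jump x hx).smul (Units.mk0 (1 / 2 : ℂ) (by norm_num))
    · have h1 : baseMeasure q w {x} = 0 :=
        measure_mono_null (singleton_subset_iff.2 hx) h.baseMeasure_compl
      rw [measureReal_def, h1]
      simpa using h.isUnit

lemma sum_mulPair (h : IsRegularSystem J q w) (hu : LocallyBoundedVariationOn u (interval a b))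
    (φ : 𝓓(interval a b, ℝ)) (i : Fin n) :
    ∑ j, mulPair (q i j) (fun x => u x j) φ =
      ∫ x, (φ x : ℂ) * (coeff q w x *ᵥ u x) i ∂(baseMeasure q w) := by
  have hint : ∀ j, Integrable (fun x => (φ x : ℂ) * u x j * coeff q w x i j) (baseMeasure q w) ∧
      mulPair (q i j) (fun x => u x j) φ =
        ∫ x, (φ x : ℂ) * u x j * coeff q w x i j ∂(baseMeasure q w) := by
    intro j
    have hm : AEStronglyMeasurable (fun x => (φ x : ℂ) * u x j) (baseMeasure q w) :=
      (integrable_test_mul_of_integrableOn φ.continuous φ.hasCompactSupport φ.tsupport_subset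
        fun x hx y hy => integrableOn_Icc_of_boundedVariation (ordConnected_interval a b)
          (locallyBoundedVariationOn_apply hu j) hx hy).1
    obtain ⟨B, hB⟩ : ∃ B, ∀ x, ‖(φ x : ℂ) * u x j‖ ≤ B := by
      rcases (interval a b : Set ℝ).eq_empty_or_nonempty with hI | hI
      · refine ⟨0, fun x => ?_⟩
        rw [image_eq_zero_of_notMem_tsupport (f := φ) fun hx => by
          have := φ.tsupport_subset hx
          rw [hI] at this
          exact this]
        simp
      obtain ⟨α, hα, β, hβ, hs⟩ := exists_Icc_of_tsupport_subset φ.hasCompactSupport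
        φ.tsupport_subset hI
      obtain ⟨C, hC⟩ := φ.hasCompactSupport.exists_bound_of_continuous φ.continuous
      have hC0 : 0 ≤ C := (norm_nonneg _).trans (hC 0)
      rcases lt_or_ge β α with hαβ | hαβ
      · refine ⟨0, fun x => ?_⟩
        rw [image_eq_zero_of_notMem_tsupport (f := φ) fun hx =>
          absurd ((hs hx).1.trans (hs hx).2) hαβ.not_ge]
        simp
      obtain ⟨D, hD⟩ := exists_bound_of_boundedVariation (locallyBoundedVariationOn_apply hu j)
        hα hβ hαβ
      have hD0 : 0 ≤ D := (norm_nonneg _).trans (hD α ⟨hα, left_mem_Icc.2 hαβ⟩)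
      refine ⟨C * D, fun x => ?_⟩
      by_cases hx : x ∈ tsupport φ
      · rw [norm_mul, Complex.norm_real]
        exact mul_le_mul (hC x) (hD x ⟨φ.tsupport_subset hx, hs hx⟩) (norm_nonneg _) hC0
      · rw [image_eq_zero_of_notMem_tsupport hx]
        simpa using mul_nonneg hC0 hD0
    exact ⟨(integrable_coeff q w i j).bdd_mul hm (Eventually.of_forall hB),
      integral_eq_integral_mul (integrable_coeff q w i j)
        (fun s hs => h.distMeasure_apply i j hs) (variation_absolutelyContinuous q w i j) hm
        (Eventually.of_forall hB)⟩
  rw [Finset.sum_congr rfl fun j _ => (hint j).2, ← integral_finsetSum _ fun j _ => (hint j).1]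
  refine integral_congr_ae (Eventually.of_forall fun x => ?_)
  simp only [Matrix.mulVec, dotProduct, Finset.mul_sum]
  exact Finset.sum_congr rfl fun j _ => by ring

/-- The distributional equation in terms of densities. -/
theorem solvesEquation_iff (h : IsRegularSystem J q w) (hu : IsBalancedBV a b u)
    (hf : f ∈ preL2 w) :
    SolvesEquation J q w u f ↔ IsSol a b (baseMeasure q w) J (coeff q w) (source q w f) u := by
  have hui : ∀ i, ∀ x ∈ (interval a b : Set ℝ), ∀ y ∈ (interval a b : Set ℝ),
      IntegrableOn (fun x => u x i) (Icc x y) := fun i x hx y hy =>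
    integrableOn_Icc_of_boundedVariation (ordConnected_interval a b)
      (locallyBoundedVariationOn_apply hu.1 i) hx hy
  have hk : ∀ x ∈ (interval a b : Set ℝ), ∀ y ∈ (interval a b : Set ℝ),
      IntegrableOn (fun t => coeff q w t *ᵥ u t) (Icc x y) (baseMeasure q w) := fun x hx y hy =>
    integrableOn_mulVec_of_boundedVariation (integrable_coeff q w) hu.1 hx hy
  -- For a fixed test function both sides are linear in the vectors `A` and `B` of integrals: `-J A
  -- = B` on one side and `-A = J⁻¹ B` on the other.
  have key : ∀ φ : 𝓓(interval a b, ℝ),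
      (∀ i, -(∫ x, ((deriv φ x : ℝ) : ℂ) * (J *ᵥ u x) i) +
        ∑ j, mulPair (q i j) (fun x => u x j) φ = weightPair w f φ i) ↔
      ∀ i, -(∫ x, ((deriv φ x : ℝ) : ℂ) * u x i) = ∫ x, (φ x : ℂ) *
        solDensity J (coeff q w) (source q w f) u x i ∂(baseMeasure q w) := by
    intro φ
    have hA : ∀ i, Integrable fun x => ((deriv φ x : ℝ) : ℂ) * u x i := fun i =>
      integrable_deriv_mul φ.contDiff φ.hasCompactSupport φ.tsupport_subset (hui i)
    have hB1 : ∀ i, Integrable (fun x => (φ x : ℂ) * source q w f x i) (baseMeasure q w) :=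
      fun i => integrable_test_mul (integrable_apply (integrable_source q hf) i) φ
    have hB2 : ∀ i, Integrable (fun x => (φ x : ℂ) * (coeff q w x *ᵥ u x) i) (baseMeasure q w) :=
      fun i => integrable_test_mul_of_integrableOn φ.continuous φ.hasCompactSupport
        φ.tsupport_subset fun x hx y hy => integrable_apply (hk x hx y hy) i
    set A : Fin n → ℂ := fun i => ∫ x, ((deriv φ x : ℝ) : ℂ) * u x i with hAdef
    set B : Fin n → ℂ := fun i => (∫ x, (φ x : ℂ) * source q w f x i ∂(baseMeasure q w)) -
      ∫ x, (φ x : ℂ) * (coeff q w x *ᵥ u x) i ∂(baseMeasure q w) with hBdef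
    have e1 : ∀ i, ∫ x, ((deriv φ x : ℝ) : ℂ) * (J *ᵥ u x) i = (J *ᵥ A) i := by
      intro i
      simp only [Matrix.mulVec, dotProduct, hAdef, Finset.mul_sum, ← integral_const_mul]
      rw [← integral_finsetSum _ fun j _ => (hA j).const_mul _]
      refine integral_congr_ae (Eventually.of_forall fun x => Finset.sum_congr rfl fun j _ => ?_)
      ring
    have e2 : ∀ i, ∫ x, (φ x : ℂ) * solDensity J (coeff q w) (source q w f) u x i
        ∂(baseMeasure q w) = (J⁻¹ *ᵥ B) i := by
      intro i
      have hB : ∀ j, Integrable (fun x => (φ x : ℂ) * source q w f x j -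
          (φ x : ℂ) * (coeff q w x *ᵥ u x) j) (baseMeasure q w) := fun j => (hB1 j).sub (hB2 j)
      have e3 : ∀ j, B j = ∫ x, ((φ x : ℂ) * source q w f x j -
          (φ x : ℂ) * (coeff q w x *ᵥ u x) j) ∂(baseMeasure q w) := fun j =>
        (integral_sub (hB1 j) (hB2 j)).symm
      change _ = ∑ j, J⁻¹ i j * B j
      simp only [e3, ← integral_const_mul]
      rw [← integral_finsetSum _ fun j _ => (hB j).const_mul _]
      refine integral_congr_ae (Eventually.of_forall fun x => ?_)
      simp only [solDensity]
      conv_lhs => rw [Matrix.mulVec, dotProduct, Finset.mul_sum]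
      refine Finset.sum_congr rfl fun j _ => ?_
      rw [Pi.sub_apply]
      ring
    have e4 : ∀ i, weightPair w f φ i = ∫ x, (φ x : ℂ) * source q w f x i ∂(baseMeasure q w) :=
      fun i => (integral_test_source q f φ i).symm
    have e5 : (∀ i, -(∫ x, ((deriv φ x : ℝ) : ℂ) * (J *ᵥ u x) i) +
        ∑ j, mulPair (q i j) (fun x => u x j) φ = weightPair w f φ i) ↔ -(J *ᵥ A) = B := by
      rw [funext_iff]
      refine forall_congr' fun i => ?_
      rw [e1, e4, h.sum_mulPair hu.1, hBdef, Pi.neg_apply, eq_sub_iff_add_eq]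
    have e6 : (∀ i, -(∫ x, ((deriv φ x : ℝ) : ℂ) * u x i) = ∫ x, (φ x : ℂ) *
        solDensity J (coeff q w) (source q w f) u x i ∂(baseMeasure q w)) ↔ -A = J⁻¹ *ᵥ B := by
      rw [funext_iff]
      refine forall_congr' fun i => ?_
      rw [e2, hAdef, Pi.neg_apply]
    rw [e5, e6]
    refine ⟨fun h1 => ?_, fun h1 => ?_⟩
    · rw [← h1, Matrix.mulVec_neg, Matrix.mulVec_mulVec, h.isSystem.inv_mul, Matrix.one_mulVec]
    · rw [← Matrix.mulVec_neg, h1, Matrix.mulVec_mulVec, h.isSystem.mul_inv, Matrix.one_mulVec]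
  refine ⟨fun h1 => ⟨hu, fun i φ hφ hφc hφI => ?_⟩, fun h1 φ i => ?_⟩
  · exact (key (toTest φ hφ hφc hφI)).1 (h1 _) i
  · exact (key φ).2 (fun i => h1.weak i φ φ.contDiff φ.hasCompactSupport φ.tsupport_subset) i

end IsRegularSystem

end Link

end

end DistSystem

namespace DistSystem

noncomputable section

/-! ### The form of 𝕁 and its signature -/

section Blocks

variable {n : ℕ} {J : Matrix (Fin n) (Fin n) ℂ}

lemma star_dotProduct_blockJ (y z : Fin n ⊕ Fin n → ℂ) :
    star y ⬝ᵥ (blockJ J *ᵥ z) = star (y ∘ Sum.inl) ⬝ᵥ (J *ᵥ (z ∘ Sum.inl)) -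
      star (y ∘ Sum.inr) ⬝ᵥ (J *ᵥ (z ∘ Sum.inr)) := by
  have h : blockJ J *ᵥ z = Sum.elim (J *ᵥ (z ∘ Sum.inl)) (-(J *ᵥ (z ∘ Sum.inr))) := by
    rw [blockJ, Matrix.fromBlocks_mulVec]
    simp [Matrix.neg_mulVec]
  rw [h]
  simp only [dotProduct, Fintype.sum_sum_type, Sum.elim_inl, Sum.elim_inr, Pi.star_apply,
    Function.comp_apply, Pi.neg_apply, mul_neg, Finset.sum_neg_distrib, sub_eq_add_neg]

lemma isUnit_blockJ (hJ : IsUnit J) : IsUnit (blockJ J) := by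
  rw [Matrix.isUnit_iff_isUnit_det] at hJ ⊢
  rw [blockJ, Matrix.det_fromBlocks_zero₂₁, Matrix.det_neg]
  exact hJ.mul ((isUnit_one.neg.pow _).mul hJ)

lemma conjTranspose_blockJ (hJ : Jᴴ = -J) : (blockJ J)ᴴ = -blockJ J := by
  rw [blockJ, Matrix.fromBlocks_conjTranspose, Matrix.fromBlocks_neg]
  simp [hJ]

/-- The form `i z* 𝕁 z` is definite on subspaces of half the dimension. -/
lemma exists_definite (hJ : IsUnit J) (hJ' : Jᴴ = -J) {s : ℝ} (hs : s ≠ 0) :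
    ∃ U : Submodule ℂ (Fin n ⊕ Fin n → ℂ),
      2 * Module.finrank ℂ U = Fintype.card (Fin n ⊕ Fin n) ∧
      ∀ z ∈ U, (s * (Complex.I * (star z ⬝ᵥ (blockJ J *ᵥ z))).re ≤ 0) → z = 0 := by
  -- On the vectors `(ξ + T ξ, ξ - T ξ)` only the mixed terms survive, and `i z* 𝕁 z` becomes `4 s
  -- ‖J ξ‖²` with the Euclidean norm; the sign of `s` selects the definite subspace.
  set T : Matrix (Fin n) (Fin n) ℂ := ((s : ℂ) * Complex.I) • J with hT
  let f : (Fin n → ℂ) →ₗ[ℂ] (Fin n ⊕ Fin n → ℂ) := LinearMap.pi fun i =>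
    Sum.elim (fun j => LinearMap.proj j ∘ₗ (1 + T).mulVecLin)
      (fun j => LinearMap.proj j ∘ₗ (1 - T).mulVecLin) i
  have hl : ∀ ξ, f ξ ∘ Sum.inl = ξ + T *ᵥ ξ := fun ξ => by
    funext j
    change ((1 + T) *ᵥ ξ) j = _
    rw [Matrix.add_mulVec, Matrix.one_mulVec]
  have hr : ∀ ξ, f ξ ∘ Sum.inr = ξ - T *ᵥ ξ := fun ξ => by
    funext j
    change ((1 - T) *ᵥ ξ) j = _
    rw [Matrix.sub_mulVec, Matrix.one_mulVec]
  have hf : Function.Injective f := by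
    rw [← LinearMap.ker_eq_bot, LinearMap.ker_eq_bot']
    intro ξ hξ
    have h1 := hl ξ
    have h2 := hr ξ
    rw [hξ] at h1 h2
    have h3 : (2 : ℂ) • ξ = 0 := by
      have h4 : (2 : ℂ) • ξ = (ξ + T *ᵥ ξ) + (ξ - T *ᵥ ξ) := by module
      rw [h4, ← h1, ← h2]
      funext j
      exact add_zero 0
    exact (smul_eq_zero.1 h3).resolve_left two_ne_zero
  refine ⟨LinearMap.range f, ?_, ?_⟩
  · rw [LinearMap.finrank_range_of_inj hf]
    simp
    ring
  · rintro _ ⟨ξ, rfl⟩ h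
    have h1 : Complex.I * (star (f ξ) ⬝ᵥ (blockJ J *ᵥ f ξ)) =
        4 * s * (star (J *ᵥ ξ) ⬝ᵥ (J *ᵥ ξ)) := by
      have e1 : star ξ ⬝ᵥ (J *ᵥ (J *ᵥ ξ)) = -(star (J *ᵥ ξ) ⬝ᵥ (J *ᵥ ξ)) := by
        rw [Matrix.star_mulVec, hJ', Matrix.vecMul_neg, neg_dotProduct, neg_neg,
          ← Matrix.dotProduct_mulVec]
      rw [star_dotProduct_blockJ, hl, hr]
      simp only [hT, Matrix.smul_mulVec, Matrix.mulVec_add, Matrix.mulVec_sub, Matrix.mulVec_smul,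
        star_add, star_sub, star_smul, add_dotProduct, sub_dotProduct, dotProduct_add,
        dotProduct_sub, smul_dotProduct, dotProduct_smul, e1, smul_eq_mul, star_mul',
        Complex.star_def, Complex.conj_I, Complex.conj_ofReal]
      linear_combination (-4 * (s : ℂ) * (star (J *ᵥ ξ) ⬝ᵥ (J *ᵥ ξ))) * Complex.I_sq
    have h2 : 0 ≤ star (J *ᵥ ξ) ⬝ᵥ (J *ᵥ ξ) := dotProduct_star_self_nonneg _
    obtain ⟨h3, h4⟩ := Complex.le_def.1 h2
    rw [h1] at h
    have h5 : ((4 * s * (star (J *ᵥ ξ) ⬝ᵥ (J *ᵥ ξ)) : ℂ)).re =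
        4 * s * (star (J *ᵥ ξ) ⬝ᵥ (J *ᵥ ξ)).re := by
      rw [show (4 * s : ℂ) = ((4 * s : ℝ) : ℂ) by push_cast; ring, Complex.re_ofReal_mul]
    rw [h5] at h
    rw [Complex.zero_re] at h3
    have h6 : (star (J *ᵥ ξ) ⬝ᵥ (J *ᵥ ξ)).re = 0 := by
      have : 0 < s ^ 2 := by positivity
      nlinarith
    have h7 : star (J *ᵥ ξ) ⬝ᵥ (J *ᵥ ξ) = 0 := Complex.ext h6 h4.symm
    rw [dotProduct_star_self_eq_zero] at h7
    have h8 : ξ = 0 := Matrix.mulVec_injective_of_isUnit hJ (h7.trans (Matrix.mulVec_zero _).symm)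
    rw [h8, map_zero]

end Blocks

/-! ### Boundary systems from initial value problems -/

section Abstract

/-- Riesz representation for functionals factoring through a finite-dimensional space. -/
lemma exists_inner_eq {E H : Type*} [AddCommGroup E] [Module ℂ E] [FiniteDimensional ℂ E]
    [NormedAddCommGroup H] [InnerProductSpace ℂ H] (Y : E →ₗ[ℂ] H) (ℓ : E →ₗ[ℂ] ℂ)
    (h : LinearMap.ker Y ≤ LinearMap.ker ℓ) : ∃ f : H, ∀ d, inner ℂ f (Y d) = ℓ d := by
  have h1 : ℓ ∈ LinearMap.range (Y.rangeRestrict.dualMap) := by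
    rw [LinearMap.range_dualMap_eq_dualAnnihilator_ker, Submodule.mem_dualAnnihilator,
      LinearMap.ker_rangeRestrict]
    exact fun d hd => h hd
  obtain ⟨r, hr⟩ := h1
  refine ⟨((InnerProductSpace.toDual ℂ (LinearMap.range Y)).symm (LinearMap.toContinuousLinearMap r) :
    LinearMap.range Y), fun d => ?_⟩
  have h2 := InnerProductSpace.toDual_symm_apply (𝕜 := ℂ) (x := Y.rangeRestrict d)
    (y := LinearMap.toContinuousLinearMap r)
  rw [← hr]
  exact h2

variable {n : ℕ} {J : Matrix (Fin n) (Fin n) ℂ} {P H : Type*} [AddCommGroup P] [Module ℂ P]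
  [NormedAddCommGroup H] [InnerProductSpace ℂ H]

/-- A boundary system from the solvability of initial value problems. -/
def BoundarySystem.ofInitialValues (hJ : IsUnit J) (hJ' : Jᴴ = -J) (c₁ c₂ : P →ₗ[ℂ] H)
    (β : P →ₗ[ℂ] (Fin n ⊕ Fin n → ℂ)) (ev : P →ₗ[ℂ] (Fin n → ℂ))
    (green : ∀ r p, inner ℂ (c₁ r) (c₂ p) - inner ℂ (c₂ r) (c₁ p) =
      -(star (β r) ⬝ᵥ (blockJ J *ᵥ β p)))
    (exists_eq : ∀ f d, ∃ p, c₂ p = f ∧ β p ∘ Sum.inl = d)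
    (unique : ∀ p, c₁ p = 0 → c₂ p = 0 → ev p = 0 → β p = 0) :
    BoundarySystem P H (Fin n ⊕ Fin n) (Fin n) (blockJ J) := by
  -- `L d` is a homogeneous solution with initial value `d`. The last clause says that the final
  -- values of these solutions span.
  have hL : ∃ L : (Fin n → ℂ) →ₗ[ℂ] P, (∀ d, c₂ (L d) = 0) ∧ (∀ d, β (L d) ∘ Sum.inl = d) ∧
      ∀ y, (∀ d, star (β (L d) ∘ Sum.inr) ⬝ᵥ y = 0) → y = 0 := by
    choose p hp hp' using fun j : Fin n => exists_eq 0 (Pi.single j 1)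
    have h1 : ∀ d, c₂ (Fintype.linearCombination ℂ p d) = 0 := fun d => by
      simp [Fintype.linearCombination_apply, hp]
    have h2 : ∀ d, β (Fintype.linearCombination ℂ p d) ∘ Sum.inl = d := fun d => by
      funext i
      have h3 : ∀ j, β (p j) (Sum.inl i) = (Pi.single j 1 : Fin n → ℂ) i := fun j =>
        congrFun (hp' j) i
      simp [Fintype.linearCombination_apply, h3, Pi.single_apply]
    refine ⟨Fintype.linearCombination ℂ p, h1, h2, fun y hy => ?_⟩
    -- The map from initial to final values. If the final value of `d` vanishes, Green's identity
    -- gives `e* J d = 0` for all `e`; hence `R` is injective, and surjective by dimension.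
    let R : (Fin n → ℂ) →ₗ[ℂ] (Fin n → ℂ) :=
      LinearMap.funLeft ℂ ℂ Sum.inr ∘ₗ β ∘ₗ Fintype.linearCombination ℂ p
    have hR : Function.Injective R := by
      rw [← LinearMap.ker_eq_bot, LinearMap.ker_eq_bot']
      intro d hd
      have h4 : ∀ e, star e ⬝ᵥ (J *ᵥ d) = 0 := fun e => by
        have h5 := green (Fintype.linearCombination ℂ p e) (Fintype.linearCombination ℂ p d)
        have h6 : β (Fintype.linearCombination ℂ p d) ∘ Sum.inr = 0 := hd
        rw [h1, h1, inner_zero_left, inner_zero_right, sub_zero, star_dotProduct_blockJ, h2, h2,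
          h6, Matrix.mulVec_zero, dotProduct_zero, sub_zero] at h5
        exact neg_eq_zero.1 h5.symm
      have h5 := h4 (J *ᵥ d)
      rw [dotProduct_star_self_eq_zero] at h5
      exact Matrix.mulVec_injective_of_isUnit hJ (h5.trans (Matrix.mulVec_zero _).symm)
    obtain ⟨d, hd⟩ := LinearMap.injective_iff_surjective.1 hR y
    have h6 := hy d
    change star (R d) ⬝ᵥ y = 0 at h6
    rwa [hd, dotProduct_star_self_eq_zero] at h6
  have hz : ∀ {L : (Fin n → ℂ) →ₗ[ℂ] P},
      (∀ y, (∀ d, star (β (L d) ∘ Sum.inr) ⬝ᵥ y = 0) → y = 0) → ∀ z : Fin n ⊕ Fin n → ℂ,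
      z ∘ Sum.inl = 0 → (∀ d, star (β (L d)) ⬝ᵥ (blockJ J *ᵥ z) = 0) → z = 0 := by
    intro L hL z hz h
    have h1 : J *ᵥ (z ∘ Sum.inr) = 0 := hL _ fun d => by
      have h2 := h d
      rwa [star_dotProduct_blockJ, hz, Matrix.mulVec_zero, dotProduct_zero, zero_sub,
        neg_eq_zero] at h2
    have h2 := Matrix.mulVec_injective_of_isUnit hJ (h1.trans (Matrix.mulVec_zero _).symm)
    funext i
    rcases i with i | i
    · exact congrFun hz i
    · exact congrFun h2 i
  refine
    { c₁, c₂, β, ev, green, unique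
      isUnit := isUnit_blockJ hJ
      skew := conjTranspose_blockJ hJ'
      perp_le := ?_
      closed := ?_
      exists_pos := ?_
      exists_neg := ?_ }
  · obtain ⟨L, hL1, hL2, hL3⟩ := hL
    intro z hzp
    -- If `c₁ (L d) = 0`, then `L d` represents zero and `z` is orthogonal to its boundary values,
    -- so the functional factors through `c₁ ∘ L`. The solution with source `f` and initial value
    -- that of `z` then has boundary values `z`: the difference has zero initial part and is
    -- orthogonal to all `β (L d)`.
    obtain ⟨f, hf⟩ := exists_inner_eq (c₁ ∘ₗ L)
      (-(dotProductBilin ℂ ℂ (star (blockJ J *ᵥ z)) ∘ₗ β ∘ₗ L)) (fun d hd => by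
        have h1 := hzp (β (L d)) ⟨L d, ⟨hd, hL1 d⟩, rfl⟩
        rw [Matrix.star_dotProduct, star_eq_zero] at h1
        exact neg_eq_zero.2 h1)
    obtain ⟨p, hp, hp'⟩ := exists_eq f (z ∘ Sum.inl)
    refine ⟨p, sub_eq_zero.1 (hz hL3 _ ?_ fun d => ?_)⟩
    · funext i
      exact sub_eq_zero.2 (congrFun hp' i)
    · have h1 := green (L d) p
      have h2 : inner ℂ f (c₁ (L d)) = -(star (blockJ J *ᵥ z) ⬝ᵥ β (L d)) := hf d
      rw [hL1, inner_zero_left, sub_zero, hp, ← inner_conj_symm, h2, map_neg, neg_inj] at h1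
      rw [Matrix.mulVec_sub, dotProduct_sub, ← h1, sub_eq_zero, Matrix.star_dotProduct]
      exact star_star _
  · obtain ⟨L, hL1, hL2, hL3⟩ := hL
    intro v g hvg
    obtain ⟨r, hr, -⟩ := exists_eq g 0
    -- The error `v - c₁ r` must be the class of a homogeneous solution. These classes form a
    -- finite-dimensional space, equal to its double orthogonal complement. Any `f` orthogonal to
    -- them is the source of an element with zero boundary values, on which the hypothesis and
    -- Green's identity can be used.
    have h1 : v - c₁ r ∈ LinearMap.range (c₁ ∘ₗ L) := by
      rw [← Submodule.orthogonal_orthogonal (LinearMap.range (c₁ ∘ₗ L)), Submodule.mem_orthogonal']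
      intro f hf
      obtain ⟨p, hp, hp'⟩ := exists_eq f 0
      have h2 : β p = 0 := hz hL3 _ hp' fun d => by
        have h3 := green (L d) p
        have h4 : inner ℂ (c₁ (L d)) f = 0 := (Submodule.mem_orthogonal _ _).1 hf _ ⟨d, rfl⟩
        rw [hL1, inner_zero_left, sub_zero, hp, h4] at h3
        exact neg_eq_zero.1 h3.symm
      have h3 := green r p
      rw [h2, Matrix.mulVec_zero, dotProduct_zero, neg_zero, hr, hvg p h2, hp] at h3
      rw [inner_sub_left, ← neg_sub, h3, neg_zero]
    obtain ⟨d, hd⟩ := h1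
    refine ⟨r + L d, ?_, ?_⟩
    · rw [map_add]
      exact (add_sub_cancel (c₁ r) v) ▸ congrArg (c₁ r + ·) hd
    · rw [map_add, hL1, add_zero, hr]
  · obtain ⟨U, hU, h⟩ := exists_definite hJ hJ' (s := 1) one_ne_zero
    exact ⟨U, hU, fun z hz h' => h z hz (by rwa [one_mul])⟩
  · obtain ⟨U, hU, h⟩ := exists_definite hJ hJ' (s := -1) (by norm_num)
    exact ⟨U, hU, fun z hz h' => h z hz (by linarith)⟩

end Abstract

end

end DistSystem

namespace DistSystem

noncomputable section

/-! ### Boundary values of functions on (a, b) -/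

section BoundaryValues

variable {a b : EReal} {n : ℕ} {u v : ℝ → Fin n → ℂ} {z z' : Fin n ⊕ Fin n → ℂ}

lemma HasBoundaryValues.congr (hne : (interval a b : Set ℝ).Nonempty)
    (hu : HasBoundaryValues a b u z) (h : EqOn u v (interval a b)) : HasBoundaryValues a b v z :=
  ⟨hu.1.congr' (by filter_upwards [interval_mem_start hne] with x hx using h hx),
    hu.2.congr' (by filter_upwards [interval_mem_end hne] with x hx using h hx)⟩

lemma HasBoundaryValues.unique (hne : (interval a b : Set ℝ).Nonempty)
    (hu : HasBoundaryValues a b u z) (hu' : HasBoundaryValues a b u z') : z = z' := by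
  have := neBot_start hne
  have := neBot_end hne
  have h1 := tendsto_nhds_unique hu.1 hu'.1
  have h2 := tendsto_nhds_unique hu.2 hu'.2
  funext i
  rcases i with i | i
  · exact congrFun h1 i
  · exact congrFun h2 i

lemma hasBoundaryValues_zero : HasBoundaryValues a b (0 : ℝ → Fin n → ℂ) 0 :=
  ⟨tendsto_const_nhds, tendsto_const_nhds⟩

end BoundaryValues

/-! ### Maximal solutions and Green's formula in L²(w) -/

section MaximalSolutions

variable {a b : EReal} {n : ℕ} {J : Matrix (Fin n) (Fin n) ℂ} {q w : DistMatrix a b n}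
  {f g u v : ℝ → Fin n → ℂ} {c d : Fin n → ℂ}

lemma source_add (q : DistMatrix a b n) (f g : ℝ → Fin n → ℂ) :
    source q w (f + g) = source q w f + source q w g := by
  funext x
  simp only [source, Pi.add_apply, Matrix.mulVec_add, smul_add]

lemma source_smul (q : DistMatrix a b n) (t : ℂ) (f : ℝ → Fin n → ℂ) :
    source q w (t • f) = t • source q w f := by
  funext x
  simp only [source, Pi.smul_apply, Matrix.mulVec_smul, smul_comm t]

lemma IsGlobalSol.zero {m : Measure ℝ} {k : ℝ → Matrix (Fin n) (Fin n) ℂ} :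
    IsGlobalSol m J k 0 0 0 := by
  have h0 : solDensity J k 0 (0 : ℝ → Fin n → ℂ) = 0 := by
    funext x
    simp [solDensity]
  refine ⟨by rw [h0]; exact integrable_zero _ _ _, fun x => ?_⟩
  rw [h0]
  simp [balPrim]

lemma IsGlobalSol.congr_source {m : Measure ℝ} {k : ℝ → Matrix (Fin n) (Fin n) ℂ}
    {F G : ℝ → Fin n → ℂ} (h : IsGlobalSol m J k F c u) (hFG : F =ᵐ[m] G) :
    IsGlobalSol m J k G c u := by
  have h1 : solDensity J k F u =ᵐ[m] solDensity J k G u := by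
    filter_upwards [hFG] with x hx
    simp only [solDensity, hx]
  refine ⟨h.integrable.congr h1, fun x => ?_⟩
  rw [h.eq_add, balPrim, balPrim, integral_congr_ae (ae_restrict_of_ae h1)]
  -- Functions that agree almost everywhere agree at every atom, and elsewhere the pointwise term of
  -- the balanced primitive is zero.
  by_cases hx : m {x} = 0
  · rw [measureReal_def, hx]
    simp
  · have h2 : solDensity J k F u x = solDensity J k G u x := by
      by_contra h3
      exact hx (measure_mono_null (singleton_subset_iff.2 h3) h1)
    rw [h2]

lemma mem_preL2_of_bounded (hu : AEStronglyMeasurable u (traceMeasure w)) {B : ℝ}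
    (hB : ∀ᵐ x ∂(traceMeasure w), ‖u x‖ ≤ B) : u ∈ preL2 w := by
  refine ⟨hu, ?_⟩
  have h1 := integrable_mulVec_of_bounded (integrable_density w) hu hB
  have h2 : ∀ i, Integrable (fun x => star (u x i) * (density w x *ᵥ u x) i) (traceMeasure w) := by
    intro i
    refine (integrable_apply h1 i).bdd_mul (c := B) (AEStronglyMeasurable.star (f := fun x => u x i)
      ((continuous_apply i).comp_aestronglyMeasurable hu)) ?_
    filter_upwards [hB] with x hx
    rw [norm_star]
    exact (norm_le_pi_norm _ i).trans hx
  exact integrable_finsetSum Finset.univ fun i _ => h2 i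

/-- For a semidefinite matrix the quadratic form vanishes exactly on the kernel, so zero norm means
that the distribution `w f` is zero rather than `f` itself. -/
lemma toL2_eq_zero_iff (hf : f ∈ preL2 w) :
    toL2 f hf = 0 ↔ ∀ᵐ x ∂(traceMeasure w), density w x *ᵥ f x = 0 := by
  have h1 : toL2 f hf = 0 ↔ ∫ x, (form w f f x).re ∂(traceMeasure w) = 0 := by
    rw [← norm_eq_zero, ← sq_eq_zero_iff]
    exact (norm_sq_eq_integral (⟨f, hf⟩ : PreL2 w)).congr_left
  rw [h1, integral_eq_zero_iff_of_nonneg (fun x => form_re_nonneg f x) (integrable_form w hf hf).re]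
  refine ⟨fun h => ?_, fun h => ?_⟩
  · filter_upwards [h] with x hx
    refine ((density_posSemidef w x).dotProduct_mulVec_zero_iff _).1 (Complex.ext hx ?_)
    exact (Complex.le_def.1 (form_self_nonneg w f x)).2.symm
  · filter_upwards [h] with x hx
    simp [form, hx]

lemma source_ae_eq_zero (q : DistMatrix a b n)
    (h : ∀ᵐ x ∂(traceMeasure w), density w x *ᵥ f x = 0) :
    source q w f =ᵐ[baseMeasure q w] 0 := by
  have h1 : ∀ᵐ x ∂(baseMeasure q w), (traceMeasure w).rnDeriv (baseMeasure q w) x ≠ 0 →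
      density w x *ᵥ f x = 0 := by
    rw [← Measure.withDensity_rnDeriv_eq _ _ (traceMeasure_absolutelyContinuous q w),
      ae_withDensity_iff (Measure.measurable_rnDeriv _ _)] at h
    exact h
  filter_upwards [h1] with x hx
  by_cases h2 : (traceMeasure w).rnDeriv (baseMeasure q w) x = 0
  · simp [source, h2]
  · simp [source, hx h2]

/-- `u` is a balanced solution of `J u' + q u = w f` with boundary values `z`. -/
structure IsMaximal (J : Matrix (Fin n) (Fin n) ℂ) (q w : DistMatrix a b n)
    (u f : ℝ → Fin n → ℂ) (z : Fin n ⊕ Fin n → ℂ) : Prop where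
  balanced : IsBalancedBV a b u
  equation : SolvesEquation J q w u f
  boundary : HasBoundaryValues a b u z

namespace IsRegularSystem

lemma exists_globalSol (h : IsRegularSystem J q w) (hne : (interval a b : Set ℝ).Nonempty)
    (hf : f ∈ preL2 w) (hu : IsBalancedBV a b u) (he : SolvesEquation J q w u f) :
    ∃ c U, IsGlobalSol (baseMeasure q w) J (coeff q w) (source q w f) c U ∧
      EqOn u U (interval a b) :=
  ((h.solvesEquation_iff hu hf).1 he).exists_globalSol h.isSystem (integrable_source q hf) hne

lemma isMaximal (h : IsRegularSystem J q w) (hne : (interval a b : Set ℝ).Nonempty)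
    (hf : f ∈ preL2 w) {U : ℝ → Fin n → ℂ}
    (hU : IsGlobalSol (baseMeasure q w) J (coeff q w) (source q w f) c U)
    (huU : EqOn u U (interval a b)) : IsMaximal J q w u f (Sum.elim c
      (c + ∫ x, solDensity J (coeff q w) (source q w f) U x ∂(baseMeasure q w))) := by
  have h1 : IsSol a b (baseMeasure q w) J (coeff q w) (source q w f) u := (hU.isSol a b).congr huU
  exact ⟨h1.balanced, (h.solvesEquation_iff h1.balanced hf).2 h1,
    (hU.hasBoundaryValues h.baseMeasure_compl).congr hne fun x hx => (huU hx).symm⟩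

lemma exists_boundaryValues (h : IsRegularSystem J q w) (hne : (interval a b : Set ℝ).Nonempty)
    (hf : f ∈ preL2 w) (hu : IsBalancedBV a b u) (he : SolvesEquation J q w u f) :
    ∃ z, HasBoundaryValues a b u z := by
  obtain ⟨c, U, hU, huU⟩ := h.exists_globalSol hne hf hu he
  exact ⟨_, (h.isMaximal hne hf hU huU).boundary⟩

lemma isMaximal_iff (h : IsRegularSystem J q w) (hne : (interval a b : Set ℝ).Nonempty)
    (hf : f ∈ preL2 w) {z : Fin n ⊕ Fin n → ℂ} : IsMaximal J q w u f z ↔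
      ∃ U, IsGlobalSol (baseMeasure q w) J (coeff q w) (source q w f) (z ∘ Sum.inl) U ∧
        EqOn u U (interval a b) ∧ z = Sum.elim (z ∘ Sum.inl) (z ∘ Sum.inl +
          ∫ x, solDensity J (coeff q w) (source q w f) U x ∂(baseMeasure q w)) := by
  constructor
  · intro hm
    obtain ⟨c, U, hU, huU⟩ := h.exists_globalSol hne hf hm.balanced hm.equation
    have hz := hm.boundary.unique hne (h.isMaximal hne hf hU huU).boundary
    have hc : z ∘ Sum.inl = c := by
      rw [hz]
      rfl
    rw [hc]
    exact ⟨U, hU, huU, hz⟩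
  · rintro ⟨U, hU, huU, hz⟩
    rw [hz]
    exact h.isMaximal hne hf hU huU

lemma isMaximal_zero (h : IsRegularSystem J q w) (hne : (interval a b : Set ℝ).Nonempty) :
    IsMaximal J q w 0 0 0 := by
  have h1 : source q w (0 : ℝ → Fin n → ℂ) = 0 := by
    have := source_smul (w := w) q 0 0
    simpa using this
  have h2 := h.isMaximal hne (preL2 w).zero_mem (c := 0) (U := 0) (by rw [h1]; exact IsGlobalSol.zero)
    (fun x _ => rfl : EqOn 0 _ _)
  exact ⟨h2.balanced, h2.equation, hasBoundaryValues_zero⟩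

lemma isMaximal_add (h : IsRegularSystem J q w) (hne : (interval a b : Set ℝ).Nonempty)
    (hf : f ∈ preL2 w) (hg : g ∈ preL2 w) {z z' : Fin n ⊕ Fin n → ℂ}
    (hu : IsMaximal J q w u f z) (hv : IsMaximal J q w v g z') :
    IsMaximal J q w (u + v) (f + g) (z + z') := by
  obtain ⟨U, hU, huU, -⟩ := (h.isMaximal_iff hne hf).1 hu
  obtain ⟨V, hV, hvV, -⟩ := (h.isMaximal_iff hne hg).1 hv
  have h1 := hU.add hV
  rw [← source_add] at h1
  have h2 := h.isMaximal hne ((preL2 w).add_mem hf hg) h1 (u := u + v) fun x hx => by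
    simp only [Pi.add_apply, huU hx, hvV hx]
  exact ⟨h2.balanced, h2.equation, hu.boundary.1.add hv.boundary.1,
    hu.boundary.2.add hv.boundary.2⟩

lemma isMaximal_smul (h : IsRegularSystem J q w) (hne : (interval a b : Set ℝ).Nonempty)
    (hf : f ∈ preL2 w) {z : Fin n ⊕ Fin n → ℂ} (t : ℂ) (hu : IsMaximal J q w u f z) :
    IsMaximal J q w (t • u) (t • f) (t • z) := by
  obtain ⟨U, hU, huU, -⟩ := (h.isMaximal_iff hne hf).1 hu
  have h1 := hU.smul t
  rw [← source_smul] at h1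
  have h2 := h.isMaximal hne ((preL2 w).smul_mem t hf) h1 (u := t • u) fun x hx => by
    simp only [Pi.smul_apply, huU hx]
  exact ⟨h2.balanced, h2.equation, hu.boundary.1.const_smul t, hu.boundary.2.const_smul t⟩

lemma exists_isMaximal (h : IsRegularSystem J q w) (hne : (interval a b : Set ℝ).Nonempty)
    (hf : f ∈ preL2 w) (c : Fin n → ℂ) :
    ∃ u ∈ preL2 w, ∃ z, IsMaximal J q w u f z ∧ z ∘ Sum.inl = c := by
  obtain ⟨u, hu, hum, B, hB⟩ := DistSystem.exists_globalSol h.isUnit (integrable_coeff q w)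
    (measurable_coeff q w) h.isSystem.regular (integrable_source q hf) c
  exact ⟨u, mem_preL2_of_bounded (hum.mono_ac (traceMeasure_absolutelyContinuous q w))
    (Eventually.of_forall hB), _, h.isMaximal hne hf hu fun x _ => rfl, rfl⟩

/-- Green's formula for maximal solutions. -/
lemma green (h : IsRegularSystem J q w) (hne : (interval a b : Set ℝ).Nonempty)
    (hu : u ∈ preL2 w) (hf : f ∈ preL2 w) (hv : v ∈ preL2 w) (hg : g ∈ preL2 w)
    {z z' : Fin n ⊕ Fin n → ℂ} (huf : IsMaximal J q w u f z) (hvg : IsMaximal J q w v g z') :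
    ∫ x, form w v f x ∂(traceMeasure w) - ∫ x, form w g u x ∂(traceMeasure w) =
      -(star z' ⬝ᵥ (blockJ J *ᵥ z)) := by
  obtain ⟨U, hU, huU, hz⟩ := (h.isMaximal_iff hne hf).1 huf
  obtain ⟨V, hV, hvV, hz'⟩ := (h.isMaximal_iff hne hg).1 hvg
  have h1 := hU.green h.isSystem hV
  have hI : ∀ᵐ x ∂(baseMeasure q w), x ∈ interval a b := by
    filter_upwards [measure_eq_zero_iff_ae_notMem.1 h.baseMeasure_compl] with x hx
    exact not_not.1 hx
  have e1 : ∫ x, form w g u x ∂(traceMeasure w) =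
      ∫ x, star (source q w g x) ⬝ᵥ u x ∂(baseMeasure q w) := by
    have h2 := congrArg star (integral_star_dotProduct_source (w := w) q g u)
    rw [integral_star, integral_star] at h2
    refine Eq.trans (integral_congr_ae (Eventually.of_forall fun x => ?_)) (h2.symm.trans
      (integral_congr_ae (Eventually.of_forall fun x => ?_)))
    · exact (form_symm w g u x).symm
    · exact (Matrix.star_dotProduct (source q w g x) (u x)).symm
  have i1 : Integrable (fun x => star (v x) ⬝ᵥ source q w f x) (baseMeasure q w) := by
    refine ((integrable_rnDeriv_smul_iff (traceMeasure_absolutelyContinuous q w)).2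
      (integrable_form w hv hf)).congr (Eventually.of_forall fun x => ?_)
    simp only [source, form, dotProduct_smul]
  have i2 : Integrable (fun x => star (source q w g x) ⬝ᵥ u x) (baseMeasure q w) := by
    refine ((integrable_rnDeriv_smul_iff (traceMeasure_absolutelyContinuous q w)).2
      (integrable_form w hg hu)).congr (Eventually.of_forall fun x => ?_)
    simp only [source, form, star_smul, smul_dotProduct, star_trivial]
    rw [Matrix.star_mulVec, (density_posSemidef w x).1.eq, Matrix.dotProduct_mulVec]
  rw [e1, ← integral_star_dotProduct_source q f v, ← integral_sub i1 i2, star_dotProduct_blockJ]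
  have e2 : z ∘ Sum.inr = z ∘ Sum.inl +
      ∫ x, solDensity J (coeff q w) (source q w f) U x ∂(baseMeasure q w) :=
    congrArg (· ∘ Sum.inr) hz
  have e3 : z' ∘ Sum.inr = z' ∘ Sum.inl +
      ∫ x, solDensity J (coeff q w) (source q w g) V x ∂(baseMeasure q w) :=
    congrArg (· ∘ Sum.inr) hz'
  rw [e2, e3, h1, sub_add_cancel_left, neg_neg]
  refine integral_congr_ae ?_
  filter_upwards [hI] with x hx
  rw [huU hx, hvV hx]

/-- A maximal solution with vanishing right-hand side which vanishes at some point has vanishing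
boundary values. -/
lemma boundaryValues_eq_zero (h : IsRegularSystem J q w) {x : ℝ} (hx : x ∈ interval a b)
    (hf : f ∈ preL2 w) (hf0 : toL2 f hf = 0) {z : Fin n ⊕ Fin n → ℂ}
    (hu : IsMaximal J q w u f z) (hux : u x = 0) : z = 0 := by
  have hne : (interval a b : Set ℝ).Nonempty := ⟨x, hx⟩
  obtain ⟨U, hU, huU, -⟩ := (h.isMaximal_iff hne hf).1 hu
  have h1 := (hU.congr_source (source_ae_eq_zero q ((toL2_eq_zero_iff hf).1 hf0))).isSol a b
  have h2 := h1.eq_leftLim_add (integrable_coeff q w) (integrable_zero _ _ _) hx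
  have h3 : U x = 0 := (huU hx).symm.trans hux
  rw [solDensity, h3, Matrix.mulVec_zero, Pi.zero_apply, sub_zero, Matrix.mulVec_zero, smul_zero,
    add_zero] at h2
  refine (hu.boundary.congr hne fun y hy => ?_).unique hne hasBoundaryValues_zero
  rw [huU hy]
  exact h1.eq_zero h.isSystem hx h2.symm hy

end IsRegularSystem

end MaximalSolutions

end

end DistSystem

namespace DistSystem

noncomputable section

/-! ### Matrices of boundary conditions and the subspaces they encode -/

section BoundaryConditions

variable {n m : ℕ} {J : Matrix (Fin n) (Fin n) ℂ}

/-- The space `𝕁⁻¹ A* ℂᵐ`. -/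
def coimage (J : Matrix (Fin n) (Fin n) ℂ) (A : Matrix (Fin m) (Fin n ⊕ Fin n) ℂ) :
    Submodule ℂ (Fin n ⊕ Fin n → ℂ) := LinearMap.range ((blockJ J)⁻¹ * Aᴴ).mulVecLin

/-- Since `𝕁` is skew-Hermitian, `(𝕁⁻¹ A*)* 𝕁 = -A`; orthogonality to the columns of `𝕁⁻¹ A*` is
therefore the boundary condition itself. -/
lemma mem_formPerp_coimage (hJ : IsUnit J) (hJ' : Jᴴ = -J)
    (A : Matrix (Fin m) (Fin n ⊕ Fin n) ℂ) (z : Fin n ⊕ Fin n → ℂ) :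
    z ∈ formPerp (blockJ J) (coimage J A) ↔ A *ᵥ z = 0 := by
  have hu := (Matrix.isUnit_iff_isUnit_det _).1 (isUnit_blockJ hJ)
  have h1 : ((blockJ J)⁻¹ * Aᴴ)ᴴ * blockJ J = -A := by
    rw [Matrix.conjTranspose_mul, Matrix.conjTranspose_conjTranspose,
      Matrix.conjTranspose_nonsing_inv, conjTranspose_blockJ hJ']
    have : (-blockJ J)⁻¹ = -(blockJ J)⁻¹ :=
      Matrix.inv_eq_right_inv (by simp [Matrix.mul_nonsing_inv _ hu])
    rw [this, Matrix.mul_neg, Matrix.neg_mul, Matrix.mul_assoc, Matrix.nonsing_inv_mul _ hu,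
      Matrix.mul_one]
  have h2 : ∀ y, star (((blockJ J)⁻¹ * Aᴴ) *ᵥ y) ⬝ᵥ (blockJ J *ᵥ z) = -(star y ⬝ᵥ (A *ᵥ z)) := by
    intro y
    rw [Matrix.star_mulVec, ← Matrix.dotProduct_mulVec, Matrix.mulVec_mulVec, h1,
      Matrix.neg_mulVec, dotProduct_neg]
  constructor
  · intro hz
    have h3 := hz _ ⟨A *ᵥ z, rfl⟩
    rw [Matrix.mulVecLin_apply, h2, neg_eq_zero, dotProduct_star_self_eq_zero] at h3
    exact h3
  · rintro hz _ ⟨y, rfl⟩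
    rw [Matrix.mulVecLin_apply, h2, hz, dotProduct_zero, neg_zero]

lemma finrank_coimage (hJ : IsUnit J) (A : Matrix (Fin m) (Fin n ⊕ Fin n) ℂ) :
    Module.finrank ℂ (coimage J A) = A.rank := by
  have hu := (Matrix.isUnit_iff_isUnit_det _).1 (isUnit_blockJ hJ)
  change ((blockJ J)⁻¹ * Aᴴ).rank = _
  rw [Matrix.rank_mul_eq_right_of_isUnit_det _ _ (Matrix.isUnit_nonsing_inv_det _ hu),
    Matrix.rank_conjTranspose]

/-- Property (3) is isotropy of the coimage, by inserting its own elements into the boundary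
condition. -/
lemma coimage_le_formPerp_iff (hJ : IsUnit J) (hJ' : Jᴴ = -J)
    (A : Matrix (Fin m) (Fin n ⊕ Fin n) ℂ) :
    coimage J A ≤ formPerp (blockJ J) (coimage J A) ↔ A * (blockJ J)⁻¹ * Aᴴ = 0 := by
  have h1 : ∀ y, A *ᵥ (((blockJ J)⁻¹ * Aᴴ) *ᵥ y) = (A * (blockJ J)⁻¹ * Aᴴ) *ᵥ y := fun y => by
    rw [Matrix.mulVec_mulVec, Matrix.mul_assoc]
  constructor
  · intro h
    refine Matrix.toLin'.injective (LinearMap.ext fun y => ?_)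
    have h2 := (mem_formPerp_coimage hJ hJ' A _).1 (h ⟨y, rfl⟩)
    rw [Matrix.mulVecLin_apply, h1] at h2
    rw [map_zero, Matrix.toLin'_apply, h2, LinearMap.zero_apply]
  · rintro h _ ⟨y, rfl⟩
    rw [mem_formPerp_coimage hJ hJ', Matrix.mulVecLin_apply, h1, h, Matrix.zero_mulVec]

/-- With a basis of `V` as the columns of `B`, the choice `A = (𝕁 B)*` gives `𝕁⁻¹ A* = B`. -/
lemma exists_coimage_eq (hJ : IsUnit J) (V : Submodule ℂ (Fin n ⊕ Fin n → ℂ))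
    (hV : Module.finrank ℂ V = m) :
    ∃ A : Matrix (Fin m) (Fin n ⊕ Fin n) ℂ, coimage J A = V := by
  have hu := (Matrix.isUnit_iff_isUnit_det _).1 (isUnit_blockJ hJ)
  let e := Module.finBasisOfFinrankEq ℂ V hV
  let B : Matrix (Fin n ⊕ Fin n) (Fin m) ℂ := Matrix.of fun i j => (e j : Fin n ⊕ Fin n → ℂ) i
  refine ⟨(blockJ J * B)ᴴ, ?_⟩
  rw [coimage, Matrix.conjTranspose_conjTranspose, ← Matrix.mul_assoc,
    Matrix.nonsing_inv_mul _ hu, Matrix.one_mul, Matrix.range_mulVecLin]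
  have h1 : range B.col = V.subtype '' range e := by
    rw [← range_comp]
    rfl
  rw [h1, ← Submodule.map_span, e.span_eq, Submodule.map_top, Submodule.range_subtype]

end BoundaryConditions

/-! ### The boundary system of the differential equation -/

section SolutionSpace

variable {a b : EReal} {n : ℕ} {J : Matrix (Fin n) (Fin n) ℂ} {q w : DistMatrix a b n}

lemma weightPair_eq_zero {f : ℝ → Fin n → ℂ} (hf : f ∈ preL2 w) (h0 : toL2 f hf = 0)
    (φ : 𝓓(interval a b, ℝ)) : weightPair w f φ = 0 := by
  funext i
  refine integral_eq_zero_of_ae ?_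
  filter_upwards [(toL2_eq_zero_iff hf).1 h0] with x hx
  simp [hx]

namespace IsRegularSystem

lemma toL2_eq_zero (h : IsRegularSystem J q w) {f : ℝ → Fin n → ℂ} (hf : f ∈ preL2 w)
    (h0 : ∀ φ, weightPair w f φ = 0) : toL2 f hf = 0 := by
  rw [toL2_eq_zero_iff]
  have h1 : ∀ i, ∀ᵐ x ∂(traceMeasure w), (density w x *ᵥ f x) i = 0 := fun i =>
    ae_eq_zero_of_integral_test_eq_zero h.traceMeasure_compl
      (integrable_apply (integrable_density_mulVec hf) i) fun φ => congrFun (h0 φ) i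
  filter_upwards [ae_all_iff.2 h1] with x hx
  exact funext hx

/-- Regular endpoints make every solution bounded, and `tr w` and the density are finite; so the
elements of `𝓛₀` belong to 𝓛²(w) automatically. -/
lemma mem_preL2 (h : IsRegularSystem J q w) (hne : (interval a b : Set ℝ).Nonempty)
    {u f : ℝ → Fin n → ℂ} (hf : f ∈ preL2 w) (hu : IsBalancedBV a b u)
    (he : SolvesEquation J q w u f) : u ∈ preL2 w := by
  obtain ⟨c, U, hU, huU⟩ := h.exists_globalSol hne hf hu he
  have hI : ∀ᵐ x ∂(traceMeasure w), U x = u x := by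
    filter_upwards [measure_eq_zero_iff_ae_notMem.1 h.traceMeasure_compl] with x hx
    exact (huU (not_not.1 hx)).symm
  have h1 : AEStronglyMeasurable U (baseMeasure q w) := by
    rw [hU.eq_fun]
    exact (aestronglyMeasurable_balPrim hU.integrable.1).const_add c
  refine mem_preL2_of_bounded ((h1.mono_ac (traceMeasure_absolutelyContinuous q w)).congr hI)
    (B := ‖c‖ + 2 * ∫ x, ‖solDensity J (coeff q w) (source q w f) U x‖ ∂(baseMeasure q w)) ?_
  filter_upwards [hI] with x hx
  rw [← hx, hU.eq_add]
  exact (norm_add_le _ _).trans (add_le_add_right (norm_balPrim_le hU.integrable x) _)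

/-- The space of the maximal solutions, with their right-hand sides and boundary values. -/
def solutionSpace (h : IsRegularSystem J q w) (hne : (interval a b : Set ℝ).Nonempty) :
    Submodule ℂ (PreL2 w × PreL2 w × (Fin n ⊕ Fin n → ℂ)) where
  carrier := {p | IsMaximal J q w p.1.toFun p.2.1.toFun p.2.2}
  zero_mem' := h.isMaximal_zero hne
  add_mem' {p r} hp hr := h.isMaximal_add hne p.2.1.mem r.2.1.mem hp hr
  smul_mem' t p hp := h.isMaximal_smul hne p.2.1.mem t hp

/-- The boundary system of a regular system. -/
def boundarySystem (h : IsRegularSystem J q w) {x₀ : ℝ} (hx₀ : x₀ ∈ interval a b) :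
    BoundarySystem (h.solutionSpace ⟨x₀, hx₀⟩) (L2 w) (Fin n ⊕ Fin n) (Fin n) (blockJ J) :=
  BoundarySystem.ofInitialValues h.isUnit h.skew
    ((SeparationQuotient.mkCLM ℂ (PreL2 w)).toLinearMap ∘ₗ LinearMap.fst ℂ _ _ ∘ₗ
      (h.solutionSpace ⟨x₀, hx₀⟩).subtype)
    ((SeparationQuotient.mkCLM ℂ (PreL2 w)).toLinearMap ∘ₗ LinearMap.fst ℂ _ _ ∘ₗ
      LinearMap.snd ℂ _ _ ∘ₗ (h.solutionSpace ⟨x₀, hx₀⟩).subtype)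
    (LinearMap.snd ℂ _ _ ∘ₗ LinearMap.snd ℂ _ _ ∘ₗ (h.solutionSpace ⟨x₀, hx₀⟩).subtype)
    { toFun := fun p => p.1.1.toFun x₀
      map_add' := fun _ _ => rfl
      map_smul' := fun _ _ => rfl }
    (fun r p => h.green ⟨x₀, hx₀⟩ p.1.1.mem p.1.2.1.mem r.1.1.mem r.1.2.1.mem p.2 r.2)
    (fun f d => by
      obtain ⟨f, rfl⟩ := SeparationQuotient.surjective_mk f
      obtain ⟨u, hu, z, hm, hz⟩ := h.exists_isMaximal ⟨x₀, hx₀⟩ f.mem d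
      exact ⟨⟨(⟨u, hu⟩, f, z), hm⟩, rfl, hz⟩)
    (fun p _ h2 h3 => h.boundaryValues_eq_zero hx₀ p.1.2.1.mem h2 p.2 h3)

variable (h : IsRegularSystem J q w) {x₀ : ℝ} (hx₀ : x₀ ∈ interval a b)

lemma range_rel : (LinearMap.range (h.boundarySystem hx₀).rel : Set (L2 w × L2 w)) =
    Tmax J q w := by
  ext x
  constructor
  · rintro ⟨p, rfl⟩
    exact ⟨_, _, p.1.1.mem, p.1.2.1.mem, p.2.balanced, p.2.equation, rfl⟩
  · rintro ⟨u, f, hu, hf, hb, he, rfl⟩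
    obtain ⟨z, hz⟩ := h.exists_boundaryValues ⟨x₀, hx₀⟩ hf hb he
    exact ⟨⟨(⟨u, hu⟩, ⟨f, hf⟩, z), hb, he, hz⟩, rfl⟩

lemma defect_eq (z : ℂ) : ((h.boundarySystem hx₀).defect z : Set (L2 w × L2 w)) =
    deficiencySpace J q w z := by
  ext x
  rw [SetLike.mem_coe, BoundarySystem.mem_defect, deficiencySpace, mem_ofPred_eq,
    ← h.range_rel hx₀]
  rfl

lemma nPlus_eq : nPlus J q w = Module.finrank ℂ ((h.boundarySystem hx₀).defect Complex.I) := by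
  rw [nPlus, ← h.defect_eq hx₀, Set.finrank, Submodule.span_eq]

lemma restriction_eq {m : ℕ} (A : Matrix (Fin m) (Fin n ⊕ Fin n) ℂ) :
    (h.boundarySystem hx₀).restriction (formPerp (blockJ J) (coimage J A)) =
      boundaryRelation J q w A := by
  ext x
  constructor
  · rintro ⟨p, rfl, hp⟩
    exact ⟨_, _, p.1.1.mem, p.1.2.1.mem, ⟨p.2.balanced, p.2.equation, rfl⟩, _, p.2.boundary,
      (mem_formPerp_coimage h.isUnit h.skew A _).1 hp⟩
  · rintro ⟨u, f, hu, hf, ⟨hb, he, rfl⟩, z, hz, hA⟩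
    exact ⟨⟨(⟨u, hu⟩, ⟨f, hf⟩, z), hb, he, hz⟩, rfl,
      (mem_formPerp_coimage h.isUnit h.skew A _).2 hA⟩

/-- The elements of the solution space that represent zero are the elements of `𝓛₀`. -/
lemma ev_mem_nullSolutions {y : h.solutionSpace ⟨x₀, hx₀⟩}
    (hy : y ∈ (h.boundarySystem hx₀).null) : y.1.1.toFun ∈ nullSolutions J q w := by
  obtain ⟨h1, h2⟩ := (h.boundarySystem hx₀).mem_null.1 hy
  refine ⟨y.2.balanced, fun φ i => ?_, weightPair_eq_zero y.1.1.mem h1⟩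
  have h3 : weightPair w (0 : ℝ → Fin n → ℂ) φ = 0 := by
    funext i
    simp [weightPair]
  rw [y.2.equation φ i, weightPair_eq_zero y.1.2.1.mem h2, h3]

lemma exists_mem_null {y : ℝ → Fin n → ℂ} (hy : y ∈ nullSolutions J q w) :
    ∃ r ∈ (h.boundarySystem hx₀).null, r.1.1.toFun = y := by
  have hm := h.mem_preL2 ⟨x₀, hx₀⟩ (preL2 w).zero_mem hy.1 hy.2.1
  obtain ⟨z, hz⟩ := h.exists_boundaryValues ⟨x₀, hx₀⟩ (preL2 w).zero_mem hy.1 hy.2.1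
  refine ⟨⟨(⟨y, hm⟩, 0, z), hy.1, hy.2.1, hz⟩, ?_, rfl⟩
  rw [BoundarySystem.mem_null]
  exact ⟨h.toL2_eq_zero hm hy.2.2, rfl⟩

/-- The values of the evaluation operator are the normalized representatives. Two normalized
representatives of one class differ by a normalized element representing zero, so they share their
boundary values. -/
lemma defectBdry_eq : ((h.boundarySystem hx₀).defectBdry : Set (Fin n ⊕ Fin n → ℂ)) =
    boundarySpace J q w x₀ := by
  set S := h.boundarySystem hx₀ with hS
  ext z
  rw [SetLike.mem_coe, BoundarySystem.mem_defectBdry]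
  constructor
  · rintro ⟨p, hp, r, hr, rfl⟩
    have h1 : ∀ {t e}, e ∈ S.eigen t → S.rel e ∈ deficiencySpace J q w t := by
      intro t e he
      rw [← h.defect_eq hx₀]
      exact ⟨e, he, rfl⟩
    refine ⟨S.rel p, h1 hp, S.rel r, h1 hr, (p + r).1.1.toFun,
      ⟨⟨_, (p + r).1.1.mem, (p + r).1.2.1.mem, (p + r).2.balanced, (p + r).2.equation, ?_⟩, ?_⟩,
      (p + r).2.boundary⟩
    · rw [← map_add]
      rfl
    · intro y hy
      obtain ⟨e, he, rfl⟩ := h.exists_mem_null hx₀ hy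
      exact S.normalized.add_mem hp.1 hr.1 e he
  · rintro ⟨p, hp, p', hp', v, ⟨⟨f, hv, hf, hb, he, hpp⟩, hn⟩, hz⟩
    rw [← h.defect_eq hx₀] at hp hp'
    obtain ⟨e, he1, rfl⟩ := hp
    obtain ⟨e', he1', rfl⟩ := hp'
    refine ⟨e, he1, e', he1', ?_⟩
    let r : h.solutionSpace ⟨x₀, hx₀⟩ := ⟨(⟨v, hv⟩, ⟨f, hf⟩, z), hb, he, hz⟩
    have hr : r ∈ S.normalized := fun y hy => hn _ (h.ev_mem_nullSolutions hx₀ hy)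
    have h1 : S.β (r - (e + e')) = 0 := by
      refine S.β_eq_zero_of_normalized
        (S.normalized.sub_mem hr (S.normalized.add_mem he1.1 he1'.1)) ?_
      rw [← S.rel_eq_zero, map_sub, map_add, hpp]
      exact sub_self _
    rw [map_sub, sub_eq_zero] at h1
    exact h1.symm

end IsRegularSystem

end SolutionSpace

end

end DistSystem

theorem theoremT5p3 {a b : EReal} {n : ℕ} (J : Matrix (Fin n) (Fin n) ℂ)
    (q w : DistSystem.DistMatrix a b n)
    (hJ : IsUnit J) (hJskew : Jᴴ = -J)
    (hq : DistSystem.IsHermitianDist q) (hw : DistSystem.IsNonnegDist w)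
    (hinv : ∀ x ∈ DistSystem.interval a b,
      IsUnit ((2 : ℂ) • J + DistSystem.jump q x) ∧ IsUnit ((2 : ℂ) • J - DistSystem.jump q x))
    (hreg_a : DistSystem.RegularLeft q ∧ DistSystem.RegularLeft w)
    (hreg_b : DistSystem.RegularRight q ∧ DistSystem.RegularRight w)
    (x₀ : ℝ) (hx₀ : x₀ ∈ DistSystem.interval a b) :
    (∀ A : Matrix (Fin (DistSystem.nPlus J q w)) (Fin n ⊕ Fin n) ℂ,
      DistSystem.IsBoundaryMatrix J q w x₀ A →
        DistSystem.IsSelfAdjointRestriction J q w (DistSystem.boundaryRelation J q w A)) ∧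
    (∀ T : Set (DistSystem.L2 w × DistSystem.L2 w),
      DistSystem.IsSelfAdjointRestriction J q w T →
        ∃ A : Matrix (Fin (DistSystem.nPlus J q w)) (Fin n ⊕ Fin n) ℂ,
          DistSystem.IsBoundaryMatrix J q w x₀ A ∧ T = DistSystem.boundaryRelation J q w A) := by
  have hr : ∀ {r : DistSystem.DistMatrix a b n}, DistSystem.RegularLeft r →
      DistSystem.RegularRight r → ∀ i j, DistSystem.IsRegularDist (r i j) := by
    rintro r ⟨c, hc, h1⟩ ⟨d, hd, h2⟩ i j
    exact ⟨⟨c, hc, h1 i j⟩, ⟨d, hd, h2 i j⟩⟩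
  have h : DistSystem.IsRegularSystem J q w :=
    ⟨hJ, hJskew, hq, fun x hx => (hinv x hx).1, hr hreg_a.1 hreg_b.1, hr hreg_a.2 hreg_b.2⟩
  set S := h.boundarySystem hx₀ with hS
  constructor
  · rintro A ⟨h1, h2, h3⟩
    -- The properties of `A` say that its coimage has dimension `n₊`, lies in the defect boundary
    -- space and is isotropic.
    rw [← h.restriction_eq hx₀ A]
    refine ⟨?_, S.restriction_selfAdjoint ?_ ?_ ?_⟩
    · rintro _ ⟨p, rfl, -⟩
      rw [← h.range_rel hx₀]
      exact ⟨p, rfl⟩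
    · rintro _ ⟨y, rfl⟩
      rw [← SetLike.mem_coe, h.defectBdry_eq hx₀]
      exact h2 y
    · rw [DistSystem.finrank_coimage hJ, h1, h.nPlus_eq hx₀]
    · rwa [DistSystem.coimage_le_formPerp_iff hJ hJskew]
  · rintro T ⟨hT, hT'⟩
    rw [← h.range_rel hx₀] at hT
    obtain ⟨V, hV, hd, hiso, hTV⟩ := S.exists_eq_restriction hT hT'
    obtain ⟨A, rfl⟩ := DistSystem.exists_coimage_eq (m := DistSystem.nPlus J q w) hJ V
      (hd.trans (h.nPlus_eq hx₀).symm)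
    refine ⟨A, ⟨?_, fun y => ?_, ?_⟩, ?_⟩
    · rw [← DistSystem.finrank_coimage hJ, hd, h.nPlus_eq hx₀]
    · rw [← h.defectBdry_eq hx₀]
      exact hV ⟨y, rfl⟩
    · rwa [← DistSystem.coimage_le_formPerp_iff hJ hJskew]
    · rw [hTV, h.restriction_eq hx₀]
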